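/- Let $A \neq 0$ be a unital C$^*$-algebra with trivial center $\mathcal Z(A)=\mathbb C 1$. *Correspondences.* A right $A$-$A$-correspondence is a right Hilbert C$^*$-module over $A$ with a unital $*$-homomorphism from $A$ to its adjointable operators. With adjointable $A$-$A$-bilinear maps as morphisms, adjoints as $*$-operation, the relative tensor product $\boxtimes_A$ (determined by $\langle k\boxtimes l, k'\boxtimes l'\rangle=\langle l,\langle k,k'\rangle l'\rangle$) and unit $A$, they form the C$^*$-tensor category $\mathsf{C^*Alg}_{A\text{-}A}$. *Bimodules.* Let $\mathsf{Bim_{fgp}}(A)$ be the full subcategory of those correspondences $K$ that are finitely generated projective as right and as left $A$-modules and are bi-Hilbertian, i.e. carry a left $A$-valued inner product, for which $A$ acts on the right by adjointable operators, inducing the same topology as the right inner product. Let $\operatorname{Irr}(A)$ be a set of representatives of the isomorphism classes of its irreducible objects (those $K$ with $\operatorname{End}(K)=\mathbb C\,\mathrm{id}_K\neq 0$). For $X\in\mathsf{Bim_{fgp}}(A)$, the intrinsic dimension $d_X$ is the minimum of $\|R\|\,\|\bar R\|$ over all $\bar X\in\mathsf{Bim_{fgp}}(A)$ and all solutions $R:A\to\bar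 X\boxtimes X$, $\bar R:A\to X\boxtimes\bar X$ of the conjugate equations $(\bar R^*\boxtimes \mathrm{id}_X)(\mathrm{id}_X\boxtimes R)=\mathrm{id}_X$ and $(R^*\boxtimes \mathrm{id}_{\bar X})(\mathrm{id}_{\bar X}\boxtimes \bar R)=\mathrm{id}_{\bar X}$. *Ind-completion.* The unitary ind-completion $\mathsf{Hilb}(\mathsf{Bim_{fgp}}(A))$ has as objects the linear $*$-functors $H:\mathsf{Bim_{fgp}}(A)^{\mathrm{op}}\to\mathsf{Hilb}$ and as morphisms the uniformly bounded natural transformations, with objectwise linear structure and adjoints. Its tensor structure extends that of $\mathsf{Bim_{fgp}}(A)$: for $X \in \operatorname{Irr}(A)$, $$(H\boxtimes G)(X)=\bigoplus^{\ell^2}_{Y,Z\in\operatorname{Irr}(A)}\mathsf{Bim_{fgp}}(A)(X,Y\boxtimes Z)\otimes H(Y)\otimes G(Z),$$ where $\mathsf{Bim_{fgp}}(A)(X,Y\boxtimes Z)$ has the trace inner product $\langle f,f'\rangle=d_X c$, $f^*f'=c\,\mathrm{id}_X$, and the inner product of the $(Y,Z)$-summand is scaled by $(d_Yd_Z)^{-1}$.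 For general $X,Y,Z \in \mathsf{Bim_{fgp}}(A)$ there are elements $f\otimes h\otimes g\in(H\boxtimes G)(X)$ with $f:X\to Y\boxtimes Z$, $h\in H(Y)$, $g\in G(Z)$, trilinear, natural in $X$, and balanced: $f\otimes H(a)h\otimes G(b)g=(a\boxtimes b)f\otimes h\otimes g$. The tensor product of morphisms is $f\otimes h\otimes g\mapsto f\otimes\eta h\otimes\theta g$. The unit is $X\mapsto \mathsf{Bim_{fgp}}(A)(X,A)$ with $f'f^*=\langle f,f'\rangle\,\mathrm{id}_A$. The unitors and the associator are induced by those of $\boxtimes_A$: $f\otimes e\otimes h\mapsto H(\lambda_Z(e\boxtimes \mathrm{id}_Z)f)h$ for $e:Y\to A$, $h\in H(Z)$, symmetrically for the right unitor, and $f\otimes(e\otimes h\otimes g)\otimes x\mapsto f'\otimes h\otimes(e'\otimes g\otimes x)$ whenever $\alpha(e\boxtimes\mathrm{id})f=(\mathrm{id}\boxtimes e')f'$. *Realization.* For an object $H$ and a morphism $\eta:H\to G$ of $\mathsf{Hilb}(\mathsf{Bim_{fgp}}(A))$, put $$|H|:=\bigoplus^{\ell^2}_{K\in\operatorname{Irr}(A)}K\otimes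 H(K),\qquad |\eta|:=\bigoplus_{K\in\operatorname{Irr}(A)}\mathrm{id}_K\otimes\eta_K:|H|\to|G|,$$ where $K\otimes H(K)$ is the external tensor product, $\langle k\otimes h,k'\otimes h'\rangle=\langle h,h'\rangle\langle k,k'\rangle$. **Proposition.** A set $\operatorname{Irr}(A)$ as above exists. For every such choice, $H\mapsto|H|$, $\eta\mapsto|\eta|$ is a fully faithful linear $*$-preserving functor $|\cdot|:\mathsf{Hilb}(\mathsf{Bim_{fgp}}(A))\to\mathsf{C^*Alg}_{A\text{-}A}$; a tensor structure on $\mathsf{Hilb}(\mathsf{Bim_{fgp}}(A))$ as described exists; and for every such structure $|\cdot|$ admits a unitary tensor structure, i.e. unitaries $A\to|\mathbb 1|$ and $|H|\boxtimes_A|G|\to|H\boxtimes G|$, natural in $H$ and $G$, satisfying the associativity and unit coherence conditions. Hence $|\cdot|$ is a fully faithful unitary tensor functor. -/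

import Mathlib

open CategoryTheory MonoidalCategory MulOpposite
open scoped InnerProductSpace

universe u

set_option linter.unusedSectionVars false

noncomputable section

namespace CStarCorr

/-! ### Semi-definite `A`-valued forms -/

/-- An `A`-valued positive semi-definite sesquilinear form (linear in the second variable). -/
structure IsSemiInner {A : Type*} [CStarAlgebra A] [PartialOrder A] {V : Type*} [AddCommGroup V]
    [Module ℂ V] (B : V → V → A) : Prop where
  add_right : ∀ x y z, B x (y + z) = B x y + B x z
  smul_right : ∀ (c : ℂ) x y, B x (c • y) = c • B x y
  star_eq : ∀ x y, star (B x y) = B y x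
  nonneg : ∀ x, 0 ≤ B x x

namespace IsSemiInner

variable {A : Type*} [CStarAlgebra A] [PartialOrder A] [StarOrderedRing A]
  {V : Type*} [AddCommGroup V] [Module ℂ V] {B : V → V → A}

lemma zero_right (hB : IsSemiInner B) (x : V) : B x 0 = 0 := by simpa using hB.smul_right 0 x 0

lemma zero_left (hB : IsSemiInner B) (x : V) : B 0 x = 0 := by rw [← hB.star_eq, hB.zero_right, star_zero]

lemma neg_right (hB : IsSemiInner B) (x y : V) : B x (-y) = -B x y := by simpa using hB.smul_right (-1) x y

lemma sub_right (hB : IsSemiInner B) (x y z : V) : B x (y - z) = B x y - B x z := by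
  rw [sub_eq_add_neg, hB.add_right, hB.neg_right, sub_eq_add_neg]

lemma add_left (hB : IsSemiInner B) (x y z : V) : B (x + y) z = B x z + B y z := by
  rw [← hB.star_eq, hB.add_right, star_add, hB.star_eq, hB.star_eq]

lemma smul_left (hB : IsSemiInner B) (c : ℂ) (x y : V) : B (c • x) y = star c • B x y := by
  rw [← hB.star_eq, hB.smul_right, star_smul, hB.star_eq]

lemma sub_left (hB : IsSemiInner B) (x y z : V) : B (x - y) z = B x z - B y z := by
  rw [← hB.star_eq, hB.sub_right, star_sub, hB.star_eq, hB.star_eq]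

/-- The seminorm `‖B x x‖ ^ (1/2)`. -/
def sn (_ : IsSemiInner B) (x : V) : ℝ := √‖B x x‖

lemma sn_nonneg (hB : IsSemiInner B) (x : V) : 0 ≤ hB.sn x := Real.sqrt_nonneg _

lemma sn_sq (hB : IsSemiInner B) (x : V) : hB.sn x ^ 2 = ‖B x x‖ := Real.sq_sqrt (norm_nonneg _)

/-- Cauchy-Schwarz, given right multiplication operators `R a`. -/
lemma cauchy_schwarz (hB : IsSemiInner B) (R : A → V → V) (hR : ∀ a x y, B x (R a y) = B x y * a) (x y : V) :
    ‖B x y‖ ≤ hB.sn x * hB.sn y := by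
  have hRl : ∀ a x y, B (R a x) y = star a * B x y := fun a x y => by
    rw [← hB.star_eq, hR, star_mul, hB.star_eq]
  set b := B x y with hb
  -- `0 ≤ ⟨t x - y b*, t x - y b*⟩` with `t = s + ‖y‖ ^ 2`
  have key : ∀ t : ℝ, ‖B y y‖ ≤ t → 0 < t → ‖b‖ ^ 2 ≤ t * ‖B x x‖ := by
    intro t ht ht0
    have h0 := hB.nonneg ((t : ℂ) • x - R (star b) y)
    have e : B ((t : ℂ) • x - R (star b) y) ((t : ℂ) • x - R (star b) y)
        = t ^ 2 • B x x - (2 * t) • (b * star b) + b * B y y * star b := by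
      have e1 : B y x = star b := by rw [hb, hB.star_eq]
      have e2 : ∀ z : A, (t : ℂ) • z = t • z := fun z => Complex.coe_smul t z
      rw [hB.sub_left, hB.sub_right, hB.sub_right, hB.smul_left, hB.smul_left, hB.smul_right,
        hRl, hRl, hR, hR, hB.smul_right, e1, ← hb, star_star, Complex.star_def,
        Complex.conj_ofReal, e2, e2, e2, e2, two_mul, add_smul, pow_two, smul_smul,
        mul_smul_comm, ← mul_assoc]
      abel
    rw [e] at h0
    have h1 : b * B y y * star b ≤ t • (b * star b) := by
      calc b * B y y * star b ≤ ‖B y y‖ • (b * star b) := by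
            have := CStarAlgebra.star_right_conjugate_le_norm_smul (a := b) (b := B y y)
              (hb := IsSelfAdjoint.of_nonneg (hB.nonneg y))
            exact this
        _ ≤ t • (b * star b) := by
            exact smul_le_smul_of_nonneg_right ht (mul_star_self_nonneg b)
    have h2 : t • (b * star b) ≤ t ^ 2 • B x x := by
      have h3 : 0 ≤ t ^ 2 • B x x - (2 * t) • (b * star b) + t • (b * star b) :=
        h0.trans (by gcongr)
      have h4 : t ^ 2 • B x x - (2 * t) • (b * star b) + t • (b * star b)
          = t ^ 2 • B x x - t • (b * star b) := by
        rw [two_mul, add_smul]; abel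
      rw [h4] at h3
      exact sub_nonneg.mp h3
    have h5 : ‖t • (b * star b)‖ ≤ ‖t ^ 2 • B x x‖ :=
      CStarAlgebra.norm_le_norm_of_nonneg_of_le
        (smul_nonneg ht0.le (mul_star_self_nonneg b)) h2
    rw [norm_smul, norm_smul, CStarRing.norm_self_mul_star, Real.norm_of_nonneg ht0.le,
      Real.norm_of_nonneg (by positivity), pow_two t, mul_assoc] at h5
    have := le_of_mul_le_mul_left h5 ht0
    rw [pow_two]; exact this
  have key2 : ‖b‖ ^ 2 ≤ ‖B y y‖ * ‖B x x‖ := by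
    refine le_of_forall_pos_le_add fun ε hε => ?_
    have hd : 0 < ε / (‖B x x‖ + 1) := by positivity
    have := key (‖B y y‖ + ε / (‖B x x‖ + 1)) (by linarith) (by positivity)
    refine this.trans ?_
    rw [add_mul]
    gcongr
    rw [div_mul_eq_mul_div, div_le_iff₀ (by positivity)]
    nlinarith [norm_nonneg (B x x)]
  refine le_of_sq_le_sq ?_ (mul_nonneg (hB.sn_nonneg _) (hB.sn_nonneg _))
  rw [mul_pow, hB.sn_sq, hB.sn_sq, mul_comm]
  exact key2

lemma sn_smul (hB : IsSemiInner B) (c : ℂ) (x : V) : hB.sn (c • x) = ‖c‖ * hB.sn x := by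
  rw [sn, hB.smul_left, hB.smul_right, norm_smul, norm_smul, norm_star, ← mul_assoc,
    Real.sqrt_mul (by positivity), Real.sqrt_mul_self (norm_nonneg _), sn]

lemma sn_add_le (hB : IsSemiInner B) (R : A → V → V) (hR : ∀ a x y, B x (R a y) = B x y * a) (x y : V) :
    hB.sn (x + y) ≤ hB.sn x + hB.sn y := by
  refine le_of_sq_le_sq ?_ (add_nonneg (hB.sn_nonneg _) (hB.sn_nonneg _))
  rw [hB.sn_sq, hB.add_left, hB.add_right, hB.add_right]
  have h1 := hB.cauchy_schwarz R hR x y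
  have h2 := hB.cauchy_schwarz R hR y x
  have h3 := hB.sn_sq x
  have h4 := hB.sn_sq y
  calc ‖B x x + B x y + (B y x + B y y)‖ ≤ (‖B x x‖ + ‖B x y‖) + (‖B y x‖ + ‖B y y‖) :=
        (norm_add_le _ _).trans (add_le_add (norm_add_le _ _) (norm_add_le _ _))
    _ ≤ (hB.sn x + hB.sn y) ^ 2 := by nlinarith

/-- A `*`-compatible action of `A` by operators is contractive. -/
lemma sn_action_le (hB : IsSemiInner B) (L : A → V → V) (hL : ∀ a x y, B (L a x) y = B x (L (star a) y))
    (hadd : ∀ a b x y, B x (L (a + b) y) = B x (L a y) + B x (L b y))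
    (hmul : ∀ a b x y, B x (L (a * b) y) = B x (L a (L b y)))
    (hsc : ∀ (c : ℂ) x y, B x (L (algebraMap ℂ A c) y) = c • B x y) (a : A) (x : V) :
    hB.sn (L a x) ≤ ‖a‖ * hB.sn x := by
  have hpos : 0 ≤ algebraMap ℝ A (‖a‖ ^ 2) - star a * a := by
    rw [sub_nonneg]
    have := CStarAlgebra.star_mul_le_algebraMap_norm_sq (a := a)
    exact this
  obtain ⟨b, hb⟩ := CStarAlgebra.nonneg_iff_eq_star_mul_self.mp hpos
  have h1 : B (L a x) (L a x) ≤ ‖a‖ ^ 2 • B x x := by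
    have hb' : star b * b + star a * a = algebraMap ℂ A ((‖a‖ ^ 2 : ℝ) : ℂ) := by
      rw [← hb, sub_add_cancel, Algebra.algebraMap_eq_smul_one, Algebra.algebraMap_eq_smul_one,
        Complex.coe_smul]
    have h2 : B (L b x) (L b x) + B (L a x) (L a x) = ‖a‖ ^ 2 • B x x := by
      rw [hL, hL, ← hmul, ← hmul, ← hadd, hb', hsc, Complex.coe_smul]
    rw [← h2]
    exact le_add_of_nonneg_left (hB.nonneg _)
  refine le_of_sq_le_sq ?_ (mul_nonneg (norm_nonneg _) (hB.sn_nonneg _))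
  rw [mul_pow, hB.sn_sq, hB.sn_sq]
  calc ‖B (L a x) (L a x)‖ ≤ ‖‖a‖ ^ 2 • B x x‖ :=
        CStarAlgebra.norm_le_norm_of_nonneg_of_le (hB.nonneg _) h1
    _ = ‖a‖ ^ 2 * ‖B x x‖ := by rw [norm_smul, Real.norm_of_nonneg (by positivity)]

end IsSemiInner

/-! ### Right `A`-`A`-correspondences -/

/-- A right `A`-`A`-correspondence: a right Hilbert C⋆-module `K` over `A` (the right action is
encoded as an action of `Aᵐᵒᵖ`, the inner product is `A`-linear in the second variable and `K` is
complete for the norm `‖⟨x, x⟩‖ ^ (1/2)`), with a unital `*`-representation of `A` by adjointable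
operators. -/
structure Corr (A : Type u) [CStarAlgebra A] [PartialOrder A] where
  carrier : Type u
  [group : NormedAddCommGroup carrier]
  [space : NormedSpace ℂ carrier]
  [complete : CompleteSpace carrier]
  [leftModule : Module A carrier]
  [rightModule : Module Aᵐᵒᵖ carrier]
  [bimodule : SMulCommClass A Aᵐᵒᵖ carrier]
  [leftTower : IsScalarTower ℂ A carrier]
  [rightTower : IsScalarTower ℂ Aᵐᵒᵖ carrier]
  ip : carrier → carrier → A
  ip_add_right : ∀ x y z, ip x (y + z) = ip x y + ip x z
  ip_smul_right : ∀ (a : A) x y, ip x (op a • y) = ip x y * a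
  star_ip : ∀ x y, star (ip x y) = ip y x
  ip_nonneg : ∀ x, 0 ≤ ip x x
  norm_sq : ∀ x, ‖x‖ ^ 2 = ‖ip x x‖
  ip_left : ∀ (a : A) x y, ip (a • x) y = ip x (star a • y)

namespace Corr

attribute [instance] Corr.group Corr.space Corr.complete Corr.leftModule Corr.rightModule
  Corr.bimodule Corr.leftTower Corr.rightTower

instance {A : Type u} [CStarAlgebra A] [PartialOrder A] : CoeSort (Corr A) (Type u) := ⟨carrier⟩

variable {A : Type u} [CStarAlgebra A] [PartialOrder A] [StarOrderedRing A]

lemma isSemiInner (K : Corr A) : IsSemiInner K.ip where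
  add_right := K.ip_add_right
  smul_right c x y := by
    have : c • y = op (algebraMap ℂ A c) • y := by
      rw [Algebra.algebraMap_eq_smul_one, op_smul, smul_assoc, op_one, one_smul]
    rw [this, K.ip_smul_right, ← Algebra.commutes, ← Algebra.smul_def]
  star_eq := K.star_ip
  nonneg := K.ip_nonneg

lemma norm_eq (K : Corr A) (x : K) : ‖x‖ = K.isSemiInner.sn x := by
  rw [IsSemiInner.sn, ← K.norm_sq, Real.sqrt_sq (norm_nonneg x)]

lemma norm_ip_le (K : Corr A) (x y : K) : ‖K.ip x y‖ ≤ ‖x‖ * ‖y‖ := by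
  rw [K.norm_eq, K.norm_eq]
  exact K.isSemiInner.cauchy_schwarz (fun a x => op a • x) (fun a x y => K.ip_smul_right a x y) x y

lemma norm_smul_le' (K : Corr A) (a : A) (x : K) : ‖a • x‖ ≤ ‖a‖ * ‖x‖ := by
  rw [K.norm_eq, K.norm_eq]
  refine K.isSemiInner.sn_action_le (fun a x => a • x) (fun a x y => K.ip_left a x y)
    (fun a b x y => by rw [add_smul, K.ip_add_right]) (fun a b x y => by rw [mul_smul])
    (fun c x y => ?_) a x
  rw [Algebra.algebraMap_eq_smul_one, smul_assoc, one_smul, K.isSemiInner.smul_right]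

/-- The inner product as a continuous sesquilinear map. -/
def ipL (K : Corr A) : K →L⋆[ℂ] K →L[ℂ] A :=
  LinearMap.mkContinuous₂ (LinearMap.mk₂'ₛₗ (starRingEnd ℂ) (RingHom.id ℂ) K.ip
    K.isSemiInner.add_left K.isSemiInner.smul_left K.isSemiInner.add_right
    K.isSemiInner.smul_right) 1 (fun x y => by
      rw [one_mul]; exact K.norm_ip_le x y)

@[simp] lemma ipL_apply (K : Corr A) (x y : K) : K.ipL x y = K.ip x y := rfl

/-- The left action of `a` as a continuous linear map. -/
def lsmulL (K : Corr A) (a : A) : K →L[ℂ] K :=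
  LinearMap.mkContinuous
    { toFun := fun x => a • x
      map_add' := smul_add a
      map_smul' := fun c x => by
        rw [RingHom.id_apply, smul_comm] }
    ‖a‖ (fun x => K.norm_smul_le' a x)

@[simp] lemma lsmulL_apply (K : Corr A) (a : A) (x : K) : K.lsmulL a x = a • x := rfl

lemma ip_ext (K : Corr A) {x y : K} (h : ∀ z, K.ip z x = K.ip z y) : x = y := by
  rw [← sub_eq_zero, ← norm_eq_zero, ← sq_eq_zero_iff, K.norm_sq, K.isSemiInner.sub_right, h,
    sub_self, norm_zero]

lemma ip_ext_left (K : Corr A) {x y : K} (h : ∀ z, K.ip x z = K.ip y z) : x = y :=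
  K.ip_ext fun z => by rw [← K.star_ip, h, K.star_ip]

/-- The space of adjointable `A`-`A`-bilinear maps `K → L`. -/
def homSubmodule (K L : Corr A) : Submodule ℂ (K →L[ℂ] L) where
  carrier := {T | (∀ (a : A) x, T (a • x) = a • T x) ∧ (∀ (a : A) x, T (op a • x) = op a • T x) ∧
    ∃ S : L →L[ℂ] K, ∀ x y, L.ip (T x) y = K.ip x (S y)}
  add_mem' := by
    rintro T T' ⟨h1, h2, S, h3⟩ ⟨h1', h2', S', h3'⟩
    refine ⟨fun a x => by simp [h1, h1'], fun a x => by simp [h2, h2'], S + S', fun x y => ?_⟩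
    simp [L.isSemiInner.add_left, K.isSemiInner.add_right, h3, h3']
  zero_mem' := ⟨by simp, by simp, 0, fun x y => by
    simp [L.isSemiInner.zero_left, K.isSemiInner.zero_right]⟩
  smul_mem' := by
    rintro c T ⟨h1, h2, S, h3⟩
    refine ⟨fun a x => ?_, fun a x => ?_, star c • S, fun x y => ?_⟩
    · change c • T (a • x) = a • (c • T x)
      rw [h1, smul_comm]
    · change c • T (op a • x) = op a • (c • T x)
      rw [h2, smul_comm]
    · simp [L.isSemiInner.smul_left, K.isSemiInner.smul_right, h3]

/-- Morphisms of correspondences: adjointable `A`-`A`-bilinear maps. -/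
def Hom (K L : Corr A) : Type u := homSubmodule K L

instance (K L : Corr A) : AddCommGroup (Hom K L) := inferInstanceAs (AddCommGroup (homSubmodule K L))
instance (K L : Corr A) : Module ℂ (Hom K L) := inferInstanceAs (Module ℂ (homSubmodule K L))

/-- The underlying bounded operator. -/
def Hom.toCLM {K L : Corr A} (f : Hom K L) : K →L[ℂ] L := f.1

instance (K L : Corr A) : CoeFun (Hom K L) (fun _ => K → L) := ⟨fun f => f.toCLM⟩

instance : Category (Corr A) where
  Hom := Hom
  id K := ⟨ContinuousLinearMap.id ℂ K, fun _ _ => rfl, fun _ _ => rfl,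
    ContinuousLinearMap.id ℂ K, fun _ _ => rfl⟩
  comp f g := ⟨g.1.comp f.1, fun a x => by
      rw [ContinuousLinearMap.comp_apply, f.2.1, g.2.1]; rfl, fun a x => by
      rw [ContinuousLinearMap.comp_apply, f.2.2.1, g.2.2.1]; rfl, by
      obtain ⟨S, hS⟩ := f.2.2.2
      obtain ⟨T, hT⟩ := g.2.2.2
      exact ⟨S.comp T, fun x y => by
        rw [ContinuousLinearMap.comp_apply, hT, hS]; rfl⟩⟩

/-- The operator underlying a morphism of correspondences. -/
def op' {K L : Corr A} (f : K ⟶ L) : K →L[ℂ] L := Hom.toCLM f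

instance (K L : Corr A) : CoeFun (K ⟶ L) (fun _ => K → L) := ⟨fun f => op' f⟩

@[ext] lemma hom_ext {K L : Corr A} {f g : K ⟶ L} (h : ∀ x, f x = g x) : f = g :=
  Subtype.ext (ContinuousLinearMap.ext h)

@[simp] lemma id_apply (K : Corr A) (x : K) : (𝟙 K : K ⟶ K) x = x := rfl
@[simp] lemma comp_apply {K L M : Corr A} (f : K ⟶ L) (g : L ⟶ M) (x : K) :
    (f ≫ g) x = g (f x) := rfl

instance : Preadditive (Corr A) where
  homGroup K L := inferInstanceAs (AddCommGroup (Hom K L))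
  add_comp _ _ _ f f' g := hom_ext fun x => (op' g).map_add (f x) (f' x)
  comp_add _ _ _ _ _ _ := rfl

instance : Linear ℂ (Corr A) where
  homModule K L := inferInstanceAs (Module ℂ (Hom K L))
  smul_comp _ _ _ c f g := hom_ext fun x => (op' g).map_smul c (f x)
  comp_smul _ _ _ _ _ _ := rfl

@[simp] lemma add_apply {K L : Corr A} (f g : K ⟶ L) (x : K) : (f + g) x = f x + g x := rfl
@[simp] lemma smul_apply {K L : Corr A} (c : ℂ) (f : K ⟶ L) (x : K) : (c • f) x = c • f x := rfl
@[simp] lemma map_lsmul {K L : Corr A} (f : K ⟶ L) (a : A) (x : K) : f (a • x) = a • f x :=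
  f.2.1 a x
@[simp] lemma map_rsmul {K L : Corr A} (f : K ⟶ L) (a : A) (x : K) :
    f (op a • x) = op a • f x := f.2.2.1 a x

/-- A constructor for morphisms: right linearity is automatic. -/
def mkHom {K L : Corr A} (T : K →L[ℂ] L) (S : L →L[ℂ] K)
    (h : ∀ x y, L.ip (T x) y = K.ip x (S y)) (hl : ∀ (a : A) x, T (a • x) = a • T x) : K ⟶ L :=
  ⟨T, hl, fun a x => L.ip_ext_left fun z => by
    have hr : ∀ (M : Corr A) (x y : M), M.ip (op a • x) y = star a * M.ip x y := fun M x y => by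
      rw [← M.star_ip, M.ip_smul_right, star_mul, M.star_ip]
    rw [h, hr, hr, h], S, h⟩

@[simp] lemma mkHom_apply {K L : Corr A} (T : K →L[ℂ] L) (S : L →L[ℂ] K)
    (h : ∀ x y, L.ip (T x) y = K.ip x (S y)) (hl : ∀ (a : A) x, T (a • x) = a • T x) (x : K) :
    mkHom T S h hl x = T x := rfl

/-- The adjoint of an adjointable bimodule map. -/
def adj {K L : Corr A} (f : K ⟶ L) : L ⟶ K :=
  mkHom f.2.2.2.choose (op' f)
    (fun x y => by
      rw [← K.star_ip, ← f.2.2.2.choose_spec, L.star_ip]; rfl)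
    (fun a x => K.ip_ext fun z => by
      have h := f.2.2.2.choose_spec
      have hs : ∀ (M : Corr A) (x y : M), M.ip x (a • y) = M.ip (star a • x) y := fun M x y => by
        rw [M.ip_left, star_star]
      rw [← h, hs, hs, ← h, f.2.1])

lemma ip_adj {K L : Corr A} (f : K ⟶ L) (x : K) (y : L) : L.ip (f x) y = K.ip x (adj f y) :=
  f.2.2.2.choose_spec x y

lemma adj_ip {K L : Corr A} (f : K ⟶ L) (x : K) (y : L) : K.ip (adj f y) x = L.ip y (f x) := by
  rw [← K.star_ip, ← ip_adj, L.star_ip]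

/-- A morphism of correspondences is unitary if its adjoint is its inverse. -/
def IsUnitary {K L : Corr A} (f : K ⟶ L) : Prop := f ≫ adj f = 𝟙 K ∧ adj f ≫ f = 𝟙 L

end Corr

/-! ### Correspondences from positive definite kernels

Both the relative tensor product and the realization are separated completions of spaces spanned by
a set `X` of elementary vectors (`k ⊗ l`, resp. `k ⊗ h`) with prescribed inner products. -/

/-- A positive definite `A`-valued kernel on a set `X` of elementary vectors, with compatible left
and right multiplications by elements of `A`. -/
structure Kernel (A : Type u) [CStarAlgebra A] [PartialOrder A] (X : Type u) where
  κ : X → X → A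
  left : A → X → X
  right : A → X → X
  star_κ : ∀ x y, star (κ x y) = κ y x
  pos : ∀ v : X →₀ ℂ,
    0 ≤ v.sum fun x c => star c • Finsupp.linearCombination ℂ (κ x) v
  κ_left : ∀ a x y, κ (left a x) y = κ x (left (star a) y)
  κ_right : ∀ a x y, κ x (right a y) = κ x y * a
  left_add : ∀ a b x y, κ x (left (a + b) y) = κ x (left a y) + κ x (left b y)
  left_mul : ∀ a b x y, κ x (left (a * b) y) = κ x (left a (left b y))
  left_scalar : ∀ (c : ℂ) x y, κ x (left (algebraMap ℂ A c) y) = c • κ x y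

namespace Kernel

open UniformSpace

variable {A : Type u} [CStarAlgebra A] [PartialOrder A] [StarOrderedRing A] {X : Type u}
  (k : Kernel A X)

/-- The semi-inner product determined by the kernel. -/
def form (v w : X →₀ ℂ) : A :=
  v.sum fun x c => star c • Finsupp.linearCombination ℂ (k.κ x) w

/-- The elementary vectors. -/
def δ (_ : Kernel A X) (x : X) : (X →₀ ℂ) := Finsupp.single x 1

lemma form_δ_left (x : X) (w : (X →₀ ℂ)) : k.form (k.δ x) w = Finsupp.linearCombination ℂ (k.κ x) w := by
  rw [form, δ, Finsupp.sum_single_index] <;> simp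

@[simp] lemma form_δ (x y : X) : k.form (k.δ x) (k.δ y) = k.κ x y := by
  rw [form_δ_left, δ, Finsupp.linearCombination_single, one_smul]

lemma form_star (v w : (X →₀ ℂ)) : star (k.form v w) = k.form w v := by
  simp only [form, Finsupp.linearCombination_apply, Finsupp.sum, star_sum, star_smul, star_star,
    k.star_κ, Finset.smul_sum]
  rw [Finset.sum_comm]
  refine Finset.sum_congr rfl fun x _ => Finset.sum_congr rfl fun y _ => ?_
  rw [smul_comm]

lemma isSemiInner : IsSemiInner k.form where
  add_right x y z := by
    simp only [form, map_add, smul_add]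
    exact Finset.sum_add_distrib
  smul_right c x y := by
    simp only [form, map_smul, Finsupp.smul_sum]
    exact Finset.sum_congr rfl fun x _ => smul_comm _ _ _
  star_eq := k.form_star
  nonneg := k.pos

/-- Induction on spanning vectors for identities between linear expressions. -/
lemma pre_induction {p : (X →₀ ℂ) → Prop} (v : (X →₀ ℂ)) (h0 : p 0)
    (hadd : ∀ x y, p x → p y → p (x + y)) (hs : ∀ (c : ℂ) x, p (c • k.δ x)) : p v := by
  refine Finsupp.induction_linear (motive := p) v h0 hadd fun x c => ?_
  have := hs c x
  rwa [δ, Finsupp.smul_single, smul_eq_mul, mul_one] at this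

/-- Linear extension of a map between elementary vectors. -/
def lin {Y : Type u} (_ : Kernel A X) (_ : Kernel A Y) (t : X → Y) : (X →₀ ℂ) →ₗ[ℂ] (Y →₀ ℂ) :=
  Finsupp.lmapDomain ℂ ℂ t

@[simp] lemma lin_δ {Y : Type u} (k' : Kernel A Y) (t : X → Y) (x : X) :
    k.lin k' t (k.δ x) = k'.δ (t x) := Finsupp.mapDomain_single

lemma ext_right {V : Type*} [AddCommGroup V] [Module ℂ V] {f g : (X →₀ ℂ) →ₗ[ℂ] V}
    (h : ∀ x, f (k.δ x) = g (k.δ x)) (v : (X →₀ ℂ)) : f v = g v :=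
  k.pre_induction (p := fun v => f v = g v) v (by simp) (fun x y hx hy => by simp [hx, hy]) fun c x => by simp [h]

/-- The form as a linear map in the second variable. -/
def formR (v : (X →₀ ℂ)) : (X →₀ ℂ) →ₗ[ℂ] A where
  toFun := k.form v
  map_add' := k.isSemiInner.add_right v
  map_smul' c w := k.isSemiInner.smul_right c v w

lemma form_ext_left {v v' w : (X →₀ ℂ)} (h : ∀ x, k.form (k.δ x) v = k.form (k.δ x) v') :
    k.form w v = k.form w v' := by
  refine k.pre_induction (p := fun w => k.form w v = k.form w v') w ?_ (fun x y hx hy => ?_) fun c x => ?_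
  · rw [k.isSemiInner.zero_left, k.isSemiInner.zero_left]
  · rw [k.isSemiInner.add_left, k.isSemiInner.add_left, hx, hy]
  · rw [k.isSemiInner.smul_left, k.isSemiInner.smul_left, h]

lemma form_lin_adj {Y : Type u} (k' : Kernel A Y) (t : X → Y) (t' : Y → X)
    (h : ∀ x y, k'.κ (t x) y = k.κ x (t' y)) (v : (X →₀ ℂ)) (w : (Y →₀ ℂ)) :
    k'.form (k.lin k' t v) w = k.form v (k'.lin k t' w) := by
  refine k.pre_induction
    (p := fun v => k'.form (k.lin k' t v) w = k.form v (k'.lin k t' w)) v ?_ (fun x y hx hy => ?_) fun c x => ?_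
  · rw [map_zero, k.isSemiInner.zero_left, k'.isSemiInner.zero_left]
  · rw [map_add, k.isSemiInner.add_left, k'.isSemiInner.add_left, hx, hy]
  · rw [map_smul, k.isSemiInner.smul_left, k'.isSemiInner.smul_left, lin_δ]
    congr 1
    exact k'.ext_right (f := k'.formR (k'.δ (t x))) (g := (k.formR (k.δ x)).comp (k'.lin k t'))
      (fun y => by simp [formR, h]) w

/-- The left action on the pre-correspondence. -/
def preLeft (a : A) : (X →₀ ℂ) →ₗ[ℂ] (X →₀ ℂ) := k.lin k (k.left a)

/-- The right action on the pre-correspondence. -/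
def preRight (a : A) : (X →₀ ℂ) →ₗ[ℂ] (X →₀ ℂ) := k.lin k (k.right a)

lemma form_preRight (a : A) (v w : (X →₀ ℂ)) : k.form v (k.preRight a w) = k.form v w * a :=
  k.ext_right (f := (k.formR v).comp (k.preRight a))
    (g := (LinearMap.mulRight ℂ a).comp (k.formR v)) (fun y => by
      simp only [LinearMap.comp_apply, formR, LinearMap.coe_mk, AddHom.coe_mk, preRight, lin_δ,
        LinearMap.mulRight_apply]
      rw [← k.form_star, ← k.form_star (k.δ y), form_δ_left, form_δ_left, ← star_star a,
        ← star_mul, star_star]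
      congr 1
      refine k.ext_right (f := Finsupp.linearCombination ℂ (k.κ (k.right a y)))
        (g := (LinearMap.mulLeft ℂ (star a)).comp (Finsupp.linearCombination ℂ (k.κ y)))
        (fun x => ?_) v
      simp only [δ, LinearMap.comp_apply, Finsupp.linearCombination_single, one_smul,
        LinearMap.mulLeft_apply]
      rw [← k.star_κ, k.κ_right, star_mul, k.star_κ]) w

lemma form_preLeft (a : A) (v w : (X →₀ ℂ)) :
    k.form (k.preLeft a v) w = k.form v (k.preLeft (star a) w) :=
  k.form_lin_adj k _ _ (fun x y => k.κ_left a x y) v w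

lemma form_ext {f g : (X →₀ ℂ) →ₗ[ℂ] (X →₀ ℂ)} (h : ∀ x y, k.form (k.δ x) (f (k.δ y)) =
    k.form (k.δ x) (g (k.δ y))) (v w : (X →₀ ℂ)) : k.form v (f w) = k.form v (g w) :=
  k.form_ext_left fun x => k.ext_right (f := (k.formR (k.δ x)).comp f)
    (g := (k.formR (k.δ x)).comp g) (fun y => h x y) w

lemma form_left_add (a b : A) (v w : (X →₀ ℂ)) :
    k.form v (k.preLeft (a + b) w) = k.form v ((k.preLeft a + k.preLeft b) w) :=
  k.form_ext (fun x y => by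
    simp [preLeft, k.left_add, k.isSemiInner.add_right]) v w

lemma form_left_mul (a b : A) (v w : (X →₀ ℂ)) :
    k.form v (k.preLeft (a * b) w) = k.form v ((k.preLeft a ∘ₗ k.preLeft b) w) :=
  k.form_ext (fun x y => by simp [preLeft, k.left_mul]) v w

lemma form_left_scalar (c : ℂ) (v w : (X →₀ ℂ)) :
    k.form v (k.preLeft (algebraMap ℂ A c) w) = k.form v ((c • LinearMap.id : (X →₀ ℂ) →ₗ[ℂ] _) w) :=
  k.form_ext (fun x y => by simp [preLeft, k.left_scalar, k.isSemiInner.smul_right]) v w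

/-- The free vector space on the elementary vectors, with the seminorm given by the form. -/
def Pre (_ : Kernel A X) : Type u := X →₀ ℂ

instance : AddCommGroup k.Pre := inferInstanceAs (AddCommGroup (X →₀ ℂ))
instance : Module ℂ k.Pre := inferInstanceAs (Module ℂ (X →₀ ℂ))
instance : Norm k.Pre := ⟨k.isSemiInner.sn⟩

lemma core : SeminormedSpace.Core ℂ k.Pre where
  norm_nonneg := k.isSemiInner.sn_nonneg
  norm_smul := k.isSemiInner.sn_smul
  norm_triangle := k.isSemiInner.sn_add_le (fun a => k.preRight a) k.form_preRight

instance : SeminormedAddCommGroup k.Pre := SeminormedAddCommGroup.ofCore k.core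
instance : NormedSpace ℂ k.Pre := ⟨fun c x => (k.core.norm_smul c x).le⟩
instance : Inner A k.Pre := ⟨k.form⟩

lemma pre_norm_sq (v : k.Pre) : ‖v‖ ^ 2 = ‖k.form v v‖ := k.isSemiInner.sn_sq v

lemma norm_form_le (v w : k.Pre) : ‖k.form v w‖ ≤ ‖v‖ * ‖w‖ :=
  k.isSemiInner.cauchy_schwarz (fun a => k.preRight a) k.form_preRight v w


/-- A linear map of pre-correspondences which is bounded, as a continuous linear map. -/
def bdd (T : (X →₀ ℂ) →ₗ[ℂ] (X →₀ ℂ)) (C : ℝ)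
    (h : ∀ v, k.isSemiInner.sn (T v) ≤ C * k.isSemiInner.sn v) : k.Pre →L[ℂ] k.Pre :=
  LinearMap.mkContinuous (𝕜 := ℂ) (𝕜₂ := ℂ) (E := k.Pre) (F := k.Pre)
    (show k.Pre →ₗ[ℂ] k.Pre from T) C h

/-- The left action on the pre-correspondence, as a bounded operator. -/
def leftL (a : A) : k.Pre →L[ℂ] k.Pre :=
  k.bdd (k.preLeft a) ‖a‖ fun v => k.isSemiInner.sn_action_le (fun a => k.preLeft a)
    k.form_preLeft
    (fun a b v w => by
      rw [k.form_left_add, LinearMap.add_apply, k.isSemiInner.add_right])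
    (fun a b v w => by rw [k.form_left_mul, LinearMap.comp_apply])
    (fun c v w => by
      rw [k.form_left_scalar, LinearMap.smul_apply, k.isSemiInner.smul_right, LinearMap.id_apply])
    a v

/-- The right action on the pre-correspondence, as a bounded operator. -/
def rightL (a : A) : k.Pre →L[ℂ] k.Pre :=
  k.bdd (k.preRight a) ‖a‖ fun v => by
    refine le_of_sq_le_sq ?_ (mul_nonneg (norm_nonneg _) (k.isSemiInner.sn_nonneg _))
    have hl : k.form (k.preRight a v) (k.preRight a v) = star a * k.form v v * a := by
      rw [k.form_preRight, ← k.form_star, k.form_preRight, star_mul, k.form_star]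
    rw [mul_pow, k.isSemiInner.sn_sq, k.isSemiInner.sn_sq, hl]
    calc ‖star a * k.form v v * a‖ ≤ ‖star a‖ * ‖k.form v v‖ * ‖a‖ :=
          (norm_mul_le _ _).trans (by gcongr; exact norm_mul_le _ _)
      _ = ‖a‖ ^ 2 * ‖k.form v v‖ := by rw [norm_star]; ring

/-- The separated completion. -/
def Compl : Type u := Completion k.Pre

instance : NormedAddCommGroup k.Compl := inferInstanceAs (NormedAddCommGroup (Completion k.Pre))
instance : NormedSpace ℂ k.Compl := inferInstanceAs (NormedSpace ℂ (Completion k.Pre))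
instance : CompleteSpace k.Compl := inferInstanceAs (CompleteSpace (Completion k.Pre))

/-- The canonical map into the completion. -/
def toCompl : k.Pre →L[ℂ] k.Compl := Completion.toComplL

lemma denseRange_toCompl : DenseRange k.toCompl := Completion.denseRange_coe

lemma norm_toCompl (v : k.Pre) : ‖k.toCompl v‖ = ‖v‖ := Completion.norm_coe v

lemma toCompl_eq {v w : k.Pre} (h : ∀ u, k.form u v = k.form u w) : k.toCompl v = k.toCompl w := by
  rw [← sub_eq_zero, ← map_sub, ← norm_eq_zero, norm_toCompl, ← sq_eq_zero_iff, k.pre_norm_sq]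
  have : k.form (v - w) (v - w) = 0 := by
    refine (k.isSemiInner.sub_right _ _ _).trans ?_
    exact sub_eq_zero.mpr (h _)
  rw [this, norm_zero]

/-- The extension of a bounded operator to the completion. -/
def complL (T : k.Pre →L[ℂ] k.Pre) : k.Compl →L[ℂ] k.Compl := T.completion

@[simp] lemma complL_toCompl (T : k.Pre →L[ℂ] k.Pre) (v : k.Pre) :
    k.complL T (k.toCompl v) = k.toCompl (T v) := Completion.map_coe T.uniformContinuous v

lemma compl_ext {T T' : k.Compl →L[ℂ] k.Compl}
    (h : ∀ v, T (k.toCompl v) = T' (k.toCompl v)) : T = T' :=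
  DFunLike.coe_injective (k.denseRange_toCompl.equalizer T.continuous T'.continuous (funext h))

/-- The extension of the form to the completion. -/
def complIp (x y : k.Compl) : A := (Completion.toInner (𝕜' := A) (E' := k.Pre)).inner x y

lemma continuous_form : Continuous fun p : k.Pre × k.Pre => k.form p.1 p.2 := by
  let F : k.Pre →L⋆[ℂ] k.Pre →L[ℂ] A :=
    LinearMap.mkContinuous₂ (LinearMap.mk₂'ₛₗ (starRingEnd ℂ) (RingHom.id ℂ)
      (fun v w : k.Pre => k.form v w)
      k.isSemiInner.add_left k.isSemiInner.smul_left k.isSemiInner.add_right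
      k.isSemiInner.smul_right) 1 (fun x y => by rw [one_mul]; exact k.norm_form_le x y)
  have : Continuous fun p : k.Pre × k.Pre => F p.1 p.2 := by fun_prop
  exact this

@[simp] lemma complIp_coe (v w : k.Pre) : k.complIp (k.toCompl v) (k.toCompl w) = k.form v w :=
  (Completion.isDenseInducing_coe.prodMap Completion.isDenseInducing_coe).extend_eq
    k.continuous_form (v, w)

lemma continuous_complIp : Continuous fun p : k.Compl × k.Compl => k.complIp p.1 p.2 := by
  let inner' : k.Pre →+ k.Pre →+ A :=
    { toFun := fun v => (k.formR v).toAddMonoidHom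
      map_zero' := AddMonoidHom.ext fun w => k.isSemiInner.zero_left w
      map_add' := fun x y => AddMonoidHom.ext fun z => k.isSemiInner.add_left x y z }
  have h : Continuous fun p : k.Pre × k.Pre => inner' p.1 p.2 := k.continuous_form
  exact (Completion.isDenseInducing_toCompl k.Pre).extend_Z_bilin
    (Completion.isDenseInducing_toCompl k.Pre) h

@[fun_prop] lemma _root_.Continuous.complIp {α : Type*} [TopologicalSpace α] {k : Kernel A X}
    {f g : α → k.Compl} (hf : Continuous f) (hg : Continuous g) :
    Continuous fun a => k.complIp (f a) (g a) :=
  k.continuous_complIp.comp (hf.prodMk hg)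

@[elab_as_elim] lemma compl_induction {p : k.Compl → Prop} (x : k.Compl) (hp : IsClosed {x | p x})
    (h : ∀ v, p (k.toCompl v)) : p x := Completion.induction_on (α := k.Pre) x hp h

instance : Module A k.Compl where
  smul a x := k.complL (k.leftL a) x
  one_smul x := by
    change k.complL (k.leftL 1) x = ContinuousLinearMap.id ℂ k.Compl x
    congr 1
    refine k.compl_ext fun v => ?_
    rw [complL_toCompl]
    refine k.toCompl_eq fun u => ?_
    rw [← map_one (algebraMap ℂ A)]
    refine (k.form_left_scalar 1 u v).trans ?_
    rw [one_smul]; rfl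
  mul_smul a b x := by
    change k.complL (k.leftL (a * b)) x = ((k.complL (k.leftL a)).comp (k.complL (k.leftL b))) x
    congr 1
    refine k.compl_ext fun v => ?_
    rw [complL_toCompl, ContinuousLinearMap.comp_apply, complL_toCompl, complL_toCompl]
    exact k.toCompl_eq fun u => k.form_left_mul a b u v
  smul_zero a := map_zero (k.complL (k.leftL a))
  smul_add a := map_add (k.complL (k.leftL a))
  add_smul a b x := by
    change k.complL (k.leftL (a + b)) x = (k.complL (k.leftL a) + k.complL (k.leftL b)) x
    congr 1
    refine k.compl_ext fun v => ?_
    rw [complL_toCompl, _root_.add_apply, complL_toCompl, complL_toCompl, ← map_add]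
    exact k.toCompl_eq fun u => k.form_left_add a b u v
  zero_smul x := by
    change k.complL (k.leftL 0) x = (0 : k.Compl →L[ℂ] k.Compl) x
    congr 1
    refine k.compl_ext fun v => ?_
    rw [complL_toCompl, _root_.zero_apply, ← map_zero k.toCompl]
    refine k.toCompl_eq fun u => ?_
    rw [← map_zero (algebraMap ℂ A)]
    refine (k.form_left_scalar 0 u v).trans ?_
    rw [zero_smul]; rfl

lemma lsmul_def (a : A) (x : k.Compl) : a • x = k.complL (k.leftL a) x := rfl

instance : Module Aᵐᵒᵖ k.Compl where
  smul a x := k.complL (k.rightL a.unop) x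
  one_smul x := by
    change k.complL (k.rightL 1) x = ContinuousLinearMap.id ℂ k.Compl x
    congr 1
    refine k.compl_ext fun v => ?_
    rw [complL_toCompl]
    refine k.toCompl_eq fun u => (k.form_preRight 1 u v).trans (mul_one _)
  mul_smul a b x := by
    change k.complL (k.rightL (b.unop * a.unop)) x =
      ((k.complL (k.rightL a.unop)).comp (k.complL (k.rightL b.unop))) x
    congr 1
    refine k.compl_ext fun v => ?_
    rw [complL_toCompl, ContinuousLinearMap.comp_apply, complL_toCompl, complL_toCompl]
    refine k.toCompl_eq fun u => (k.form_preRight _ u v).trans ?_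
    refine Eq.trans ?_ (k.form_preRight _ u _).symm
    refine Eq.trans ?_ (congrArg (· * _) (k.form_preRight _ u v).symm)
    rw [mul_assoc]
  smul_zero a := map_zero (k.complL (k.rightL a.unop))
  smul_add a := map_add (k.complL (k.rightL a.unop))
  add_smul a b x := by
    change k.complL (k.rightL (a.unop + b.unop)) x =
      (k.complL (k.rightL a.unop) + k.complL (k.rightL b.unop)) x
    congr 1
    refine k.compl_ext fun v => ?_
    rw [complL_toCompl, _root_.add_apply, complL_toCompl, complL_toCompl, ← map_add]
    refine k.toCompl_eq fun u => (k.form_preRight _ u v).trans ?_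
    refine Eq.trans ?_ (k.isSemiInner.add_right u _ _).symm
    rw [mul_add]
    exact congrArg₂ (· + ·) (k.form_preRight _ u v).symm (k.form_preRight _ u v).symm
  zero_smul x := by
    change k.complL (k.rightL 0) x = (0 : k.Compl →L[ℂ] k.Compl) x
    congr 1
    refine k.compl_ext fun v => ?_
    rw [complL_toCompl, _root_.zero_apply, ← map_zero k.toCompl]
    refine k.toCompl_eq fun u => (k.form_preRight 0 u v).trans ?_
    rw [mul_zero]; exact (k.isSemiInner.zero_right u).symm

lemma rsmul_def (a : A) (x : k.Compl) : op a • x = k.complL (k.rightL a) x := rfl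

@[simp] lemma lsmul_δ (a : A) (x : X) :
    a • k.toCompl (k.δ x) = k.toCompl (k.δ (k.left a x)) := by
  exact (k.complL_toCompl (k.leftL a) (k.δ x)).trans
    (congrArg k.toCompl (k.lin_δ k (k.left a) x))

@[simp] lemma rsmul_δ (a : A) (x : X) :
    op a • k.toCompl (k.δ x) = k.toCompl (k.δ (k.right a x)) := by
  exact (k.complL_toCompl (k.rightL a) (k.δ x)).trans
    (congrArg k.toCompl (k.lin_δ k (k.right a) x))

instance : IsScalarTower ℂ A k.Compl := ⟨fun c a x => by
  have h : ∀ y : k.Compl, algebraMap ℂ A c • y = c • y := fun y => by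
    change k.complL (k.leftL (algebraMap ℂ A c)) y = (c • ContinuousLinearMap.id ℂ k.Compl) y
    congr 1
    refine k.compl_ext fun v => ?_
    rw [complL_toCompl, _root_.smul_apply, ContinuousLinearMap.id_apply, ← map_smul]
    exact k.toCompl_eq fun u => k.form_left_scalar c u v
  rw [Algebra.smul_def, mul_smul, h]⟩

instance : IsScalarTower ℂ Aᵐᵒᵖ k.Compl := ⟨fun c a x => by
  change k.complL (k.rightL (c • a.unop)) x = (c • k.complL (k.rightL a.unop)) x
  congr 1
  refine k.compl_ext fun v => ?_
  rw [complL_toCompl, _root_.smul_apply, complL_toCompl, ← map_smul]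
  refine k.toCompl_eq fun u => (k.form_preRight _ u v).trans ?_
  refine Eq.trans ?_ (k.isSemiInner.smul_right c u _).symm
  rw [mul_smul_comm]
  exact congrArg (c • ·) (k.form_preRight _ u v).symm⟩

instance : SMulCommClass A Aᵐᵒᵖ k.Compl := ⟨fun a b x => by
  change ((k.complL (k.leftL a)).comp (k.complL (k.rightL b.unop))) x =
    ((k.complL (k.rightL b.unop)).comp (k.complL (k.leftL a))) x
  congr 1
  refine k.compl_ext fun v => ?_
  rw [ContinuousLinearMap.comp_apply, ContinuousLinearMap.comp_apply, complL_toCompl,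
    complL_toCompl, complL_toCompl, complL_toCompl]
  have hs : ∀ u w : X →₀ ℂ, k.form u (k.preLeft a w) = k.form (k.preLeft (star a) u) w :=
    fun u w => by rw [k.form_preLeft, star_star]
  refine k.toCompl_eq fun u => (hs u _).trans ?_
  refine (k.form_preRight _ _ v).trans ?_
  refine Eq.trans ?_ (k.form_preRight _ u _).symm
  exact congrArg (· * _) (hs u v).symm⟩

/-- The correspondence determined by a kernel. -/
def toCorr : Corr A where
  carrier := k.Compl
  ip := k.complIp
  ip_add_right x y z := by
    refine k.compl_induction x (isClosed_eq (by fun_prop) (by fun_prop)) fun u => ?_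
    refine k.compl_induction y (isClosed_eq (by fun_prop) (by fun_prop)) fun v => ?_
    refine k.compl_induction z (isClosed_eq (by fun_prop) (by fun_prop)) fun w => ?_
    rw [← map_add, complIp_coe, complIp_coe, complIp_coe]
    exact k.isSemiInner.add_right u v w
  ip_smul_right a x y := by
    rw [rsmul_def]
    refine k.compl_induction x (isClosed_eq (by fun_prop) (by fun_prop)) fun u => ?_
    refine k.compl_induction y (isClosed_eq (by fun_prop) (by fun_prop)) fun v => ?_
    rw [complL_toCompl, complIp_coe, complIp_coe]
    exact k.form_preRight a u v
  star_ip x y := by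
    refine k.compl_induction x (isClosed_eq (by fun_prop) (by fun_prop)) fun u => ?_
    refine k.compl_induction y (isClosed_eq (by fun_prop) (by fun_prop)) fun v => ?_
    rw [complIp_coe, complIp_coe]
    exact k.form_star u v
  ip_nonneg x := by
    refine k.compl_induction x (isClosed_le (by fun_prop) (by fun_prop)) fun u => ?_
    rw [complIp_coe]
    exact k.isSemiInner.nonneg u
  norm_sq x := by
    refine k.compl_induction x (isClosed_eq (by fun_prop) (by fun_prop)) fun u => ?_
    rw [complIp_coe, norm_toCompl]
    exact k.pre_norm_sq u
  ip_left a x y := by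
    rw [lsmul_def, lsmul_def]
    refine k.compl_induction x (isClosed_eq (by fun_prop) (by fun_prop)) fun u => ?_
    refine k.compl_induction y (isClosed_eq (by fun_prop) (by fun_prop)) fun v => ?_
    rw [complL_toCompl, complL_toCompl, complIp_coe, complIp_coe]
    exact k.form_preLeft a u v

/-- The elementary vectors in the correspondence determined by a kernel. -/
def elem (x : X) : k.toCorr := k.toCompl (k.δ x)

lemma ip_elem (x y : X) : k.toCorr.ip (k.elem x) (k.elem y) = k.κ x y :=
  (k.complIp_coe _ _).trans (k.form_δ x y)

lemma lsmul_elem (a : A) (x : X) : a • k.elem x = k.elem (k.left a x) := k.lsmul_δ a x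

lemma rsmul_elem (a : A) (x : X) : op a • k.elem x = k.elem (k.right a x) := k.rsmul_δ a x

lemma denseRange_elem : DenseRange (Finsupp.linearCombination ℂ k.elem) := by
  have h : (Finsupp.linearCombination ℂ k.elem : (X →₀ ℂ) → k.toCorr) =
      fun v => (k.toCompl v : k.toCorr) := by
    funext v
    exact k.ext_right (f := Finsupp.linearCombination ℂ k.elem)
      (g := (k.toCompl.toLinearMap : (X →₀ ℂ) →ₗ[ℂ] k.toCorr)) (fun x => by
        rw [δ, Finsupp.linearCombination_single, one_smul]; rfl) v
  rw [h]
  exact k.denseRange_toCompl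

end Kernel

namespace Corr

variable {A : Type u} [CStarAlgebra A] [PartialOrder A] [StarOrderedRing A]

/-- A family of vectors whose linear span is dense. -/
def Total {X : Type u} {E : Corr A} (g : X → E) : Prop :=
  DenseRange (Finsupp.linearCombination ℂ g)

lemma clm_ext_of_total {X : Type u} {E : Corr A} {V : Type*} [NormedAddCommGroup V]
    [NormedSpace ℂ V] {g : X → E} (hg : Total g)
    {f f' : E →L[ℂ] V} (h : ∀ x, f (g x) = f' (g x)) : f = f' := by
  refine DFunLike.coe_injective (hg.equalizer f.continuous f'.continuous (funext fun v => ?_))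
  simp only [Function.comp_apply, Finsupp.linearCombination_apply, Finsupp.sum, map_sum, map_smul,
    h]

lemma hom_ext_of_total {X : Type u} {E F : Corr A} {g : X → E} (hg : Total g) {f f' : E ⟶ F}
    (h : ∀ x, f (g x) = f' (g x)) : f = f' :=
  hom_ext fun x => congrArg (fun T : E →L[ℂ] F => T x)
    (clm_ext_of_total hg (f := op' f) (f' := op' f') h)

lemma power_trick {a b C r : ℝ} (hb : 0 ≤ b) (hr : 0 < r)
    (h0 : b = 0 → a = 0) (h : ∀ n : ℕ, a ^ (2 ^ n) * b ≤ b ^ (2 ^ n) * (C * r ^ (2 ^ n))) :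
    a ≤ r * b := by
  rcases hb.eq_or_lt with hb0 | hb0
  · rw [h0 hb0.symm, ← hb0, mul_zero]
  by_contra hlt
  push Not at hlt
  have hq : 1 < a / (r * b) := (one_lt_div (by positivity)).mpr hlt
  obtain ⟨n, hn⟩ := ((tendsto_pow_atTop_atTop_of_one_lt hq).comp
    (tendsto_pow_atTop_atTop_of_one_lt (one_lt_two (α := ℕ)))).eventually_gt_atTop (C / b) |>.exists
  have h1 := h n
  rw [Function.comp_apply, div_pow, mul_pow, div_lt_div_iff₀ hb0 (by positivity)] at hn
  nlinarith

section Gen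

variable {X X' : Type u} {E F : Corr A} (g : X → E) (g' : X' → F) (t : X → X') (t' : X' → X)

lemma ip_lin (h : ∀ x y, F.ip (g' (t x)) (g' y) = E.ip (g x) (g (t' y))) (v : X →₀ ℂ)
    (w : X' →₀ ℂ) :
    F.ip (Finsupp.linearCombination ℂ g' (Finsupp.lmapDomain ℂ ℂ t v))
      (Finsupp.linearCombination ℂ g' w) =
    E.ip (Finsupp.linearCombination ℂ g v)
      (Finsupp.linearCombination ℂ g (Finsupp.lmapDomain ℂ ℂ t' w)) := by
  induction v using Finsupp.induction_linear with
  | zero => simp [E.isSemiInner.zero_left, F.isSemiInner.zero_left]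
  | add x y hx hy => simp only [map_add, E.isSemiInner.add_left, F.isSemiInner.add_left, hx, hy]
  | single x c =>
    induction w using Finsupp.induction_linear with
    | zero => simp [E.isSemiInner.zero_right, F.isSemiInner.zero_right]
    | add x y hx hy => simp only [map_add, E.isSemiInner.add_right, F.isSemiInner.add_right, hx, hy]
    | single y d =>
      simp only [Finsupp.lmapDomain_apply, Finsupp.mapDomain_single,
        Finsupp.linearCombination_single, E.isSemiInner.smul_left, E.isSemiInner.smul_right,
        F.isSemiInner.smul_left, F.isSemiInner.smul_right, h]

lemma iterate_bound (s : X → X) (hs : ∀ x y, E.ip (g (s x)) (g y) = E.ip (g x) (g (s y))) {r : ℝ}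
    (hr : 0 < r) (hgrow : ∀ x, ∃ C, ∀ n : ℕ, ‖g (s^[n] x)‖ ≤ C * r ^ n) (v : X →₀ ℂ) :
    ‖Finsupp.linearCombination ℂ g (Finsupp.lmapDomain ℂ ℂ s v)‖ ≤
      r * ‖Finsupp.linearCombination ℂ g v‖ := by
  set G := Finsupp.linearCombination ℂ g
  let S : ℕ → (X →₀ ℂ) →ₗ[ℂ] (X →₀ ℂ) := fun n => Finsupp.lmapDomain ℂ ℂ (s^[n])
  have hS : ∀ m n v, S m (S n v) = S (m + n) v := fun m n v => by
    simp only [S, Finsupp.lmapDomain_apply, Function.iterate_add, Finsupp.mapDomain_comp]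
  have hsn : ∀ (n : ℕ) x y, E.ip (g (s^[n] x)) (g y) = E.ip (g x) (g (s^[n] y)) := by
    intro n
    induction n with
    | zero => intro x y; rfl
    | succ n ih =>
      intro x y
      rw [Function.iterate_succ_apply, ih, hs, ← Function.iterate_succ_apply' s]
  have hip : ∀ n v w, E.ip (G (S n v)) (G w) = E.ip (G v) (G (S n w)) := fun n v w =>
    ip_lin g g _ _ (hsn n) v w
  have hsq : ∀ n, ‖G (S n v)‖ ^ 2 ≤ ‖G v‖ * ‖G (S (n + n) v)‖ := fun n => by
    rw [E.norm_sq, hip, hS]; exact E.norm_ip_le _ _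
  obtain ⟨C, hC⟩ : ∃ C, ∀ n, ‖G (S n v)‖ ≤ C * r ^ n := by
    clear hsq
    induction v using Finsupp.induction_linear with
    | zero => exact ⟨0, fun n => by simp⟩
    | add x y hx hy =>
      obtain ⟨C, hC⟩ := hx
      obtain ⟨D, hD⟩ := hy
      exact ⟨C + D, fun n => by
        rw [map_add, map_add, add_mul]
        exact (norm_add_le _ _).trans (add_le_add (hC n) (hD n))⟩
    | single x c =>
      obtain ⟨C, hC⟩ := hgrow x
      exact ⟨‖c‖ * C, fun n => by
        simp only [G, S, Finsupp.lmapDomain_apply, Finsupp.mapDomain_single,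
          Finsupp.linearCombination_single, norm_smul, mul_assoc]
        gcongr
        exact hC n⟩
  have h1 : Finsupp.lmapDomain ℂ ℂ s v = S 1 v := rfl
  rw [h1]
  refine power_trick (C := C) (norm_nonneg _) hr (fun h0 => ?_) fun n => ?_
  · have := hsq 1
    rw [h0, zero_mul] at this
    exact pow_eq_zero_iff (two_ne_zero) |>.mp (le_antisymm this (sq_nonneg _))
  · have hind : ‖G (S 1 v)‖ ^ (2 ^ n) * ‖G v‖ ≤ ‖G v‖ ^ (2 ^ n) * ‖G (S (2 ^ n) v)‖ := by
      induction n with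
      | zero => simp [mul_comm]
      | succ n ih =>
        rcases (norm_nonneg (G v)).eq_or_lt with h0 | h0
        · rw [← h0]; simp
        have h2 := hsq (2 ^ n)
        have e : 2 ^ (n + 1) = 2 ^ n + 2 ^ n := by ring
        rw [e, pow_add]
        have h3 : (‖G (S 1 v)‖ ^ (2 ^ n) * ‖G v‖) ^ 2 ≤
            (‖G v‖ ^ (2 ^ n)) ^ 2 * (‖G v‖ * ‖G (S (2 ^ n + 2 ^ n) v)‖) := by
          refine (pow_le_pow_left₀ (by positivity) ih 2).trans ?_
          rw [mul_pow]
          gcongr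
        refine le_of_mul_le_mul_right ?_ h0
        calc _ = (‖G (S 1 v)‖ ^ (2 ^ n) * ‖G v‖) ^ 2 := by ring
          _ ≤ _ := h3
          _ = _ := by rw [pow_add]; ring
    exact hind.trans (mul_le_mul_of_nonneg_left (hC _) (by positivity))

variable {g g'}

lemma gen_bound
    (h : ∀ x y, F.ip (g' (t x)) (g' y) = E.ip (g x) (g (t' y)))
    (hgrow : ∃ r : ℝ, 0 < r ∧ ∀ x, ∃ C, ∀ n : ℕ, ‖g ((t' ∘ t)^[n] x)‖ ≤ C * r ^ n) : ∃ D : ℝ, 0 ≤ D ∧ ∀ v, ‖Finsupp.linearCombination ℂ (g' ∘ t) v‖ ≤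
    D * ‖Finsupp.linearCombination ℂ g v‖ := by
  obtain ⟨r, hr, hC⟩ := hgrow
  have hs : ∀ x y, E.ip (g ((t' ∘ t) x)) (g y) = E.ip (g x) (g ((t' ∘ t) y)) := fun x y => by
    rw [Function.comp_apply, Function.comp_apply, ← h, ← E.star_ip, ← h, F.star_ip]
  refine ⟨√r, Real.sqrt_nonneg r, fun v => ?_⟩
  have e : Finsupp.linearCombination ℂ (g' ∘ t) v =
      Finsupp.linearCombination ℂ g' (Finsupp.lmapDomain ℂ ℂ t v) := by
    rw [Finsupp.lmapDomain_apply, Finsupp.linearCombination_mapDomain]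
  have h1 : ‖Finsupp.linearCombination ℂ (g' ∘ t) v‖ ^ 2 ≤
      r * ‖Finsupp.linearCombination ℂ g v‖ ^ 2 := by
    rw [e, F.norm_sq, ip_lin g g' t t' h]
    refine (E.norm_ip_le _ _).trans ?_
    have h2 := iterate_bound g (t' ∘ t) hs hr hC v
    have e2 : Finsupp.lmapDomain ℂ ℂ t' (Finsupp.lmapDomain ℂ ℂ t v) =
        Finsupp.lmapDomain ℂ ℂ (t' ∘ t) v := by
      simp only [Finsupp.lmapDomain_apply, Finsupp.mapDomain_comp]
    rw [e2]
    nlinarith [norm_nonneg (Finsupp.linearCombination ℂ g v)]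
  refine le_of_sq_le_sq ?_ (by positivity)
  rw [mul_pow, Real.sq_sqrt hr.le]
  exact h1

lemma gen_bound'
    (h : ∀ x y, F.ip (g' (t x)) (g' y) = E.ip (g x) (g (t' y)))
    (hgrow : ∃ r : ℝ, 0 < r ∧ ∀ x, ∃ C, ∀ n : ℕ, ‖g ((t' ∘ t)^[n] x)‖ ≤ C * r ^ n) : ∃ D : ℝ, ∀ w, ‖Finsupp.linearCombination ℂ (g ∘ t') w‖ ≤
    D * ‖Finsupp.linearCombination ℂ g' w‖ := by
  obtain ⟨D, hD0, hD⟩ := gen_bound t t' h hgrow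
  refine ⟨D, fun w => ?_⟩
  have e : Finsupp.linearCombination ℂ (g ∘ t') w =
      Finsupp.linearCombination ℂ g (Finsupp.lmapDomain ℂ ℂ t' w) := by
    rw [Finsupp.lmapDomain_apply, Finsupp.linearCombination_mapDomain]
  set v := Finsupp.lmapDomain ℂ ℂ t' w
  have h1 : ‖Finsupp.linearCombination ℂ g v‖ ^ 2 ≤
      D * ‖Finsupp.linearCombination ℂ g v‖ * ‖Finsupp.linearCombination ℂ g' w‖ := by
    rw [E.norm_sq, ← ip_lin g g' t t' h]
    refine (F.norm_ip_le _ _).trans ?_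
    gcongr
    have := hD v
    rwa [← Finsupp.linearCombination_mapDomain] at this
  rw [e]
  rcases (norm_nonneg (Finsupp.linearCombination ℂ g v)).eq_or_lt with h0 | h0
  · rw [← h0]
    positivity
  · nlinarith

variable (hg : Total g) (hg' : Total g')
    (h : ∀ x y, F.ip (g' (t x)) (g' y) = E.ip (g x) (g (t' y)))
    (hgrow : ∃ r : ℝ, 0 < r ∧ ∀ x, ∃ C, ∀ n : ℕ, ‖g ((t' ∘ t)^[n] x)‖ ≤ C * r ^ n)

/-- The morphism determined by its values on a total family and those of its adjoint. -/
def genHom (hl : ∀ (a : A) x, ∃ y, a • g x = g y ∧ a • g' (t x) = g' (t y)) : E ⟶ F := by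
  refine mkHom ((Finsupp.linearCombination ℂ (g' ∘ t)).extendOfNorm
    (Finsupp.linearCombination ℂ g)) ((Finsupp.linearCombination ℂ (g ∘ t')).extendOfNorm
    (Finsupp.linearCombination ℂ g')) ?_ ?_
  · have hT := LinearMap.extendOfNorm_eq (f := Finsupp.linearCombination ℂ (g' ∘ t)) hg
      ((gen_bound t t' h hgrow).imp fun D hD => hD.2)
    have hS := LinearMap.extendOfNorm_eq (f := Finsupp.linearCombination ℂ (g ∘ t')) hg'
      (gen_bound' t t' h hgrow)
    intro x y
    refine hg.induction_on (p := fun x => F.ip (LinearMap.extendOfNorm _ _ x) y =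
      E.ip x (LinearMap.extendOfNorm _ _ y)) x ?_ fun v => ?_
    · simp only [← ipL_apply]
      exact isClosed_eq (by fun_prop) (by fun_prop)
    refine hg'.induction_on (p := fun y => F.ip (LinearMap.extendOfNorm _ _ _) y =
      E.ip _ (LinearMap.extendOfNorm _ _ y)) y ?_ fun w => ?_
    · simp only [← ipL_apply]
      exact isClosed_eq (by fun_prop) (by fun_prop)
    rw [hT, hS, ← Finsupp.linearCombination_mapDomain, ← Finsupp.linearCombination_mapDomain]
    exact ip_lin g g' t t' h v w
  · intro a x
    have hT := LinearMap.extendOfNorm_eq (f := Finsupp.linearCombination ℂ (g' ∘ t)) hg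
      ((gen_bound t t' h hgrow).imp fun D hD => hD.2)
    have hT' : ∀ x, (Finsupp.linearCombination ℂ (g' ∘ t)).extendOfNorm
        (Finsupp.linearCombination ℂ g) (g x) = g' (t x) := fun x => by
      have := hT (Finsupp.single x 1)
      simpa only [Finsupp.linearCombination_single, one_smul, Function.comp_apply] using this
    have := clm_ext_of_total hg (f := ((Finsupp.linearCombination ℂ (g' ∘ t)).extendOfNorm
      (Finsupp.linearCombination ℂ g)).comp (E.lsmulL a)) (f' := (F.lsmulL a).comp
      ((Finsupp.linearCombination ℂ (g' ∘ t)).extendOfNorm (Finsupp.linearCombination ℂ g)))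
      (fun x => by
        obtain ⟨y, h1, h2⟩ := hl a x
        simp only [ContinuousLinearMap.comp_apply, lsmulL_apply]
        rw [h1, hT', hT', h2])
    exact congrArg (fun T : E →L[ℂ] F => T x) this

lemma genHom_apply (hl : ∀ (a : A) x, ∃ y, a • g x = g y ∧ a • g' (t x) = g' (t y)) (x : X) :
    genHom t t' hg hg' h hgrow hl (g x) = g' (t x) := by
  have := LinearMap.extendOfNorm_eq (f := Finsupp.linearCombination ℂ (g' ∘ t)) hg
    ((gen_bound t t' h hgrow).imp fun D hD => hD.2) (Finsupp.single x 1)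
  simp only [Finsupp.linearCombination_single, one_smul, Function.comp_apply] at this
  exact this

end Gen

lemma growth_id {X : Type u} {E : Corr A} (g : X → E) : ∃ r : ℝ, 0 < r ∧ ∀ x, ∃ C, ∀ n : ℕ,
    ‖g (((fun x => x) ∘ fun x => x)^[n] x)‖ ≤ C * r ^ n :=
  ⟨1, one_pos, fun x => ⟨‖g x‖, fun n => by
    rw [one_pow, mul_one]
    exact le_of_eq (congrArg (fun y => ‖g y‖) (congrFun (Function.iterate_id n) x))⟩⟩

/-- A unitary isomorphism determined by two total families with the same inner products. -/
def genIso {X : Type u} {E F : Corr A} {g : X → E} {g' : X → F} (hg : Total g) (hg' : Total g')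
    (h : ∀ x y, F.ip (g' x) (g' y) = E.ip (g x) (g y))
    (hl : ∀ (a : A) x, ∃ y, a • g x = g y ∧ a • g' x = g' y) : E ≅ F where
  hom := genHom (fun x => x) (fun x => x) hg hg' h
    (growth_id g) hl
  inv := genHom (fun x => x) (fun x => x) hg' hg (fun x y => (h x y).symm)
    (growth_id g')
    (fun a x => (hl a x).imp fun y hy => ⟨hy.2, hy.1⟩)
  hom_inv_id := hom_ext_of_total hg fun x => by
    rw [comp_apply, genHom_apply, genHom_apply, id_apply]
  inv_hom_id := hom_ext_of_total hg' fun x => by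
    rw [comp_apply, genHom_apply, genHom_apply, id_apply]

lemma genIso_hom_apply {X : Type u} {E F : Corr A} {g : X → E} {g' : X → F} (hg : Total g)
    (hg' : Total g') (h : ∀ x y, F.ip (g' x) (g' y) = E.ip (g x) (g y))
    (hl : ∀ (a : A) x, ∃ y, a • g x = g y ∧ a • g' x = g' y) (x : X) :
    (genIso hg hg' h hl).hom (g x) = g' x := 
  genHom_apply (fun x => x) (fun x => x) hg hg' h (growth_id g) hl x

end Corr

/-! ### The relative tensor product -/

section Gram

lemma exists_conj_eq_neg {B : Type*} [CStarAlgebra B] (G : B) (hG : IsSelfAdjoint G) :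
    ∃ N D : B, star N * G * N = -(star D * D) ∧ (D = 0 → ∃ C, G = star C * C) := by
  let _ := CStarAlgebra.spectralOrder B
  have _ := CStarAlgebra.spectralOrderedRing B
  have hdec := CFC.posPart_sub_negPart G hG
  have hN0 : 0 ≤ G⁻ := CFC.negPart_nonneg G
  have hNs : star G⁻ = G⁻ := (IsSelfAdjoint.of_nonneg hN0).star_eq
  have hPN : G⁺ * G⁻ = 0 := CFC.posPart_mul_negPart G
  have hGN : star G⁻ * G * G⁻ = -(star G⁻ * G⁻ * G⁻) := by
    nth_rewrite 2 [← hdec]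
    rw [mul_sub, sub_mul, mul_assoc, hPN, mul_zero, zero_sub]
  have hNNN : 0 ≤ star G⁻ * G⁻ * G⁻ := star_left_conjugate_nonneg hN0 G⁻
  obtain ⟨D, hD⟩ := CStarAlgebra.nonneg_iff_eq_star_mul_self.mp hNNN
  refine ⟨G⁻, D, by rw [hGN, hD], fun h => ?_⟩
  rw [h, mul_zero] at hD
  have hN2 : star G⁻ * G⁻ = 0 := by
    rw [← CStarRing.star_mul_self_eq_zero_iff, star_mul, star_star, ← mul_assoc]
    simp only [hNs] at hD ⊢
    rw [hD, zero_mul]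
  have hN3 : G⁻ = 0 := (CStarRing.star_mul_self_eq_zero_iff _).mp hN2
  have hG0 : 0 ≤ G := by
    rw [← hdec, hN3, sub_zero]
    exact CFC.posPart_nonneg G
  exact CStarAlgebra.nonneg_iff_eq_star_mul_self.mp hG0

/-- A self-adjoint matrix `G` over `A` with `∑ aᵢ* Gᵢⱼ aⱼ ≥ 0` for all `a` is of the form `C* C`. -/
lemma matrix_factor {A : Type u} [CStarAlgebra A] [PartialOrder A] [StarOrderedRing A]
    {n : Type*} [Fintype n] [DecidableEq n] (G : CStarMatrix n n A) (hG : IsSelfAdjoint G)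
    (h : ∀ a : n → A, 0 ≤ ∑ i, ∑ j, star (a i) * G i j * a j) :
    ∃ C : CStarMatrix n n A, G = star C * C := by
  obtain ⟨N, D, hND, hfin⟩ := exists_conj_eq_neg G hG
  refine hfin ?_
  have hdiag : ∀ j, (star D * D) j j = 0 := by
    intro j
    refine le_antisymm ?_ ?_
    · have h1 := h fun i => N i j
      have h2 : ∑ i, ∑ l, star (N i j) * G i l * N l j = (star N * G * N) j j := by
        simp only [CStarMatrix.mul_apply, CStarMatrix.star_apply, Finset.sum_mul]
        exact Finset.sum_comm
      rw [h2, hND] at h1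
      exact neg_nonneg.mp h1
    · simp only [CStarMatrix.mul_apply, CStarMatrix.star_apply]
      exact Finset.sum_nonneg fun i _ => star_mul_self_nonneg _
  ext i j
  have h1 := hdiag j
  simp only [CStarMatrix.mul_apply, CStarMatrix.star_apply] at h1
  rw [Finset.sum_eq_zero_iff_of_nonneg fun i _ => star_mul_self_nonneg _] at h1
  exact (CStarRing.star_mul_self_eq_zero_iff _).mp (h1 i (Finset.mem_univ i))

end Gram

namespace Corr

variable {A : Type u} [CStarAlgebra A] [PartialOrder A] [StarOrderedRing A]

lemma ip_sum_right (K : Corr A) {ι : Type*} (s : Finset ι) (x : K) (y : ι → K) :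
    K.ip x (∑ i ∈ s, y i) = ∑ i ∈ s, K.ip x (y i) := map_sum (K.ipL x) y s

lemma ip_sum_left (K : Corr A) {ι : Type*} (s : Finset ι) (x : ι → K) (y : K) :
    K.ip (∑ i ∈ s, x i) y = ∑ i ∈ s, K.ip (x i) y := by
  rw [← K.star_ip, K.ip_sum_right, star_sum]
  exact Finset.sum_congr rfl fun i _ => K.star_ip _ _

lemma ip_rsmul_left (K : Corr A) (a : A) (x y : K) : K.ip (op a • x) y = star a * K.ip x y := by
  rw [← K.star_ip, K.ip_smul_right, star_mul, K.star_ip]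

lemma gram_factor (K : Corr A) {n : Type*} [Fintype n] [DecidableEq n] (x : n → K) :
    ∃ C : n → n → A, ∀ i j, K.ip (x i) (x j) = ∑ z, star (C z i) * C z j := by
  obtain ⟨C, hC⟩ := matrix_factor (CStarMatrix.ofMatrix fun i j => K.ip (x i) (x j))
    (CStarMatrix.ext fun i j => K.star_ip _ _) fun a => by
      have h : ∑ i, ∑ j, star (a i) * K.ip (x i) (x j) * a j =
          K.ip (∑ i, op (a i) • x i) (∑ i, op (a i) • x i) := by
        rw [K.ip_sum_left]
        refine Finset.sum_congr rfl fun i _ => ?_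
        rw [K.ip_sum_right]
        refine Finset.sum_congr rfl fun j _ => ?_
        rw [K.ip_smul_right, K.ip_rsmul_left]
      exact h ▸ K.ip_nonneg _
  refine ⟨fun z i => C z i, fun i j => ?_⟩
  have := congrFun (congrFun hC i) j
  rw [CStarMatrix.mul_apply] at this
  simp only [CStarMatrix.star_apply] at this
  exact this

lemma tensor_pos (K L : Corr A) {n : Type*} [Fintype n] (x : n → K) (y : n → L) :
    0 ≤ ∑ i, ∑ j, L.ip (y i) (K.ip (x i) (x j) • y j) := by
  classical
  obtain ⟨C, hC⟩ := K.gram_factor x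
  have h : ∑ i, ∑ j, L.ip (y i) (K.ip (x i) (x j) • y j) =
      ∑ z, L.ip (∑ i, C z i • y i) (∑ j, C z j • y j) := by
    calc _ = ∑ i, ∑ j, ∑ z, L.ip (C z i • y i) (C z j • y j) := by
          refine Finset.sum_congr rfl fun i _ => Finset.sum_congr rfl fun j _ => ?_
          rw [hC, Finset.sum_smul, ip_sum_right]
          refine Finset.sum_congr rfl fun z _ => ?_
          rw [mul_smul, L.ip_left]
      _ = ∑ z, ∑ i, ∑ j, L.ip (C z i • y i) (C z j • y j) := by
          rw [Finset.sum_comm (s := (Finset.univ : Finset n)) (t := Finset.univ)]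
          rw [Finset.sum_congr rfl fun i _ => Finset.sum_comm]
          rw [Finset.sum_comm]
          exact Finset.sum_congr rfl fun i _ => Finset.sum_comm
      _ = _ := by
          simp only [ip_sum_left, ip_sum_right]
          exact Finset.sum_congr rfl fun z _ => Finset.sum_comm
  rw [h]
  exact Finset.sum_nonneg fun z _ => L.ip_nonneg _

/-- The kernel `⟨k ⊗ l, k' ⊗ l'⟩ = ⟨l, ⟨k, k'⟩ l'⟩`. -/
def tensorKernel (K L : Corr A) : Kernel A (K × L) where
  κ p q := L.ip p.2 (K.ip p.1 q.1 • q.2)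
  left a p := (a • p.1, p.2)
  right a p := (p.1, op a • p.2)
  star_κ p q := by
    rw [L.star_ip, L.ip_left, K.star_ip]
  pos v := by
    have h := tensor_pos K L (n := v.support) (fun p => p.1.1) (fun p => v p.1 • p.1.2)
    rw [Finset.sum_coe_sort v.support fun p => ∑ q : v.support,
      L.ip (v p • p.2) (K.ip p.1 q.1.1 • v q.1 • q.1.2)] at h
    refine h.trans_eq (Finset.sum_congr rfl fun p _ => ?_)
    dsimp only
    rw [Finsupp.linearCombination_apply, Finsupp.sum, Finset.smul_sum,
      Finset.sum_coe_sort v.support fun q => L.ip (v p • p.2) (K.ip p.1 q.1 • v q • q.2)]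
    refine Finset.sum_congr rfl fun q _ => ?_
    rw [L.isSemiInner.smul_left, smul_comm (K.ip p.1 q.1), L.isSemiInner.smul_right]
  κ_left a p q := by dsimp only; rw [K.ip_left]
  κ_right a p q := by dsimp only; rw [smul_comm, L.ip_smul_right]
  left_add a b p q := by
    dsimp only; rw [add_smul, K.ip_add_right, add_smul, L.ip_add_right]
  left_mul a b p q := by dsimp only; rw [mul_smul]
  left_scalar c p q := by
    dsimp only
    rw [algebraMap_smul, K.isSemiInner.smul_right, smul_assoc, L.isSemiInner.smul_right]

/-- The relative tensor product (Connes fusion, interior tensor product) of correspondences: the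
separated completion of the span of the elementary tensors with
`⟨k ⊗ l, k' ⊗ l'⟩ = ⟨l, ⟨k, k'⟩ l'⟩`. -/
def tensor (K L : Corr A) : Corr A := (tensorKernel K L).toCorr

/-- The elementary tensors. -/
def tmul {K L : Corr A} (x : K) (y : L) : tensor K L := (tensorKernel K L).elem (x, y)

@[simp] lemma ip_tmul {K L : Corr A} (x x' : K) (y y' : L) :
    (tensor K L).ip (tmul x y) (tmul x' y') = L.ip y (K.ip x x' • y') :=
  (tensorKernel K L).ip_elem _ _

lemma lsmul_tmul {K L : Corr A} (a : A) (x : K) (y : L) : a • tmul x y = tmul (a • x) y :=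
  (tensorKernel K L).lsmul_elem a (x, y)

lemma rsmul_tmul {K L : Corr A} (a : A) (x : K) (y : L) : op a • tmul x y = tmul x (op a • y) :=
  (tensorKernel K L).rsmul_elem a (x, y)

lemma total_tmul' (K L : Corr A) : Total (fun p : K × L => tmul p.1 p.2) :=
  (tensorKernel K L).denseRange_elem

lemma ip_ext_of_total {X : Type u} {E : Corr A} {g : X → E} (hg : Total g) {x y : E}
    (h : ∀ z, E.ip x (g z) = E.ip y (g z)) : x = y :=
  E.ip_ext_left fun z => congrArg (fun T : E →L[ℂ] A => T z)
    (clm_ext_of_total hg (f := E.ipL x) (f' := E.ipL y) h)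

lemma norm_tmul_le {K L : Corr A} (x : K) (y : L) : ‖tmul x y‖ ≤ ‖x‖ * ‖y‖ := by
  refine le_of_sq_le_sq ?_ (by positivity)
  rw [(tensor K L).norm_sq, ip_tmul, mul_pow, K.norm_sq]
  calc _ ≤ ‖y‖ * ‖K.ip x x • y‖ := L.norm_ip_le _ _
    _ ≤ ‖y‖ * (‖K.ip x x‖ * ‖y‖) := by gcongr; exact L.norm_smul_le' _ _
    _ = _ := by ring

/-- The elementary tensors as a continuous bilinear map. -/
def tmulL (K L : Corr A) : K →L[ℂ] L →L[ℂ] tensor K L :=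
  LinearMap.mkContinuous₂ (LinearMap.mk₂ ℂ tmul
    (fun x x' y => ip_ext_of_total (total_tmul' K L) fun z => by
      simp [(tensor K L).isSemiInner.add_left, K.isSemiInner.add_left, add_smul, L.ip_add_right])
    (fun c x y => ip_ext_of_total (total_tmul' K L) fun z => by
      simp [(tensor K L).isSemiInner.smul_left, K.isSemiInner.smul_left,
        L.isSemiInner.smul_right])
    (fun x y y' => ip_ext_of_total (total_tmul' K L) fun z => by
      simp [(tensor K L).isSemiInner.add_left, L.isSemiInner.add_left])
    (fun c x y => ip_ext_of_total (total_tmul' K L) fun z => by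
      simp [(tensor K L).isSemiInner.smul_left, L.isSemiInner.smul_left]))
    1 (fun x y => by rw [one_mul]; exact norm_tmul_le x y)

@[simp] lemma tmulL_apply {K L : Corr A} (x : K) (y : L) : tmulL K L x y = tmul x y := rfl

/-- The tensors of two total families form a total family. -/
lemma total_tmul {X Y : Type u} {K L : Corr A} {g : X → K} {g' : Y → L} (hg : Total g)
    (hg' : Total g') : Total (fun p : X × Y => tmul (g p.1) (g' p.2)) := by
  set S := (LinearMap.range (Finsupp.linearCombination ℂ
    (fun p : X × Y => tmul (g p.1) (g' p.2)))).topologicalClosure with hS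
  have hSc : IsClosed (S : Set (tensor K L)) := Submodule.isClosed_topologicalClosure _
  have h0 : ∀ x y, tmul (g x) (g' y) ∈ S := fun x y =>
    Submodule.le_topologicalClosure _ ⟨Finsupp.single (x, y) 1, by
      rw [Finsupp.linearCombination_single, one_smul]⟩
  have h1 : ∀ x y, tmul x (g' y) ∈ S := fun x y => by
    refine hg.induction_on (p := fun x => tmulL K L x (g' y) ∈ S) x
      (hSc.preimage (by fun_prop)) fun v => ?_
    rw [Finsupp.linearCombination_apply, Finsupp.sum, map_sum, _root_.sum_apply]
    refine Submodule.sum_mem _ fun i _ => ?_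
    rw [map_smul, _root_.smul_apply]
    exact S.smul_mem _ (h0 i y)
  have h2 : ∀ x y, tmul x y ∈ S := fun x y => by
    refine hg'.induction_on (p := fun y => tmulL K L x y ∈ S) y
      (hSc.preimage (by fun_prop)) fun v => ?_
    rw [Finsupp.linearCombination_apply, Finsupp.sum, map_sum]
    refine Submodule.sum_mem _ fun i _ => ?_
    rw [map_smul]
    exact S.smul_mem _ (h1 x i)
  intro z
  change z ∈ S
  refine (total_tmul' K L).induction_on (p := fun z => z ∈ S) z hSc fun v => ?_
  rw [Finsupp.linearCombination_apply, Finsupp.sum]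
  exact Submodule.sum_mem _ fun i _ => S.smul_mem _ (h2 _ _)

end Corr

namespace Corr

variable {A : Type u} [CStarAlgebra A] [PartialOrder A] [StarOrderedRing A]

lemma total_id (K : Corr A) : Total (fun x : K => x) := fun x =>
  subset_closure ⟨Finsupp.single x 1, by rw [Finsupp.linearCombination_single, one_smul]⟩

lemma total_tmul₂ (K L M : Corr A) :
    Total (fun p : (K × L) × M => tmul (tmul p.1.1 p.1.2) p.2) := by
  have := total_tmul (g := fun p : K × L => tmul p.1 p.2) (g' := fun x : M => x)
    (total_tmul' K L) (total_id M)
  exact this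

lemma total_tmul₂' (K L M : Corr A) :
    Total (fun p : (K × L) × M => tmul p.1.1 (tmul p.1.2 p.2)) := by
  have := total_tmul (total_id K) (g' := fun p : L × M => tmul p.1 p.2) (total_tmul' L M)
  intro z
  refine closure_mono ?_ (this z)
  rintro _ ⟨v, rfl⟩
  refine ⟨Finsupp.mapDomain (fun p => ((p.1, p.2.1), p.2.2)) v, ?_⟩
  rw [Finsupp.linearCombination_mapDomain]
  rfl

lemma iterate_adj_norm_le {K K' : Corr A} (f : K ⟶ K') (n : ℕ) (x : K) :
    ‖(fun x => adj f (f x))^[n] x‖ ≤ (‖op' (f ≫ adj f)‖ + 1) ^ n * ‖x‖ := by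
  induction n generalizing x with
  | zero => simp
  | succ n ih =>
    rw [Function.iterate_succ_apply, pow_succ, mul_assoc]
    refine (ih _).trans (mul_le_mul_of_nonneg_left ?_ (by positivity))
    refine ((op' (f ≫ adj f)).le_opNorm x).trans ?_
    exact mul_le_mul_of_nonneg_right (by linarith) (norm_nonneg x)

/-- Elementary tensors are balanced. -/
lemma tmul_lsmul {K L : Corr A} (a : A) (x : K) (y : L) : tmul x (a • y) = tmul (op a • x) y :=
  ip_ext_of_total (total_tmul' K L) fun q => by
    rw [ip_tmul, ip_tmul, L.ip_left, K.ip_rsmul_left, mul_smul]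

/-- The tensor product of morphisms, `(f ⊗ g) (k ⊗ l) = f k ⊗ g l`. -/
def tensorMap {K K' L L' : Corr A} (f : K ⟶ K') (g : L ⟶ L') : tensor K L ⟶ tensor K' L' :=
  genHom (fun p : K × L => (f p.1, g p.2)) (fun p : K' × L' => (adj f p.1, adj g p.2))
    (total_tmul' K L) (total_tmul' K' L')
    (fun x y => by simp only [ip_tmul, ip_adj, map_lsmul])
    ⟨(‖op' (f ≫ adj f)‖ + 1) * (‖op' (g ≫ adj g)‖ + 1), by positivity, fun p =>
      ⟨‖p.1‖ * ‖p.2‖, fun n => by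
        have e : ∀ (n : ℕ) (p : K × L), ((fun p : K' × L' => (adj f p.1, adj g p.2)) ∘
            fun p : K × L => (f p.1, g p.2))^[n] p =
            ((fun x => adj f (f x))^[n] p.1, (fun x => adj g (g x))^[n] p.2) := by
          intro n
          induction n with
          | zero => intro p; rfl
          | succ n ih => intro p; rw [Function.iterate_succ_apply, ih]; rfl
        rw [e, mul_pow]
        refine (norm_tmul_le _ _).trans ?_
        refine (mul_le_mul (iterate_adj_norm_le f n p.1) (iterate_adj_norm_le g n p.2)
          (norm_nonneg _) (by positivity)).trans_eq (by ring)⟩⟩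
    (fun a p => ⟨(a • p.1, p.2), lsmul_tmul a _ _, by
      rw [lsmul_tmul, map_lsmul]⟩)

@[simp] lemma tensorMap_tmul {K K' L L' : Corr A} (f : K ⟶ K') (g : L ⟶ L') (x : K) (y : L) :
    tensorMap f g (tmul x y) = tmul (f x) (g y) :=
  genHom_apply (fun p : K × L => (f p.1, g p.2)) _ (total_tmul' K L) (total_tmul' K' L') _ _ _
    (x, y)

/-- The algebra `A` as a correspondence over itself. -/
def unit (A : Type u) [CStarAlgebra A] [PartialOrder A] [StarOrderedRing A] : Corr A where
  carrier := A
  ip a b := star a * b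
  ip_add_right a b c := mul_add _ _ _
  ip_smul_right a x y := by rw [op_smul_eq_mul, mul_assoc]
  star_ip x y := by rw [star_mul, star_star]
  ip_nonneg x := star_mul_self_nonneg x
  norm_sq x := by rw [CStarRing.norm_star_mul_self, pow_two]
  ip_left a x y := by rw [smul_eq_mul, smul_eq_mul, star_mul, mul_assoc]

lemma ip_unit (a b : unit A) : (unit A).ip a b = star (show A from a) * (show A from b) := rfl

/-- The associator `(k ⊗ l) ⊗ m ↦ k ⊗ (l ⊗ m)`. -/
def assoc (K L M : Corr A) : tensor (tensor K L) M ≅ tensor K (tensor L M) :=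
  genIso (total_tmul₂ K L M) (total_tmul₂' K L M)
    (fun p q => by simp only [ip_tmul, lsmul_tmul])
    (fun a p => ⟨((a • p.1.1, p.1.2), p.2), by simp only [lsmul_tmul], by simp only [lsmul_tmul]⟩)

@[simp] lemma assoc_tmul {K L M : Corr A} (x : K) (y : L) (z : M) :
    (assoc K L M).hom (tmul (tmul x y) z) = tmul x (tmul y z) :=
  genIso_hom_apply (total_tmul₂ K L M) (total_tmul₂' K L M) _ _ ((x, y), z)

lemma total_lsmul (K : Corr A) :
    Total (fun p : unit A × K => (show A from p.1) • p.2) := fun x =>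
  subset_closure ⟨Finsupp.single ((1 : A), x) 1, by
    rw [Finsupp.linearCombination_single, one_smul]; exact one_smul A x⟩

lemma total_rsmul (K : Corr A) :
    Total (fun p : K × unit A => op (show A from p.2) • p.1) := fun x =>
  subset_closure ⟨Finsupp.single (x, (1 : A)) 1, by
    rw [Finsupp.linearCombination_single, one_smul]; exact one_smul Aᵐᵒᵖ x⟩

/-- The left unitor `a ⊗ k ↦ a k`. -/
def lunit (K : Corr A) : tensor (unit A) K ≅ K :=
  genIso (total_tmul' (unit A) K) (total_lsmul K)
    (fun p q => by
      rw [ip_tmul, ip_unit, K.ip_left, mul_smul])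
    (fun a p => ⟨(a • p.1, p.2), lsmul_tmul a p.1 p.2, (mul_smul a (show A from p.1) p.2).symm⟩)

@[simp] lemma lunit_tmul {K : Corr A} (a : A) (x : K) :
    (lunit K).hom (tmul (K := unit A) a x) = a • x :=
  genIso_hom_apply (total_tmul' (unit A) K) (total_lsmul K) _ _ ((show unit A from a), x)

/-- The right unitor `k ⊗ a ↦ k a`. -/
def runit (K : Corr A) : tensor K (unit A) ≅ K :=
  genIso (total_tmul' K (unit A)) (total_rsmul K)
    (fun p q => by
      rw [ip_tmul, ip_unit, K.ip_smul_right, K.ip_rsmul_left, mul_assoc]; rfl)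
    (fun a p => ⟨(a • p.1, p.2), lsmul_tmul a p.1 p.2, smul_comm _ _ _⟩)

@[simp] lemma runit_tmul {K : Corr A} (x : K) (a : A) :
    (runit K).hom (tmul (L := unit A) x a) = op a • x :=
  genIso_hom_apply (total_tmul' K (unit A)) (total_rsmul K) _ _ (x, (show unit A from a))

instance : MonoidalCategoryStruct (Corr A) where
  tensorObj := tensor
  tensorUnit := unit A
  whiskerLeft K _ _ f := tensorMap (𝟙 K) f
  whiskerRight f L := tensorMap f (𝟙 L)
  tensorHom := tensorMap
  associator := assoc
  leftUnitor := lunit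
  rightUnitor := runit

/-- Right `A`-`A`-correspondences form a monoidal category under the relative tensor product. -/
instance : MonoidalCategory (Corr A) := MonoidalCategory.ofTensorHom
  (fun K L => hom_ext_of_total (total_tmul' K L) fun p => tensorMap_tmul _ _ _ _)
  (fun _ _ _ _ => rfl)
  (fun _ _ => rfl)
  (fun {K _ _ L _ _} f g f' g' => hom_ext_of_total (total_tmul' K L) fun p => by
    change tensorMap f' g' (tensorMap f g _) = tensorMap (f ≫ f') (g ≫ g') _
    simp only [tensorMap_tmul, comp_apply])
  (fun {K L M K' L' M'} f g h => hom_ext_of_total (total_tmul₂ K L M) fun p => by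
    change (assoc K' L' M').hom (tensorMap (tensorMap f g) h _) =
      tensorMap f (tensorMap g h) ((assoc K L M).hom _)
    simp only [tensorMap_tmul, assoc_tmul])
  (fun {K L} f => hom_ext_of_total (total_tmul' (unit A) K) fun p => by
    change (lunit L).hom (tensorMap _ f _) = f ((lunit K).hom _)
    rw [tensorMap_tmul, lunit_tmul (A := A) p.1 p.2]
    exact (lunit_tmul (A := A) p.1 (f p.2)).trans (map_lsmul f _ _).symm)
  (fun {K L} f => hom_ext_of_total (total_tmul' K (unit A)) fun p => by
    change (runit L).hom (tensorMap f _ _) = f ((runit K).hom _)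
    rw [tensorMap_tmul, runit_tmul (A := A) p.1 p.2]
    exact (runit_tmul (A := A) (f p.1) p.2).trans (map_rsmul f _ _).symm)
  (fun W X Y Z => hom_ext_of_total
      (total_tmul (g := fun p : (W × X) × Y => tmul (tmul p.1.1 p.1.2) p.2)
        (total_tmul₂ W X Y) (total_id Z)) fun p => by
    change tensorMap (𝟙 W) (assoc X Y Z).hom ((assoc W (tensor X Y) Z).hom
      (tensorMap (assoc W X Y).hom (𝟙 Z) _)) =
      (assoc W X (tensor Y Z)).hom ((assoc (tensor W X) Y Z).hom _)
    simp only [tensorMap_tmul, assoc_tmul, id_apply])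
  (fun K L => hom_ext_of_total (total_tmul₂ K (unit A) L) fun p => by
    change tensorMap (𝟙 K) (lunit L).hom ((assoc K (unit A) L).hom _) =
      tensorMap (runit K).hom (𝟙 L) _
    rw [assoc_tmul, tensorMap_tmul, tensorMap_tmul, lunit_tmul (A := A) p.1.2 p.2,
      runit_tmul (A := A) p.1.1 p.1.2, id_apply, id_apply]
    exact tmul_lsmul _ _ _)

end Corr

/-! ### Finitely generated projective bi-Hilbertian correspondences -/

section Bimodules

variable (A : Type u) [CStarAlgebra A] [PartialOrder A] [StarOrderedRing A]

/-- A left `A`-valued inner product on a correspondence (for which the right action is by adjointable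
operators) inducing the same topology as the right inner product. -/
structure LeftInner {A : Type u} [CStarAlgebra A] [PartialOrder A] [StarOrderedRing A]
    (K : Corr A) where
  lip : K → K → A
  lip_add_left : ∀ x y z, lip (x + y) z = lip x z + lip y z
  lip_smul_left : ∀ (a : A) x y, lip (a • x) y = a * lip x y
  star_lip : ∀ x y, star (lip x y) = lip y x
  lip_nonneg : ∀ x, 0 ≤ lip x x
  lip_right : ∀ (a : A) x y, lip (op a • x) y = lip x (op (star a) • y)
  norm_equiv : ∃ c C : ℝ, 0 < c ∧ 0 < C ∧ ∀ x, c * ‖x‖ ^ 2 ≤ ‖lip x x‖ ∧ ‖lip x x‖ ≤ C * ‖x‖ ^ 2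

/-- An object of `Bim_fgp(A)`: a bi-Hilbertian correspondence that is finitely generated projective
as a right and as a left `A`-module. Morphisms are those of the underlying correspondences, that is,
`Bim_fgp(A)` is a full subcategory. -/
structure BimFgp where
  obj : Corr A
  biHilbertian : Nonempty (LeftInner obj)
  finite_right : Module.Finite Aᵐᵒᵖ obj
  projective_right : Module.Projective Aᵐᵒᵖ obj
  finite_left : Module.Finite A obj
  projective_left : Module.Projective A obj

variable {A}

/-- Irreducible objects: the endomorphism algebra is `ℂ`. -/
def IsIrreducible (K : Corr A) : Prop :=
  𝟙 K ≠ 0 ∧ ∀ f : K ⟶ K, ∃ c : ℂ, f = c • 𝟙 K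

variable (A) in
/-- A choice of `Irr(A)`: representatives of the isomorphism classes of irreducible objects of
`Bim_fgp(A)`. -/
structure IrrSystem where
  ι : Type u
  obj : ι → BimFgp A
  irreducible : ∀ i, IsIrreducible (obj i).obj
  disjoint : ∀ i j, i ≠ j → ∀ f : (obj i).obj ⟶ (obj j).obj, f = 0
  complete : ∀ X : BimFgp A, IsIrreducible X.obj → ∃ i, Nonempty (X.obj ≅ (obj i).obj)

/-- A solution of the conjugate equations for `X` in `Bim_fgp(A)`. -/
structure ConjugateSolution (X : BimFgp A) where
  dual : BimFgp A
  R : 𝟙_ (Corr A) ⟶ dual.obj ⊗ X.obj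
  Rbar : 𝟙_ (Corr A) ⟶ X.obj ⊗ dual.obj
  conj_obj : (ρ_ X.obj).inv ≫ X.obj ◁ R ≫ (α_ X.obj dual.obj X.obj).inv ≫
    Corr.adj Rbar ▷ X.obj ≫ (λ_ X.obj).hom = 𝟙 X.obj
  conj_dual : (ρ_ dual.obj).inv ≫ dual.obj ◁ Rbar ≫ (α_ dual.obj X.obj dual.obj).inv ≫
    Corr.adj R ▷ dual.obj ≫ (λ_ dual.obj).hom = 𝟙 dual.obj

/-- The intrinsic dimension `d_X`, the minimum of `‖R‖ ‖R̄‖` over the solutions `(R, R̄)` of the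
conjugate equations. -/
def dim (X : BimFgp A) : ℝ :=
  ⨅ s : ConjugateSolution X, ‖Corr.op' s.R‖ * ‖Corr.op' s.Rbar‖

end Bimodules

/-! ### The unitary ind-completion -/

section Ind

/-- An object of the unitary ind-completion `Hilb(Bim_fgp(A))`: a linear `*`-functor from
`Bim_fgp(A)ᵒᵖ` to Hilbert spaces. -/
structure HilbInd (A : Type u) [CStarAlgebra A] [PartialOrder A] [StarOrderedRing A] where
  obj : BimFgp A → Type u
  [group : ∀ X, NormedAddCommGroup (obj X)]
  [innerSpace : ∀ X, InnerProductSpace ℂ (obj X)]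
  [complete : ∀ X, CompleteSpace (obj X)]
  map : ∀ X Y : BimFgp A, (X.obj ⟶ Y.obj) →ₗ[ℂ] (obj Y →L[ℂ] obj X)
  map_id : ∀ X, map X X (𝟙 X.obj) = ContinuousLinearMap.id ℂ (obj X)
  map_comp : ∀ X Y Z (f : X.obj ⟶ Y.obj) (g : Y.obj ⟶ Z.obj),
    map X Z (f ≫ g) = (map X Y f).comp (map Y Z g)
  map_adj : ∀ X Y (f : X.obj ⟶ Y.obj),
    map Y X (Corr.adj f) = ContinuousLinearMap.adjoint (map X Y f)

namespace HilbInd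

attribute [instance] HilbInd.group HilbInd.innerSpace HilbInd.complete

variable {A : Type u} [CStarAlgebra A] [PartialOrder A] [StarOrderedRing A]

/-- The space of uniformly bounded natural transformations. -/
def homSubmodule (H G : HilbInd A) : Submodule ℂ (∀ X, H.obj X →L[ℂ] G.obj X) where
  carrier := {η | (∀ X Y (f : X.obj ⟶ Y.obj), (η X).comp (H.map X Y f) = (G.map X Y f).comp (η Y)) ∧
    ∃ C : ℝ, ∀ X, ‖η X‖ ≤ C}
  add_mem' := by
    rintro η θ ⟨h, C, hC⟩ ⟨h', C', hC'⟩
    refine ⟨fun X Y f => ?_, C + C', fun X => (norm_add_le _ _).trans (add_le_add (hC X) (hC' X))⟩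
    rw [Pi.add_apply, Pi.add_apply, ContinuousLinearMap.add_comp, ContinuousLinearMap.comp_add, h,
      h']
  zero_mem' := ⟨fun X Y f => by simp, 0, fun X => by simp⟩
  smul_mem' := by
    rintro c η ⟨h, C, hC⟩
    refine ⟨fun X Y f => ?_, ‖c‖ * C, fun X => ?_⟩
    · rw [Pi.smul_apply, Pi.smul_apply, ContinuousLinearMap.smul_comp,
        ContinuousLinearMap.comp_smul, h]
    · rw [Pi.smul_apply, norm_smul]
      exact mul_le_mul_of_nonneg_left (hC X) (norm_nonneg c)

/-- Morphisms of Hilbert space objects: uniformly bounded natural transformations. -/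
def Hom (H G : HilbInd A) : Type (u + 1) := homSubmodule H G

instance (H G : HilbInd A) : AddCommGroup (Hom H G) :=
  inferInstanceAs (AddCommGroup (homSubmodule H G))
instance (H G : HilbInd A) : Module ℂ (Hom H G) := inferInstanceAs (Module ℂ (homSubmodule H G))

instance : Category (HilbInd A) where
  Hom := Hom
  id H := ⟨fun X => ContinuousLinearMap.id ℂ (H.obj X), fun X Y f => rfl, 1, fun X =>
    ContinuousLinearMap.norm_id_le⟩
  comp η θ := ⟨fun X => (θ.1 X).comp (η.1 X), fun X Y f => by
      rw [ContinuousLinearMap.comp_assoc, η.2.1, ← ContinuousLinearMap.comp_assoc, θ.2.1,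
        ContinuousLinearMap.comp_assoc], by
      obtain ⟨C, hC⟩ := η.2.2
      obtain ⟨D, hD⟩ := θ.2.2
      exact ⟨D * C, fun X => (ContinuousLinearMap.opNorm_comp_le _ _).trans
        (mul_le_mul (hD X) (hC X) (norm_nonneg _) ((norm_nonneg _).trans (hD X)))⟩⟩

/-- The component of a morphism at an object. -/
def app {H G : HilbInd A} (η : H ⟶ G) (X : BimFgp A) : H.obj X →L[ℂ] G.obj X :=
  Subtype.val (p := fun η => η ∈ homSubmodule H G) η X

@[ext] lemma hom_ext {H G : HilbInd A} {η θ : H ⟶ G} (h : ∀ X, app η X = app θ X) : η = θ :=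
  Subtype.ext (funext h)

@[simp] lemma id_app (H : HilbInd A) (X : BimFgp A) :
    app (𝟙 H) X = ContinuousLinearMap.id ℂ (H.obj X) := rfl
@[simp] lemma comp_app {H G F : HilbInd A} (η : H ⟶ G) (θ : G ⟶ F) (X : BimFgp A) :
    app (η ≫ θ) X = (app θ X).comp (app η X) := rfl

instance : Preadditive (HilbInd A) where
  homGroup H G := inferInstanceAs (AddCommGroup (Hom H G))
  add_comp _ _ _ _ _ _ := hom_ext fun _ => ContinuousLinearMap.comp_add _ _ _
  comp_add _ _ _ _ _ _ := hom_ext fun _ => ContinuousLinearMap.add_comp _ _ _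

instance : Linear ℂ (HilbInd A) where
  homModule H G := inferInstanceAs (Module ℂ (Hom H G))
  smul_comp _ _ _ _ _ _ := hom_ext fun _ => ContinuousLinearMap.comp_smul _ _ _
  comp_smul _ _ _ _ _ _ := hom_ext fun _ => ContinuousLinearMap.smul_comp _ _ _

lemma exists_bound {H G : HilbInd A} (η : H ⟶ G) : ∃ C : ℝ, ∀ X, ‖app η X‖ ≤ C := η.2.2

/-- The adjoint of a morphism, computed objectwise. -/
def adj {H G : HilbInd A} (η : H ⟶ G) : G ⟶ H :=
  ⟨fun X => ContinuousLinearMap.adjoint (app η X), fun X Y f => by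
    have h := congrArg ContinuousLinearMap.adjoint (η.2.1 Y X (Corr.adj f))
    rw [ContinuousLinearMap.adjoint_comp, ContinuousLinearMap.adjoint_comp, H.map_adj, G.map_adj,
      ContinuousLinearMap.adjoint_adjoint, ContinuousLinearMap.adjoint_adjoint] at h
    exact h.symm, by
    obtain ⟨C, hC⟩ := exists_bound η
    exact ⟨C, fun X => by rw [LinearIsometryEquiv.norm_map]; exact hC X⟩⟩

@[simp] lemma adj_app {H G : HilbInd A} (η : H ⟶ G) (X : BimFgp A) :
    app (adj η) X = ContinuousLinearMap.adjoint (app η X) := rfl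

end HilbInd

end Ind

/-! ### Realization -/

section Realization

variable {A : Type u} [CStarAlgebra A] [PartialOrder A] [StarOrderedRing A]

lemma amplification_pos (K : Corr A) {V : Type u} [NormedAddCommGroup V] [InnerProductSpace ℂ V]
    (w : K × V →₀ ℂ) :
    0 ≤ w.sum fun x c => star c • w.sum fun y d => d • ⟪x.2, y.2⟫_ℂ • K.ip x.1 y.1 := by
  classical
  obtain ⟨m, B, hB⟩ := Matrix.posSemidef_iff_eq_sum_vecMulVec.mp
    (Matrix.posSemidef_gram ℂ fun x : w.support => x.1.2)
  have hB' : ∀ x y : w.support, ⟪x.1.2, y.1.2⟫_ℂ = ∑ z, star (star (B z x)) * star (B z y) :=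
    fun x y => by
      have := congrFun (congrFun hB x) y
      rw [Matrix.gram_apply, Matrix.sum_apply] at this
      refine this.trans (Finset.sum_congr rfl fun z _ => ?_)
      rw [Matrix.vecMulVec_apply, star_star, Pi.star_apply]
  have h : (w.sum fun x c => star c • w.sum fun y d => d • ⟪x.2, y.2⟫_ℂ • K.ip x.1 y.1) =
      ∑ z : Fin m, K.ip (∑ x : w.support, (star (B z x) * w x) • x.1.1)
        (∑ x : w.support, (star (B z x) * w x) • x.1.1) := by
    calc _ = ∑ x : w.support, star (w x) • ∑ y : w.support,
          w y • ⟪x.1.2, y.1.2⟫_ℂ • K.ip x.1.1 y.1.1 := by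
          simp only [Finsupp.sum]
          rw [← Finset.sum_coe_sort]
          refine Finset.sum_congr rfl fun x _ => ?_
          rw [← Finset.sum_coe_sort]
      _ = ∑ x : w.support, ∑ y : w.support, ∑ z : Fin m,
          (star (star (B z x) * w x) * (star (B z y) * w y)) • K.ip x.1.1 y.1.1 := by
          refine Finset.sum_congr rfl fun x _ => ?_
          rw [Finset.smul_sum]
          refine Finset.sum_congr rfl fun y _ => ?_
          rw [hB', Finset.sum_smul, Finset.smul_sum, Finset.smul_sum]
          refine Finset.sum_congr rfl fun z _ => ?_
          rw [smul_smul, smul_smul, star_mul]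
          congr 1
          ring
      _ = ∑ z : Fin m, ∑ x : w.support, ∑ y : w.support,
          (star (star (B z x) * w x) * (star (B z y) * w y)) • K.ip x.1.1 y.1.1 := by
          rw [Finset.sum_congr rfl fun i _ => Finset.sum_comm]
          exact Finset.sum_comm
      _ = _ := by
          refine Finset.sum_congr rfl fun z _ => ?_
          rw [K.ip_sum_left]
          refine Finset.sum_congr rfl fun x _ => ?_
          rw [K.ip_sum_right]
          refine Finset.sum_congr rfl fun y _ => ?_
          rw [K.isSemiInner.smul_left, K.isSemiInner.smul_right, smul_smul]
  rw [h]
  exact Finset.sum_nonneg fun z _ => K.ip_nonneg _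

variable (S : IrrSystem A)

/-- The elementary vectors `k ⊗ h`, for `k ∈ K` and `h ∈ H(K)`, `K ∈ Irr(A)`. -/
abbrev Elem (H : HilbInd A) : Type u := Σ i, (S.obj i).obj × H.obj (S.obj i)

open Classical in
/-- The inner product of the elementary vectors:
`⟨k ⊗ h, k' ⊗ h'⟩ = ⟪h, h'⟫ ⟨k, k'⟩` on each summand, different summands being orthogonal. -/
def realIp (H : HilbInd A) (p q : Elem S H) : A :=
  if e : q.1 = p.1 then
    ⟪p.2.2, (e ▸ q.2 : (S.obj p.1).obj × H.obj (S.obj p.1)).2⟫_ℂ •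
      (S.obj p.1).obj.ip p.2.1 (e ▸ q.2 : (S.obj p.1).obj × H.obj (S.obj p.1)).1
  else 0

lemma realIp_same (H : HilbInd A) (i : S.ι) (x y : (S.obj i).obj × H.obj (S.obj i)) :
    realIp S H ⟨i, x⟩ ⟨i, y⟩ = ⟪x.2, y.2⟫_ℂ • (S.obj i).obj.ip x.1 y.1 := by
  exact dif_pos rfl

lemma realIp_ne (H : HilbInd A) {i j : S.ι} (h : j ≠ i) (x : (S.obj i).obj × H.obj (S.obj i))
    (y : (S.obj j).obj × H.obj (S.obj j)) : realIp S H ⟨i, x⟩ ⟨j, y⟩ = 0 := by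
  exact dif_neg h

lemma realIp_pos (H : HilbInd A) (v : Elem S H →₀ ℂ) :
    0 ≤ v.sum fun p c => star c • Finsupp.linearCombination ℂ (realIp S H p) v := by
  have key : ∀ (f : Elem S H → ℂ → A), v.sum f =
      ∑ i ∈ Finsupp.splitSupport v, (Finsupp.split v i).sum fun x c => f ⟨i, x⟩ c :=
    fun f => Finsupp.sigma_sum v f
  rw [key]
  refine Finset.sum_nonneg fun i hi => ?_
  refine (amplification_pos (S.obj i).obj (Finsupp.split v i)).trans_eq ?_
  refine Finset.sum_congr rfl fun x _ => ?_
  dsimp only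
  congr 1
  rw [Finsupp.linearCombination_apply, key, Finset.sum_eq_single i]
  · refine Finset.sum_congr rfl fun y _ => ?_
    dsimp only
    rw [realIp_same]
  · intro j _ hj
    refine Finset.sum_eq_zero fun y _ => ?_
    dsimp only
    rw [realIp_ne S H hj, smul_zero]
  · exact fun h => absurd hi h

/-- The kernel defining the realization. -/
def realKernel (H : HilbInd A) : Kernel A (Elem S H) where
  κ := realIp S H
  left a p := ⟨p.1, a • p.2.1, p.2.2⟩
  right a p := ⟨p.1, op a • p.2.1, p.2.2⟩
  star_κ := by
    rintro ⟨i, x⟩ ⟨j, y⟩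
    by_cases h : j = i
    · subst h
      rw [realIp_same, realIp_same, star_smul, Corr.star_ip, ← inner_conj_symm]
      rw [starRingEnd_apply, star_star]
    · rw [realIp_ne S H h, realIp_ne S H (Ne.symm h), star_zero]
  pos := realIp_pos S H
  κ_left := by
    rintro a ⟨i, x⟩ ⟨j, y⟩
    by_cases h : j = i
    · subst h
      rw [realIp_same, realIp_same, Corr.ip_left]
    · rw [realIp_ne S H h, realIp_ne S H h]
  κ_right := by
    rintro a ⟨i, x⟩ ⟨j, y⟩
    by_cases h : j = i
    · subst h
      rw [realIp_same, realIp_same, Corr.ip_smul_right, smul_mul_assoc]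
    · rw [realIp_ne S H h, realIp_ne S H h, zero_mul]
  left_add := by
    rintro a b ⟨i, x⟩ ⟨j, y⟩
    by_cases h : j = i
    · subst h
      rw [realIp_same, realIp_same, realIp_same, add_smul, Corr.ip_add_right, smul_add]
    · rw [realIp_ne S H h, realIp_ne S H h, realIp_ne S H h, add_zero]
  left_mul := by
    rintro a b ⟨i, x⟩ ⟨j, y⟩
    dsimp only
    rw [mul_smul]
  left_scalar := by
    rintro c ⟨i, x⟩ ⟨j, y⟩
    by_cases h : j = i
    · subst h
      rw [realIp_same, realIp_same, algebraMap_smul, (S.obj j).obj.isSemiInner.smul_right,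
        smul_comm]
    · rw [realIp_ne S H h, realIp_ne S H h, smul_zero]

/-- The realization `|H| = ⨁_{K ∈ Irr(A)} K ⊗ H(K)` (an `ℓ²`-direct sum of amplifications) of a
Hilbert space object: the separated completion of the span of the elementary vectors. -/
def realObj (H : HilbInd A) : Corr A := (realKernel S H).toCorr

/-- The elementary vector `k ⊗ h` of the summand indexed by `i`. -/
def relem {H : HilbInd A} (i : S.ι) (k : (S.obj i).obj) (h : H.obj (S.obj i)) : realObj S H :=
  (realKernel S H).elem ⟨i, k, h⟩

lemma ip_relem {H : HilbInd A} (i : S.ι) (k k' : (S.obj i).obj) (h h' : H.obj (S.obj i)) :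
    (realObj S H).ip (relem S i k h) (relem S i k' h') = ⟪h, h'⟫_ℂ • (S.obj i).obj.ip k k' :=
  ((realKernel S H).ip_elem _ _).trans (realIp_same S H i (k, h) (k', h'))

lemma ip_relem_ne {H : HilbInd A} {i j : S.ι} (hij : j ≠ i) (k : (S.obj i).obj)
    (k' : (S.obj j).obj) (h : H.obj (S.obj i)) (h' : H.obj (S.obj j)) :
    (realObj S H).ip (relem S i k h) (relem S j k' h') = 0 :=
  ((realKernel S H).ip_elem _ _).trans (realIp_ne S H hij (k, h) (k', h'))

lemma total_relem (H : HilbInd A) :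
    Corr.Total (fun p : Elem S H => relem S p.1 p.2.1 p.2.2) :=
  (realKernel S H).denseRange_elem

lemma norm_relem {H : HilbInd A} (i : S.ι) (k : (S.obj i).obj) (h : H.obj (S.obj i)) :
    ‖relem S i k h‖ = ‖k‖ * ‖h‖ := by
  rw [← sq_eq_sq₀ (norm_nonneg _) (by positivity), (realObj S H).norm_sq, ip_relem, norm_smul,
    ← (S.obj i).obj.norm_sq, inner_self_eq_norm_sq_to_K, mul_pow, mul_comm]
  simp

/-- The map `k ⊗ h ↦ k ⊗ η h` on elementary vectors. -/
def elemMap {H G : HilbInd A} (η : H ⟶ G) (p : Elem S H) : Elem S G :=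
  ⟨p.1, p.2.1, HilbInd.app η _ p.2.2⟩

/-- The action of the realization on morphisms, `|η| (k ⊗ h) = k ⊗ η h`. -/
def realMap {H G : HilbInd A} (η : H ⟶ G) : realObj S H ⟶ realObj S G :=
  Corr.genHom (elemMap S η)
    (elemMap S (HilbInd.adj η))
    (total_relem S H) (total_relem S G)
    (by
      rintro ⟨i, k, h⟩ ⟨j, k', h'⟩
      dsimp only [elemMap]
      by_cases e : j = i
      · subst e
        rw [ip_relem, ip_relem, HilbInd.adj_app, ContinuousLinearMap.adjoint_inner_right]
      · rw [ip_relem_ne S e, ip_relem_ne S e])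
    (by
      obtain ⟨C, hC⟩ := HilbInd.exists_bound η
      refine ⟨|C| * |C| + 1, by positivity, fun p => ⟨‖p.2.1‖ * ‖p.2.2‖, fun n => ?_⟩⟩
      have e : ∀ (n : ℕ) (p : Elem S H), (elemMap S (HilbInd.adj η) ∘ elemMap S η)^[n] p =
          ⟨p.1, p.2.1, (fun h => HilbInd.app (HilbInd.adj η) _ (HilbInd.app η _ h))^[n] p.2.2⟩ := by
        intro n
        induction n with
        | zero => intro p; rfl
        | succ n ih => intro p; rw [Function.iterate_succ_apply, ih]; rfl
      have b : ∀ (n : ℕ) (i : S.ι) (h : H.obj (S.obj i)),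
          ‖(fun h => HilbInd.app (HilbInd.adj η) _ (HilbInd.app η _ h))^[n] h‖ ≤ ‖h‖ * (|C| * |C| + 1) ^ n := by
        intro n i
        induction n with
        | zero => intro h; simp
        | succ n ih =>
          intro h
          rw [Function.iterate_succ_apply, pow_succ']
          refine (ih _).trans ?_
          rw [← mul_assoc]
          refine mul_le_mul_of_nonneg_right ?_ (by positivity)
          have h1 : ‖HilbInd.app η (S.obj i)‖ ≤ |C| := (hC _).trans (le_abs_self C)
          have h2 : ‖HilbInd.app (HilbInd.adj η) (S.obj i)‖ ≤ |C| := by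
            rw [HilbInd.adj_app, LinearIsometryEquiv.norm_map]; exact h1
          calc _ ≤ |C| * (|C| * ‖h‖) := ((HilbInd.app (HilbInd.adj η) (S.obj i)).le_opNorm _).trans
                (mul_le_mul h2 (((HilbInd.app η (S.obj i)).le_opNorm h).trans
                  (mul_le_mul_of_nonneg_right h1 (norm_nonneg _))) (norm_nonneg _) (abs_nonneg _))
            _ ≤ _ := by nlinarith [norm_nonneg h]
      rw [e]
      dsimp only
      rw [norm_relem, mul_assoc]
      exact mul_le_mul_of_nonneg_left (b n _ _) (norm_nonneg _))
    (fun a p => ⟨⟨p.1, a • p.2.1, p.2.2⟩, (realKernel S H).lsmul_elem a _,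
      (realKernel S G).lsmul_elem a _⟩)

lemma realMap_relem {H G : HilbInd A} (η : H ⟶ G) (i : S.ι) (k : (S.obj i).obj)
    (h : H.obj (S.obj i)) : realMap S η (relem S i k h) = relem S i k (HilbInd.app η _ h) :=
  Corr.genHom_apply (elemMap S η) _
    (total_relem S H) (total_relem S G) _ _ _ ⟨i, k, h⟩

/-- The realization functor. -/
def realization : HilbInd A ⥤ Corr A where
  obj := realObj S
  map := realMap S
  map_id H := Corr.hom_ext_of_total (total_relem S H) fun p => by
    rw [realMap_relem]; rfl
  map_comp η θ := Corr.hom_ext_of_total (total_relem S _) fun p => by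
    rw [Corr.comp_apply, realMap_relem, realMap_relem, realMap_relem]; rfl

end Realization

/-! ### The tensor structure of the unitary ind-completion -/

section Tensor

variable {A : Type u} [CStarAlgebra A] [PartialOrder A] [StarOrderedRing A]

/-- The tensor structure of `Hilb(Bim_fgp(A))`, the extension of the one of `Bim_fgp(A)`:
`(H ⊠ G)(X) = ⨁_{Y, Z ∈ Irr(A)} Hom(X, Y ⊗ Z) ⊗ H(Y) ⊗ G(Z)`
as an `ℓ²`-direct sum in which `Hom(X, Y ⊗ Z)` has the trace inner product and the `(Y, Z)` summand
is scaled by `(d_Y d_Z)⁻¹`. The element `f ⊗ h ⊗ g` is `tmul X Y Z f h g`, for all objects `Y` and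
`Z` and balanced over morphisms. The tensor unit is `X ↦ Hom(X, 𝟙)`, and the structure morphisms are
those induced by `Bim_fgp(A)`. This determines the structure up to unitary isomorphism. -/
structure IndTensor (S : IrrSystem A) where
  [monoidal : MonoidalCategory (HilbInd A)]
  tmul : ∀ {H G : HilbInd A} (X Y Z : BimFgp A),
    (X.obj ⟶ Y.obj ⊗ Z.obj) →ₗ[ℂ] H.obj Y →ₗ[ℂ] G.obj Z →ₗ[ℂ] (H ⊗ G).obj X
  map_tmul : ∀ {H G : HilbInd A} (W X Y Z : BimFgp A) (u : W.obj ⟶ X.obj)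
    (f : X.obj ⟶ Y.obj ⊗ Z.obj) (h : H.obj Y) (g : G.obj Z),
    (H ⊗ G).map W X u (tmul X Y Z f h g) = tmul W Y Z (u ≫ f) h g
  tmul_map : ∀ {H G : HilbInd A} (X Y Z Y' Z' : BimFgp A) (f : X.obj ⟶ Y.obj ⊗ Z.obj)
    (a : Y.obj ⟶ Y'.obj) (b : Z.obj ⟶ Z'.obj) (h : H.obj Y') (g : G.obj Z'),
    tmul X Y Z f (H.map Y Y' a h) (G.map Z Z' b g) = tmul X Y' Z' (f ≫ (a ⊗ₘ b)) h g
  -- the trace inner product of `f` and `f'` is `d_X c`, where `f* f' = c`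
  inner_tmul : ∀ {H G : HilbInd A} (k i j : S.ι)
    (f f' : (S.obj k).obj ⟶ (S.obj i).obj ⊗ (S.obj j).obj) (c : ℂ),
    f' ≫ Corr.adj f = c • 𝟙 (S.obj k).obj →
    ∀ (h h' : H.obj (S.obj i)) (g g' : G.obj (S.obj j)),
      ⟪tmul (S.obj k) (S.obj i) (S.obj j) f h g, tmul (S.obj k) (S.obj i) (S.obj j) f' h' g'⟫_ℂ =
        ((dim (S.obj i) * dim (S.obj j))⁻¹ : ℝ) * (dim (S.obj k) * c) * ⟪h, h'⟫_ℂ * ⟪g, g'⟫_ℂ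
  inner_tmul_ne : ∀ {H G : HilbInd A} (k i j i' j' : S.ι), (i, j) ≠ (i', j') →
    ∀ (f : (S.obj k).obj ⟶ (S.obj i).obj ⊗ (S.obj j).obj)
      (f' : (S.obj k).obj ⟶ (S.obj i').obj ⊗ (S.obj j').obj)
      (h : H.obj (S.obj i)) (h' : H.obj (S.obj i')) (g : G.obj (S.obj j)) (g' : G.obj (S.obj j')),
      ⟪tmul (S.obj k) (S.obj i) (S.obj j) f h g,
        tmul (S.obj k) (S.obj i') (S.obj j') f' h' g'⟫_ℂ = 0
  dense_tmul : ∀ (H G : HilbInd A) (k : S.ι),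
    Dense (Submodule.span ℂ {v : (H ⊗ G).obj (S.obj k) | ∃ (i j : S.ι)
      (f : (S.obj k).obj ⟶ (S.obj i).obj ⊗ (S.obj j).obj) (h : H.obj (S.obj i))
      (g : G.obj (S.obj j)), v = tmul (S.obj k) (S.obj i) (S.obj j) f h g} :
      Set ((H ⊗ G).obj (S.obj k)))
  tensorHom_tmul : ∀ {H G H' G' : HilbInd A} (η : H ⟶ H') (θ : G ⟶ G') (X Y Z : BimFgp A)
    (f : X.obj ⟶ Y.obj ⊗ Z.obj) (h : H.obj Y) (g : G.obj Z),
    HilbInd.app (η ⊗ₘ θ) X (tmul X Y Z f h g) =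
      tmul X Y Z f (HilbInd.app η Y h) (HilbInd.app θ Z g)
  unit : ∀ X : BimFgp A, (X.obj ⟶ 𝟙_ (Corr A)) ≃ₗ[ℂ] (𝟙_ (HilbInd A)).obj X
  map_unit : ∀ (W X : BimFgp A) (u : W.obj ⟶ X.obj) (f : X.obj ⟶ 𝟙_ (Corr A)),
    (𝟙_ (HilbInd A)).map W X u (unit X f) = unit W (u ≫ f)
  inner_unit : ∀ (X : BimFgp A) (f f' : X.obj ⟶ 𝟙_ (Corr A)) (c : ℂ),
    Corr.adj f ≫ f' = c • 𝟙 (𝟙_ (Corr A)) → ⟪unit X f, unit X f'⟫_ℂ = c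
  leftUnitor_tmul : ∀ {H : HilbInd A} (X Y Z : BimFgp A) (f : X.obj ⟶ Y.obj ⊗ Z.obj)
    (e : Y.obj ⟶ 𝟙_ (Corr A)) (h : H.obj Z),
    HilbInd.app (λ_ H).hom X (tmul X Y Z f (unit Y e) h) =
      H.map X Z (f ≫ e ▷ Z.obj ≫ (λ_ Z.obj).hom) h
  rightUnitor_tmul : ∀ {H : HilbInd A} (X Y Z : BimFgp A) (f : X.obj ⟶ Y.obj ⊗ Z.obj)
    (h : H.obj Y) (e : Z.obj ⟶ 𝟙_ (Corr A)),
    HilbInd.app (ρ_ H).hom X (tmul X Y Z f h (unit Z e)) =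
      H.map X Y (f ≫ Y.obj ◁ e ≫ (ρ_ Y.obj).hom) h
  associator_tmul : ∀ {H G F : HilbInd A} (X Y Z P Q W : BimFgp A)
    (f : X.obj ⟶ Y.obj ⊗ Z.obj) (e : Y.obj ⟶ P.obj ⊗ Q.obj)
    (f' : X.obj ⟶ P.obj ⊗ W.obj) (e' : W.obj ⟶ Q.obj ⊗ Z.obj),
    f ≫ e ▷ Z.obj ≫ (α_ P.obj Q.obj Z.obj).hom = f' ≫ P.obj ◁ e' →
    ∀ (h : H.obj P) (g : G.obj Q) (x : F.obj Z),
      HilbInd.app (α_ H G F).hom X (tmul X Y Z f (tmul Y P Q e h g) x) =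
        tmul X P W f' h (tmul W Q Z e' g x)

end Tensor

end CStarCorr

end

noncomputable section

namespace CStarCorr

namespace Corr

variable {A : Type u} [CStarAlgebra A] [PartialOrder A] [StarOrderedRing A]

/-! ### Adjoints -/

/-! The engine is semisimplicity of `Bim_fgp(A)`. Finitely generated Hilbert modules have finite
Parseval frames (`Corr.exists_frame`). If `v` is a frame for a left inner product on `X`, the form
`∑ ⟨S vⱼ, T vⱼ⟩` on `End(X)` takes values in the centre (`traceForm_central`), so it is scalar
because the centre is trivial. It is a faithful inner product. A frame estimate bounds the number of
orthonormal self-adjoint endomorphisms (`card_le_of_orthonormal`), so `End(X)` is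
finite-dimensional. A reducible `X` then has a nontrivial projection (`exists_projection`), and
induction on `dim End(X)` decomposes every object into irreducibles (`nonempty_decomp`). The
irreducible classes form a set, since a module with a finite frame is determined by matrices over
`A` (`HasCode.nonempty_iso`).

Weighting each irreducible `K` by `d_K` gives a trace on endomorphisms that is cyclic by Schur's
lemma (`Decomp.trace_comm`), and with it every `Hom(X, E)` becomes a Hilbert space. Hence each
correspondence `E` defines a Hilbert space object `Γ E = Hom(-, E)` (`Gamma`). Two facts connect `Γ`
with the realization:

(a) `H ≅ Γ|H|`. A vector `h ∈ H(K)` gives the slice `k ↦ d_K^(-1/2) k ⊗ h`. Decomposing `X` extends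
this to `hat : H(X) → Hom(X, |H|)`, which is natural in both variables (`comp_hat`, `hat_realMap`)
and unitary (`trace_hat`, `hatL_surjective`). A morphism `|H| ⟶ |G|` therefore acts on `H` by
postcomposition, which is full faithfulness (`preimage`).

(b) `|Γ E| ≅ E` unitarily whenever the images of morphisms out of irreducibles span a dense subspace
of `E` (`counit`). This applies to `A` and to `|H| ⊗ |G|`, because `Bim_fgp(A)` contains `A` and is
closed under `⊗_A` (`generated_unit`, `generated_tensor`).

For existence of the tensor structure, the one of correspondences is transported along the
realization: `H ⊠ G = Γ(|H| ⊗ |G|)`, with `f ⊗ h ⊗ g` the composite of `f` with `hat h ⊗ hat g`. The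
factors `d^(-1/2)` in the slices produce the prescribed scaling `(d_Y d_Z)⁻¹` (`inner_etmul`). The
unit is normalized correctly because an irreducible object isomorphic to `A` has dimension one
(`dim_eq_one`). Apart from this value, only positivity of the dimensions matters.

Given an arbitrary tensor structure `T`, the tensorator sends `(slice h ⊗ slice g)(k ⊗ l)` to the
value at `k ⊗ l` of the morphism that corresponds under `hat` to `𝟙 ⊗ h ⊗ g` (`IndTensor.pair`).
Both families have the same inner products, as the axioms on `T` fix them
(`IndTensor.pair_comp_adj`), and both are total (`total_slice_tmul`, `IndTensor.total_pair`), so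
this is a unitary. Naturality and coherence are checked on slices, where they become the axioms for
the structure morphisms of `T`. -/

@[simp] lemma zero_apply {K L : Corr A} (x : K) : (0 : K ⟶ L) x = 0 := rfl

/-- Evaluation of morphisms at a vector, as a linear map. -/
def evalL {K : Corr A} (L : Corr A) (x : K) : (K ⟶ L) →ₗ[ℂ] L where
  toFun f := f x
  map_add' _ _ := rfl
  map_smul' _ _ := rfl

@[simp] lemma sum_apply {K L : Corr A} {ι : Type*} (s : Finset ι) (f : ι → (K ⟶ L)) (x : K) :
    (∑ i ∈ s, f i) x = ∑ i ∈ s, f i x := map_sum (evalL L x) f s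

lemma adj_eq {K L : Corr A} {f : K ⟶ L} {g : L ⟶ K} (h : ∀ x y, L.ip (f x) y = K.ip x (g y)) :
    adj f = g := hom_ext fun y => K.ip_ext fun x => by rw [← ip_adj, h]

@[simp] lemma adj_adj {K L : Corr A} (f : K ⟶ L) : adj (adj f) = f := adj_eq fun x y => adj_ip f y x

@[simp] lemma adj_id (K : Corr A) : adj (𝟙 K) = 𝟙 K := adj_eq fun _ _ => rfl

@[simp] lemma adj_comp {K L M : Corr A} (f : K ⟶ L) (g : L ⟶ M) :
    adj (f ≫ g) = adj g ≫ adj f := adj_eq fun x y => by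
  rw [comp_apply, ip_adj, ip_adj, comp_apply]

@[simp] lemma adj_add {K L : Corr A} (f g : K ⟶ L) : adj (f + g) = adj f + adj g :=
  adj_eq fun x y => by
    rw [add_apply, L.isSemiInner.add_left, ip_adj, ip_adj, add_apply, K.ip_add_right]

@[simp] lemma adj_smul {K L : Corr A} (c : ℂ) (f : K ⟶ L) : adj (c • f) = star c • adj f :=
  adj_eq fun x y => by
    rw [smul_apply, L.isSemiInner.smul_left, ip_adj, smul_apply, K.isSemiInner.smul_right]

@[simp] lemma adj_zero (K L : Corr A) : adj (0 : K ⟶ L) = 0 := by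
  have := adj_smul (0 : ℂ) (0 : K ⟶ L)
  rwa [zero_smul, star_zero, zero_smul] at this

lemma ip_map_map {K K' L : Corr A} (f : K ⟶ L) (g : K' ⟶ L) (x : K) (y : K') :
    L.ip (f x) (g y) = K.ip x ((g ≫ adj f) y) := ip_adj f x (g y)

lemma norm_apply_le {K L : Corr A} (f : K ⟶ L) (x : K) : ‖f x‖ ≤ ‖op' f‖ * ‖x‖ :=
  (op' f).le_opNorm x

lemma eq_zero_of_adj {K L : Corr A} {f : K ⟶ L} (h : adj f = 0) : f = 0 := by
  rw [← adj_adj f, h, adj_zero]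

/-! ### Unitaries -/

/-- An isometry satisfies `f* f = 1`, so `f f*` fixes every vector in its image. If the image
contains a total family, `f f* = 1` by continuity. -/
lemma isUnitary_of_total {K L : Corr A} {X : Type u} {g : X → L} (hg : Total g) {f : K ⟶ L}
    (hf : ∀ x y, L.ip (f x) (f y) = K.ip x y) (h : ∀ z, ∃ x, f x = g z) : IsUnitary f := by
  have h1 : f ≫ adj f = 𝟙 K := hom_ext fun x => K.ip_ext fun y => by
    rw [← ip_map_map, hf, id_apply]
  refine ⟨h1, hom_ext_of_total hg fun z => ?_⟩
  obtain ⟨x, hx⟩ := h z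
  rw [← hx, comp_apply, ← comp_apply f (adj f), h1, id_apply, id_apply]

/-- The isomorphism given by a unitary. -/
def IsUnitary.iso {K L : Corr A} {f : K ⟶ L} (hf : IsUnitary f) : K ≅ L := ⟨f, adj f, hf.1, hf.2⟩

lemma IsUnitary.ip {K L : Corr A} {f : K ⟶ L} (hf : IsUnitary f) (x y : K) :
    L.ip (f x) (f y) = K.ip x y := by rw [ip_map_map, hf.1, id_apply]

/-- Equality of inner products on a total family makes the adjoint a one-sided inverse. The morphism
is already invertible, so the adjoint is the inverse. -/
lemma genIso_isUnitary {X : Type u} {E F : Corr A} {g : X → E} {g' : X → F} (hg : Total g)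
    (hg' : Total g') (h : ∀ x y, F.ip (g' x) (g' y) = E.ip (g x) (g y))
    (hl : ∀ (a : A) x, ∃ y, a • g x = g y ∧ a • g' x = g' y) :
    IsUnitary (genIso hg hg' h hl).hom := by
  have h1 : (genIso hg hg' h hl).hom ≫ adj (genIso hg hg' h hl).hom = 𝟙 E :=
    hom_ext_of_total hg fun x => ip_ext_of_total hg fun y => by
      rw [comp_apply, adj_ip, genIso_hom_apply, genIso_hom_apply, h, id_apply]
  refine ⟨h1, ?_⟩
  have h2 : adj (genIso hg hg' h hl).hom = (genIso hg hg' h hl).inv := by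
    rw [← cancel_epi (genIso hg hg' h hl).hom, h1, Iso.hom_inv_id]
  rw [h2, Iso.inv_hom_id]

/-! ### Bilinearity of elementary tensors -/

section

variable {K L : Corr A}

lemma tmul_add (x : K) (y y' : L) : tmul x (y + y') = tmul x y + tmul x y' :=
  map_add (tmulL K L x) y y'
lemma add_tmul (x x' : K) (y : L) : tmul (x + x') y = tmul x y + tmul x' y :=
  (tmulL K L).map_add₂ x x' y
lemma tmul_smul (c : ℂ) (x : K) (y : L) : tmul x (c • y) = c • tmul x y :=
  map_smul (tmulL K L x) c y
lemma smul_tmul (c : ℂ) (x : K) (y : L) : tmul (c • x) y = c • tmul x y :=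
  (tmulL K L).map_smul₂ c x y
lemma tmul_sum {ι : Type*} (s : Finset ι) (x : K) (y : ι → L) :
    tmul x (∑ i ∈ s, y i) = ∑ i ∈ s, tmul x (y i) := map_sum (tmulL K L x) y s
lemma sum_tmul {ι : Type*} (s : Finset ι) (x : ι → K) (y : L) :
    tmul (∑ i ∈ s, x i) y = ∑ i ∈ s, tmul (x i) y := by
  change tmulL K L (∑ i ∈ s, x i) y = _
  rw [map_sum, _root_.sum_apply]; rfl

lemma tensorHom_tmul {K' L' : Corr A} (f : K ⟶ K') (g : L ⟶ L') (x : K) (y : L) :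
    (f ⊗ₘ g : K ⊗ L ⟶ K' ⊗ L') (tmul x y) = tmul (f x) (g y) := tensorMap_tmul f g x y

lemma tensor_hom_ext {E : Corr A} {f g : K ⊗ L ⟶ E} (h : ∀ x y, f (tmul x y) = g (tmul x y)) :
    f = g := hom_ext_of_total (total_tmul' K L) fun p => h p.1 p.2

lemma whiskerLeft_tmul {L' : Corr A} (g : L ⟶ L') (x : K) (y : L) :
    (K ◁ g) (tmul x y) = tmul x (g y) := tensorMap_tmul _ _ _ _

lemma whiskerRight_tmul {K' : Corr A} (f : K ⟶ K') (x : K) (y : L) :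
    (f ▷ L) (tmul x y) = tmul (f x) y := tensorMap_tmul _ _ _ _

lemma associator_tmul {M : Corr A} (x : K) (y : L) (z : M) :
    (α_ K L M).hom (tmul (tmul x y) z) = tmul x (tmul y z) := assoc_tmul x y z

lemma associator_inv_tmul {M : Corr A} (x : K) (y : L) (z : M) :
    (α_ K L M).inv (tmul x (tmul y z)) = tmul (tmul x y) z := by
  rw [← associator_tmul, ← comp_apply (α_ K L M).hom, Iso.hom_inv_id, id_apply]

/-- The vector `a` of the tensor unit. -/
def toUnit (a : A) : (𝟙_ (Corr A) : Corr A) := a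

lemma toUnit_eq (a : A) : toUnit a = a • toUnit (1 : A) := (mul_one a).symm

lemma unit_hom_ext {E : Corr A} {f g : 𝟙_ (Corr A) ⟶ E} (h : f (toUnit 1) = g (toUnit 1)) :
    f = g := hom_ext fun a => by
  have e : a = (show A from a) • toUnit (1 : A) := toUnit_eq (show A from a)
  rw [e, map_lsmul, map_lsmul, h]

lemma leftUnitor_tmul (a : A) (x : K) : (λ_ K).hom (tmul (toUnit a) x) = a • x := lunit_tmul a x

lemma rightUnitor_tmul (a : A) (x : K) : (ρ_ K).hom (tmul x (toUnit a)) = op a • x :=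
  runit_tmul x a

lemma rightUnitor_inv_apply (x : K) : (ρ_ K).inv x = tmul x (toUnit 1) := by
  have h : (ρ_ K).hom (tmul x (toUnit 1)) = x := by rw [rightUnitor_tmul, op_one, one_smul]
  nth_rewrite 1 [← h]
  rw [← comp_apply, Iso.hom_inv_id, id_apply]

lemma adj_tensorHom {K' L' : Corr A} (f : K ⟶ K') (g : L ⟶ L') :
    adj (f ⊗ₘ g : K ⊗ L ⟶ K' ⊗ L') = (adj f ⊗ₘ adj g) := by
  refine tensor_hom_ext fun x y => ip_ext_of_total (total_tmul' K L) fun p => ?_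
  rw [adj_ip, tensorHom_tmul, tensorHom_tmul]
  refine (ip_tmul _ _ _ _).trans ((ip_tmul _ _ _ _).trans ?_).symm
  rw [adj_ip, adj_ip, map_lsmul]

end

/-! ### Irreducible correspondences -/

/-- Irreducibility makes `f* f` a scalar. It is real by self-adjointness, and positive because
otherwise `⟨f x, f x⟩ ≤ 0` for all `x`. Thus a nonzero morphism out of an irreducible object is a
positive multiple of an isometry. -/
lemma exists_pos_of_irreducible {K L : Corr A} (hK : IsIrreducible K) {f : K ⟶ L} (hf : f ≠ 0) :
    ∃ r : ℝ, 0 < r ∧ f ≫ adj f = (r : ℂ) • 𝟙 K := by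
  obtain ⟨c, hc⟩ := hK.2 (f ≫ adj f)
  have hcs : star c = c := by
    have h := congrArg adj hc
    rw [adj_comp, adj_adj, adj_smul, adj_id, hc] at h
    exact (smul_left_injective ℂ hK.1 h).symm
  have hcr : ((c.re : ℝ) : ℂ) = c := Complex.conj_eq_iff_re.mp hcs
  refine ⟨c.re, ?_, by rw [hcr, hc]⟩
  by_contra hle
  refine hf (hom_ext fun x => ?_)
  have h1 : L.ip (f x) (f x) = c.re • K.ip x x := by
    rw [ip_map_map, hc, smul_apply, id_apply, K.isSemiInner.smul_right, ← hcr, Complex.ofReal_re,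
      Complex.coe_smul]
  have h2 : L.ip (f x) (f x) = 0 := le_antisymm
    (h1 ▸ smul_nonpos_of_nonpos_of_nonneg (not_lt.mp hle) (K.ip_nonneg x)) (L.ip_nonneg _)
  rw [zero_apply, ← norm_eq_zero, ← sq_eq_zero_iff, L.norm_sq, h2, norm_zero]

/-- Schur's lemma. -/
lemma exists_unitary_of_irreducible {K L : Corr A} (hK : IsIrreducible K) (hL : IsIrreducible L)
    {f : K ⟶ L} (hf : f ≠ 0) : ∃ (c : ℂ) (_ : c ≠ 0), IsUnitary (c • f) := by
  obtain ⟨r, hr, h1⟩ := exists_pos_of_irreducible hK hf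
  obtain ⟨s, hs, h2⟩ := exists_pos_of_irreducible hL (f := adj f) (fun h => hf (eq_zero_of_adj h))
  rw [adj_adj] at h2
  -- Computing `f f* f` in two ways identifies the scalars of `f* f` and `f f*`, so a single
  -- rescaling by `r^(-1/2)` makes `f` isometric and coisometric.
  have hrs : (r : ℂ) = s := by
    refine smul_left_injective ℂ hf ?_
    change (r : ℂ) • f = (s : ℂ) • f
    rw [← Category.id_comp f, ← Linear.smul_comp, ← h1, Category.assoc, h2, Linear.comp_smul,
      Category.comp_id, Category.id_comp]
  have hc : (((√r)⁻¹ : ℝ) : ℂ) * (((√r)⁻¹ : ℝ) : ℂ) * r = 1 := by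
    rw [← Complex.ofReal_mul, ← Complex.ofReal_mul, ← Complex.ofReal_one]
    congr 1
    rw [← mul_inv, Real.mul_self_sqrt hr.le, inv_mul_cancel₀ hr.ne']
  refine ⟨((√r)⁻¹ : ℝ), by exact_mod_cast inv_ne_zero (Real.sqrt_ne_zero'.mpr hr), ?_, ?_⟩
  · rw [adj_smul, Linear.smul_comp, Linear.comp_smul, h1, smul_smul, smul_smul, Complex.star_def,
      Complex.conj_ofReal, hc, one_smul]
  · rw [adj_smul, Linear.smul_comp, Linear.comp_smul, h2, smul_smul, smul_smul, Complex.star_def,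
      Complex.conj_ofReal, ← hrs, hc, one_smul]

lemma exists_ne_zero_of_irreducible {K : Corr A} (hK : IsIrreducible K) : ∃ x : K, x ≠ 0 := by
  by_contra! h
  exact hK.1 (hom_ext fun x => (h x).trans rfl)

end Corr

end CStarCorr

namespace CStarCorr

/-- A bounded operator for which all `S + t`, `t ≥ 0`, are bounded below uniformly is invertible. -/
lemma isUnit_of_bounded_below {E : Type*} [NormedAddCommGroup E] [NormedSpace ℂ E]
    [CompleteSpace E] (S : E →L[ℂ] E) {c : ℝ} (hc : 0 < c)
    (h : ∀ t : ℝ, 0 ≤ t → ∀ x, c * ‖x‖ ≤ ‖S x + (t : ℂ) • x‖) : IsUnit S := by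
  rcases subsingleton_or_nontrivial E with hE | hE
  · exact ⟨1, Subsingleton.elim _ _⟩
  set P : ℝ → E →L[ℂ] E := fun t => S + (t : ℂ) • 1 with hP
  have hPa : ∀ t x, P t x = S x + (t : ℂ) • x := fun t x => rfl
  -- The uniform lower bound gives `‖(S + t)⁻¹‖ ≤ 1/c` whenever the inverse exists, so invertibility
  -- propagates over any distance less than `c`, independently of `t`.
  have step : ∀ s t : ℝ, 0 ≤ t → |s - t| < c → IsUnit (P t) → IsUnit (P s) := by
    rintro s t ht hst ⟨U, hU⟩
    refine (U.ofNearby (P s) ?_).isUnit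
    have h1 : ‖(↑U⁻¹ : E →L[ℂ] E)‖ ≤ c⁻¹ := by
      refine ContinuousLinearMap.opNorm_le_bound _ (inv_nonneg.mpr hc.le) fun x => ?_
      have h2 := h t ht ((↑U⁻¹ : E →L[ℂ] E) x)
      rw [← hPa, ← hU, ← mul_apply_eq_comp, Units.mul_inv,
        one_apply_eq_self] at h2
      rwa [inv_mul_eq_div, le_div_iff₀ hc, mul_comm]
    have h3 : c ≤ ‖(↑U⁻¹ : E →L[ℂ] E)‖⁻¹ := by
      rw [← inv_inv c]
      exact inv_anti₀ (Units.norm_pos U⁻¹) h1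
    refine lt_of_lt_of_le ?_ h3
    have h4 : P s - U = ((s - t : ℝ) : ℂ) • (1 : E →L[ℂ] E) := by
      rw [hU, Complex.ofReal_sub, sub_smul]
      exact add_sub_add_left_eq_sub _ _ _
    rw [h4, norm_smul, norm_one, mul_one, Complex.norm_real]
    exact hst
  -- Start at `t = N c/2 > ‖S‖`, where `-t` lies in the resolvent set, and descend to `t = 0` in `N`
  -- steps of length `c/2 < c`.
  obtain ⟨N, hN⟩ := exists_nat_gt (‖S‖ / (c / 2))
  have hN' : ‖S‖ < N * (c / 2) := by rwa [div_lt_iff₀ (by positivity)] at hN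
  have hstart : IsUnit (P (N * (c / 2))) := by
    have h1 : -((N * (c / 2) : ℝ) : ℂ) ∈ resolventSet ℂ S := by
      refine spectrum.mem_resolventSet_of_norm_lt ?_
      rw [norm_neg, Complex.norm_real]
      exact hN'.trans_le (le_abs_self _)
    have h2 := (spectrum.mem_resolventSet_iff.mp h1).neg
    have h3 : -(algebraMap ℂ (E →L[ℂ] E) (-((N * (c / 2) : ℝ) : ℂ)) - S) = P (N * (c / 2)) := by
      rw [Algebra.algebraMap_eq_smul_one, neg_sub, neg_smul, sub_neg_eq_add]
    rwa [h3] at h2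
  have hall : IsUnit (P ((0 : ℕ) * (c / 2))) := by
    refine Nat.decreasingInduction (motive := fun k _ => IsUnit (P (k * (c / 2))))
      (fun k _ hk => ?_) hstart (Nat.zero_le N)
    refine step _ _ (by positivity) ?_ hk
    push_cast
    rw [show (k : ℝ) * (c / 2) - (k + 1) * (c / 2) = -(c / 2) by ring, abs_neg,
      abs_of_pos (by positivity)]
    linarith
  have h0 : P ((0 : ℕ) * (c / 2)) = S := by simp [hP]
  rwa [h0] at hall

namespace Corr

variable {A : Type u} [CStarAlgebra A] [PartialOrder A] [StarOrderedRing A]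

/-! ### Finite frames -/

lemma norm_rsmul_le (K : Corr A) (a : A) (x : K) : ‖op a • x‖ ≤ ‖x‖ * ‖a‖ := by
  refine le_of_sq_le_sq ?_ (by positivity)
  rw [K.norm_sq, K.ip_smul_right, K.ip_rsmul_left, mul_pow, K.norm_sq]
  calc _ ≤ ‖star a‖ * ‖K.ip x x‖ * ‖a‖ := (norm_mul_le _ _).trans (by gcongr; exact norm_mul_le _ _)
    _ = _ := by rw [norm_star]; ring

lemma csmul_eq_lsmul (K : Corr A) (c : ℂ) (x : K) : c • x = algebraMap ℂ A c • x := by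
  rw [algebraMap_smul]

instance (K : Corr A) : SMulCommClass Aᵐᵒᵖ ℂ K := ⟨fun a c x => by
  rw [csmul_eq_lsmul, csmul_eq_lsmul]
  exact (smul_comm _ a x).symm⟩

/-- The right multiplication `a ↦ x a` as a continuous linear map. -/
def rsmulL (K : Corr A) (x : K) : A →L[ℂ] K :=
  LinearMap.mkContinuous
    { toFun := fun a => op a • x
      map_add' := fun a b => by rw [MulOpposite.op_add, add_smul]
      map_smul' := fun c a => by rw [op_smul, smul_assoc, RingHom.id_apply] } ‖x‖
    (fun a => K.norm_rsmul_le a x)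

@[simp] lemma rsmulL_apply (K : Corr A) (a : A) (x : K) : K.rsmulL x a = op a • x := rfl

/-- The right action of `a` as a continuous linear map. -/
def rsmulActL (K : Corr A) (a : A) : K →L[ℂ] K :=
  LinearMap.mkContinuous
    { toFun := fun x => op a • x
      map_add' := smul_add (op a)
      map_smul' := fun c x => by rw [RingHom.id_apply, smul_comm] } ‖a‖
    (fun x => (K.norm_rsmul_le a x).trans_eq (mul_comm _ _))

@[simp] lemma rsmulActL_apply (K : Corr A) (a : A) (x : K) : K.rsmulActL a x = op a • x := rfl

/-- The operator `x ↦ u ⟨w, x⟩`. -/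
def rankOne {K L : Corr A} (u : L) (w : K) : K →L[ℂ] L := (L.rsmulL u).comp (K.ipL w)

@[simp] lemma rankOne_apply {K L : Corr A} (u : L) (w x : K) :
    rankOne u w x = op (K.ip w x) • u := rfl

/-- A (Parseval) frame: `∑ eᵢ ⟨eᵢ, x⟩ = x`. -/
def IsFrame (K : Corr A) {n : ℕ} (e : Fin n → K) : Prop :=
  ∀ x, ∑ i, op (K.ip (e i) x) • e i = x

/-- From `x = ∑ uᵢ⟨gᵢ, x⟩` one gets `x = ∑ gᵢ⟨uᵢ, x⟩` by taking adjoints. Factor the Gram matrix of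
`u` as `C* C` and set `e_z = ∑ gᵢ C_{zi}*`. Then `∑ e_z⟨e_z, x⟩ = ∑ gᵢ⟨uᵢ, u_m⟩⟨g_m, x⟩ = ∑ gᵢ⟨uᵢ,
x⟩ = x`. The matrix factorization takes the place of a square root of the frame operator. -/
lemma frame_of_dual (K : Corr A) {n : ℕ} (g u : Fin n → K)
    (h : ∀ x, ∑ i, op (K.ip (g i) x) • u i = x) : ∃ e : Fin n → K, K.IsFrame e := by
  obtain ⟨C, hC⟩ := K.gram_factor u
  have h' : ∀ x, ∑ i, op (K.ip (u i) x) • g i = x := fun x => K.ip_ext fun y => by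
    conv_rhs => rw [← h y]
    rw [ip_sum_right, ip_sum_left]
    refine Finset.sum_congr rfl fun i _ => ?_
    rw [ip_smul_right, ip_rsmul_left, K.star_ip]
  refine ⟨fun z => ∑ i, op (star (C z i)) • g i, fun x => ?_⟩
  have h1 : ∀ z, K.ip (∑ i, op (star (C z i)) • g i) x = ∑ m, C z m * K.ip (g m) x := fun z => by
    rw [ip_sum_left]
    exact Finset.sum_congr rfl fun i _ => by rw [ip_rsmul_left, star_star]
  calc _ = ∑ z, ∑ i, op (star (C z i) * ∑ m, C z m * K.ip (g m) x) • g i := by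
        refine Finset.sum_congr rfl fun z _ => ?_
        rw [h1, Finset.smul_sum]
        refine Finset.sum_congr rfl fun i _ => ?_
        rw [smul_smul, op_mul]
    _ = ∑ i, op (K.ip (u i) x) • g i := by
        rw [Finset.sum_comm]
        refine Finset.sum_congr rfl fun i _ => ?_
        rw [← Finset.sum_smul, ← Finset.op_sum]
        congr 2
        conv_rhs => rw [← h x]
        rw [ip_sum_right]
        simp only [Finset.mul_sum, ip_smul_right, hC, Finset.sum_mul]
        rw [Finset.sum_comm]
        simp only [mul_assoc]
    _ = x := h' x

/-- A finitely generated right Hilbert module has a finite frame. -/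
lemma exists_frame (K : Corr A) {n : ℕ} (g : Fin n → K)
    (hg : ∀ x : K, ∃ a : Fin n → A, ∑ i, op (a i) • g i = x) : ∃ e : Fin n → K, K.IsFrame e := by
  let T : (Fin n → A) →L[ℂ] K := ∑ i, (K.rsmulL (g i)).comp (ContinuousLinearMap.proj i)
  have hT : ∀ a, T a = ∑ i, op (a i) • g i := fun a => by
    simp [T, _root_.sum_apply]
  -- The open mapping theorem bounds suitable coefficients of `x` by `C ‖x‖`.
  obtain ⟨C, hC0, hC⟩ := T.exists_preimage_norm_le fun x => by
    obtain ⟨a, ha⟩ := hg x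
    exact ⟨a, by rw [hT, ha]⟩
  let S : K →L[ℂ] K := ∑ i, rankOne (g i) (g i)
  have hS : ∀ x, S x = ∑ i, op (K.ip (g i) x) • g i := fun x => by
    simp [S, _root_.sum_apply]
  have hSx : ∀ x, K.ip x (S x) = ∑ i, star (K.ip (g i) x) * K.ip (g i) x := fun x => by
    rw [hS, ip_sum_right]
    exact Finset.sum_congr rfl fun i _ => by rw [ip_smul_right, K.star_ip]
  have hSpos : ∀ x, 0 ≤ K.ip x (S x) := fun x => by
    rw [hSx]; exact Finset.sum_nonneg fun i _ => star_mul_self_nonneg _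
  -- Write `x = ∑ gᵢ aᵢ` with `‖a‖ ≤ C ‖x‖`. Each `‖⟨x, gᵢ⟩‖²` is at most `‖⟨x, S x⟩‖`, so `‖x‖² ≤ n
  -- C ‖x‖ ‖⟨x, S x⟩‖^(1/2)`. The added `1` keeps the constant positive when `n` or `C` vanishes.
  have hlow : ∀ x, ‖x‖ ^ 2 ≤ (C ^ 2 * n ^ 2 + 1) * ‖K.ip x (S x)‖ := by
    intro x
    obtain ⟨a, ha, hna⟩ := hC x
    have h1 : ∀ i, ‖K.ip x (g i)‖ ≤ √‖K.ip x (S x)‖ := fun i => by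
      refine Real.le_sqrt_of_sq_le ?_
      rw [← K.star_ip, norm_star, pow_two, ← CStarRing.norm_star_mul_self]
      refine CStarAlgebra.norm_le_norm_of_nonneg_of_le (star_mul_self_nonneg _) ?_
      rw [hSx]
      exact Finset.single_le_sum (f := fun i => star (K.ip (g i) x) * K.ip (g i) x)
        (fun i _ => star_mul_self_nonneg _) (Finset.mem_univ i)
    have h2 : ‖x‖ ^ 2 ≤ n * (√‖K.ip x (S x)‖ * (C * ‖x‖)) := by
      have h3 : K.ip x x = ∑ i, K.ip x (g i) * a i := by
        have h4 : K.ip x x = K.ip x (T a) := by rw [ha]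
        rw [h4, hT, ip_sum_right]
        exact Finset.sum_congr rfl fun i _ => K.ip_smul_right _ _ _
      rw [K.norm_sq, h3]
      refine (norm_sum_le _ _).trans ?_
      calc _ ≤ ∑ _i : Fin n, √‖K.ip x (S x)‖ * (C * ‖x‖) := by
            refine Finset.sum_le_sum fun i _ => (norm_mul_le _ _).trans ?_
            gcongr
            · exact h1 i
            · exact (norm_le_pi_norm a i).trans hna
        _ = _ := by simp
    have h4 := Real.sq_sqrt (norm_nonneg (K.ip x (S x)))
    rcases (norm_nonneg x).eq_or_lt with h0 | h0
    · rw [← h0, zero_pow two_ne_zero]; positivity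
    have h5 : ‖x‖ ≤ n * (√‖K.ip x (S x)‖ * C) := by
      refine le_of_mul_le_mul_right ?_ h0
      nlinarith
    calc ‖x‖ ^ 2 ≤ (n * (√‖K.ip x (S x)‖ * C)) ^ 2 := by gcongr
      _ = (C ^ 2 * n ^ 2) * ‖K.ip x (S x)‖ := by rw [mul_pow, mul_pow, h4]; ring
      _ ≤ _ := by gcongr; linarith
  -- Since `⟨x, (S + t) x⟩ ≥ ⟨x, S x⟩ ≥ 0` for `t ≥ 0`, Cauchy-Schwarz turns `hlow` into a lower
  -- bound for `S + t` that is uniform in `t`.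
  have hunit : IsUnit S := by
    refine isUnit_of_bounded_below S (c := (C ^ 2 * n ^ 2 + 1)⁻¹) (by positivity) fun t ht x => ?_
    have h1 : ‖K.ip x (S x)‖ ≤ ‖K.ip x (S x + (t : ℂ) • x)‖ := by
      refine CStarAlgebra.norm_le_norm_of_nonneg_of_le (hSpos x) ?_
      rw [K.ip_add_right, K.isSemiInner.smul_right, Complex.coe_smul]
      exact le_add_of_nonneg_right (smul_nonneg ht (K.ip_nonneg x))
    have h2 := hlow x
    have h3 := h1.trans (K.norm_ip_le _ _)
    rw [inv_mul_le_iff₀ (by positivity)]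
    rcases (norm_nonneg x).eq_or_lt with h0 | h0
    · rw [← h0]; exact mul_nonneg (by positivity) (norm_nonneg _)
    refine le_of_mul_le_mul_right ?_ h0
    have : (0 : ℝ) < C ^ 2 * n ^ 2 + 1 := by positivity
    nlinarith
  obtain ⟨U, hU⟩ := hunit
  have hinv : ∀ x, (↑U⁻¹ : K →L[ℂ] K) (S x) = x := fun x => by
    rw [← hU, ← mul_apply_eq_comp, Units.inv_mul]; rfl
  have hinv' : ∀ x, S ((↑U⁻¹ : K →L[ℂ] K) x) = x := fun x => by
    rw [← hU, ← mul_apply_eq_comp, Units.mul_inv]; rfl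
  have hSr : ∀ (a : A) x, S (op a • x) = op a • S x := fun a x => by
    rw [hS, hS, Finset.smul_sum]
    exact Finset.sum_congr rfl fun i _ => by rw [ip_smul_right, smul_smul, op_mul]
  have hr : ∀ (a : A) x, (↑U⁻¹ : K →L[ℂ] K) (op a • x) = op a • (↑U⁻¹ : K →L[ℂ] K) x :=
    fun a x => by
      nth_rewrite 1 [← hinv' x]
      rw [← hSr, hinv]
  -- The expansion `x = S⁻¹ S x = ∑ (S⁻¹ gᵢ)⟨gᵢ, x⟩` exhibits the canonical dual frame of `g`.
  refine K.frame_of_dual g (fun i => (↑U⁻¹ : K →L[ℂ] K) (g i)) fun x => ?_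
  conv_rhs => rw [← hinv x, hS, map_sum]
  exact Finset.sum_congr rfl fun i _ => (hr _ _).symm

lemma exists_frame_of_finite (K : Corr A) (h : Module.Finite Aᵐᵒᵖ K) :
    ∃ (n : ℕ) (e : Fin n → K), K.IsFrame e := by
  obtain ⟨n, g, hg⟩ := Module.Finite.exists_fin (R := Aᵐᵒᵖ) (M := K)
  refine ⟨n, K.exists_frame g fun x => ?_⟩
  obtain ⟨c, hc⟩ := (Submodule.mem_span_range_iff_exists_fun Aᵐᵒᵖ).mp
    (hg ▸ Submodule.mem_top : x ∈ Submodule.span Aᵐᵒᵖ (Set.range g))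
  exact ⟨fun i => (c i).unop, hc⟩

end Corr

/-- The dual basis lemma: the coordinates split the surjection `Rⁿ → M`. -/
lemma finite_projective_of_dualBasis {R M : Type*} [Ring R] [AddCommGroup M] [Module R M] {n : ℕ}
    (e : Fin n → M) (φ : Fin n → M →ₗ[R] R) (h : ∀ x, ∑ i, φ i x • e i = x) :
    Module.Finite R M ∧ Module.Projective R M := by
  have hs : (Fintype.linearCombination R e) ∘ₗ (LinearMap.pi φ) = LinearMap.id :=
    LinearMap.ext fun x => by
      rw [LinearMap.comp_apply, Fintype.linearCombination_apply]
      exact h x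
  refine ⟨Module.Finite.of_surjective (Fintype.linearCombination R e) fun x =>
    ⟨LinearMap.pi φ x, congrArg (fun f => f x) hs⟩, Module.Projective.of_split _ _ hs⟩

namespace Corr

variable {A : Type u} [CStarAlgebra A] [PartialOrder A] [StarOrderedRing A]

lemma IsFrame.finite_projective {K : Corr A} {n : ℕ} {e : Fin n → K} (he : K.IsFrame e) :
    Module.Finite Aᵐᵒᵖ K ∧ Module.Projective Aᵐᵒᵖ K :=
  finite_projective_of_dualBasis e (fun i =>
    { toFun := fun x => op (K.ip (e i) x)
      map_add' := fun x y => by rw [K.ip_add_right, MulOpposite.op_add]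
      map_smul' := fun a x => by
        rw [← op_unop a, K.ip_smul_right, op_mul]; rfl }) he

lemma IsFrame.map {K L : Corr A} {n : ℕ} {e : Fin n → K} (he : K.IsFrame e) {V : L ⟶ K}
    (hV : V ≫ adj V = 𝟙 L) : L.IsFrame fun i => adj V (e i) := fun x => by
  have h : x = adj V (V x) := by rw [← comp_apply V (adj V), hV, id_apply]
  conv_rhs => rw [h, ← he (V x), map_sum]
  exact Finset.sum_congr rfl fun i _ => by rw [adj_ip, map_rsmul]

lemma IsFrame.tmul {K L : Corr A} {m n : ℕ} {e : Fin m → K} (he : K.IsFrame e) {e' : Fin n → L}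
    (he' : L.IsFrame e') (t : tensor K L) :
    ∑ i, ∑ j, op ((tensor K L).ip (Corr.tmul (e i) (e' j)) t) • Corr.tmul (e i) (e' j) = t := by
  have h := clm_ext_of_total (total_tmul' K L)
    (f := ∑ i, ∑ j, rankOne (K := tensor K L) (Corr.tmul (e i) (e' j)) (Corr.tmul (e i) (e' j)))
    (f' := ContinuousLinearMap.id ℂ _) fun p => by
      simp only [_root_.sum_apply, rankOne_apply, ContinuousLinearMap.id_apply,
        ip_tmul, rsmul_tmul]
      simp only [← tmul_sum, he' _, tmul_lsmul]
      rw [← sum_tmul, he]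
  have := congrArg (fun T : tensor K L →L[ℂ] tensor K L => T t) h
  simpa only [_root_.sum_apply, rankOne_apply, ContinuousLinearMap.id_apply] using this

lemma exists_frame_tensor {K L : Corr A} {m n : ℕ} {e : Fin m → K} (he : K.IsFrame e)
    {e' : Fin n → L} (he' : L.IsFrame e') :
    ∃ (r : ℕ) (f : Fin r → tensor K L), (tensor K L).IsFrame f := by
  refine ⟨_, fun i => Corr.tmul (e (finProdFinEquiv.symm i).1) (e' (finProdFinEquiv.symm i).2),
    fun t => ?_⟩
  rw [finProdFinEquiv.symm.sum_comp fun p : Fin m × Fin n =>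
    op ((tensor K L).ip (Corr.tmul (e p.1) (e' p.2)) t) • Corr.tmul (e p.1) (e' p.2),
    Fintype.sum_prod_type]
  exact he.tmul he' t

/-- A bounded bimodule map out of a module with a finite frame is adjointable. -/
def homOfFrame {K L : Corr A} {n : ℕ} {e : Fin n → K} (he : K.IsFrame e) (T : K →L[ℂ] L)
    (hl : ∀ (a : A) x, T (a • x) = a • T x) (hr : ∀ (a : A) x, T (op a • x) = op a • T x) :
    K ⟶ L :=
  mkHom T (∑ i, rankOne (e i) (T (e i))) (fun x y => by
    conv_lhs => rw [← he x, map_sum, ip_sum_left]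
    rw [_root_.sum_apply, ip_sum_right]
    refine Finset.sum_congr rfl fun i _ => ?_
    rw [hr, ip_rsmul_left, rankOne_apply, ip_smul_right, K.star_ip]) hl

end Corr

end CStarCorr

namespace CStarCorr

variable {A : Type u} [CStarAlgebra A] [PartialOrder A] [StarOrderedRing A]

namespace Corr

lemma antilinear_ext_of_total {X : Type u} {E : Corr A} {V : Type*} [NormedAddCommGroup V]
    [NormedSpace ℂ V] {g : X → E} (hg : Total g) {f f' : E →L⋆[ℂ] V}
    (h : ∀ x, f (g x) = f' (g x)) : f = f' := by
  refine DFunLike.coe_injective (hg.equalizer f.continuous f'.continuous (funext fun v => ?_))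
  simp only [Function.comp_apply, Finsupp.linearCombination_apply, Finsupp.sum, map_sum,
    ContinuousLinearMap.map_smulₛₗ, h]

end Corr

/-! ### Conjugate correspondences -/

/-- A bounded conjugate linear bijection exchanging the left and the right actions. -/
structure AntiIso (K K' : Corr A) where
  map : K →L⋆[ℂ] K'
  inv : K' →L⋆[ℂ] K
  inv_map : ∀ x, inv (map x) = x
  map_inv : ∀ x, map (inv x) = x
  map_lsmul : ∀ (a : A) x, map (a • x) = op (star a) • map x
  map_rsmul : ∀ (a : A) x, map (op a • x) = star a • map x

namespace AntiIso

variable {K K' L L' : Corr A}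

/-- The inverse. -/
def symm (φ : AntiIso K K') : AntiIso K' K where
  map := φ.inv
  inv := φ.map
  inv_map := φ.map_inv
  map_inv := φ.inv_map
  map_lsmul a x := by
    have h := φ.map_rsmul (star a) (φ.inv x)
    rw [star_star, φ.map_inv] at h
    rw [← h, φ.inv_map]
  map_rsmul a x := by
    have h := φ.map_lsmul (star a) (φ.inv x)
    rw [star_star, φ.map_inv] at h
    rw [← h, φ.inv_map]

/-- The left inner product `⟨J x, J y⟩`. -/
def leftInner (φ : AntiIso K K') : LeftInner K where
  lip x y := K'.ip (φ.map x) (φ.map y)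
  lip_add_left x y z := by rw [map_add, K'.isSemiInner.add_left]
  lip_smul_left a x y := by rw [φ.map_lsmul, K'.ip_rsmul_left, star_star]
  star_lip x y := K'.star_ip _ _
  lip_nonneg x := K'.ip_nonneg _
  lip_right a x y := by rw [φ.map_rsmul, φ.map_rsmul, K'.ip_left]
  norm_equiv := by
    have h1 : ∀ x, ‖φ.map x‖ ≤ (‖φ.map‖ + 1) * ‖x‖ := fun x =>
      (φ.map.le_opNorm x).trans (by gcongr; linarith)
    have h2 : ∀ x, ‖x‖ ≤ (‖φ.inv‖ + 1) * ‖φ.map x‖ := fun x => by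
      conv_lhs => rw [← φ.inv_map x]
      exact (φ.inv.le_opNorm _).trans (by gcongr; linarith)
    refine ⟨((‖φ.inv‖ + 1) ^ 2)⁻¹, (‖φ.map‖ + 1) ^ 2, by positivity, by positivity, fun x => ?_⟩
    rw [← K'.norm_sq]
    refine ⟨?_, ?_⟩
    · rw [inv_mul_le_iff₀ (by positivity), ← mul_pow]
      exact pow_le_pow_left₀ (norm_nonneg _) (h2 x) 2
    · rw [← mul_pow]
      exact pow_le_pow_left₀ (norm_nonneg _) (h1 x) 2

/-- The inverse anti-isomorphism turns a right frame expansion in `K'` into a left frame expansion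
in `K` for the left inner product `⟨J x, J y⟩`. -/
lemma left_frame (φ : AntiIso K K') {n : ℕ} {v : Fin n → K'} (hv : K'.IsFrame v) (x : K) :
    ∑ i, K'.ip (φ.map x) (v i) • φ.inv (v i) = x := by
  conv_rhs => rw [← φ.inv_map x, ← hv (φ.map x), map_sum]
  exact Finset.sum_congr rfl fun i _ => by
    rw [← φ.symm.inv_map (v i)]
    change _ = φ.symm.map _
    rw [φ.symm.map_rsmul, K'.star_ip]
    rfl

lemma finite_projective_left (φ : AntiIso K K') {n : ℕ} {v : Fin n → K'} (hv : K'.IsFrame v) :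
    Module.Finite A K ∧ Module.Projective A K :=
  finite_projective_of_dualBasis (fun i => φ.inv (v i)) (fun i =>
    { toFun := fun x => K'.ip (φ.map x) (v i)
      map_add' := fun x y => by rw [map_add, K'.isSemiInner.add_left]
      map_smul' := fun a x => by
        rw [φ.map_lsmul, K'.ip_rsmul_left, star_star]; rfl }) (φ.left_frame hv)

/-- The tensor product of two anti-isomorphisms exchanges the factors. -/
lemma exists_tensor_map (φ : AntiIso K K') (ψ : AntiIso L L') {m n : ℕ} {e : Fin m → K}
    (he : K.IsFrame e) {e' : Fin n → L} (he' : L.IsFrame e') :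
    ∃ J : Corr.tensor K L →L⋆[ℂ] Corr.tensor L' K',
      ∀ x y, J (Corr.tmul x y) = Corr.tmul (ψ.map y) (φ.map x) := by
  -- The flip has to be shown bounded on the completion. The frames write it as a finite sum of
  -- bounded antilinear rank-one maps, and balancing over `A` identifies the sum with the flip on
  -- elementary tensors.
  let R : Fin m → Fin n → (Corr.tensor K L →L⋆[ℂ] Corr.tensor L' K') := fun i j =>
    LinearMap.mkContinuous
      { toFun := fun t => star ((Corr.tensor K L).ip (Corr.tmul (e i) (e' j)) t) •
          Corr.tmul (ψ.map (e' j)) (φ.map (e i))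
        map_add' := fun x y => by rw [(Corr.tensor K L).ip_add_right, star_add, add_smul]
        map_smul' := fun c x => by
          rw [(Corr.tensor K L).isSemiInner.smul_right, star_smul, smul_assoc]; rfl }
      (‖Corr.tmul (e i) (e' j)‖ * ‖Corr.tmul (ψ.map (e' j)) (φ.map (e i))‖) (fun t => by
        refine (Corr.norm_smul_le' _ _ _).trans ?_
        rw [norm_star, mul_right_comm]
        gcongr
        exact Corr.norm_ip_le _ _ _)
  refine ⟨∑ i, ∑ j, R i j, fun x y => ?_⟩
  have hR : ∀ i j t, R i j t = star ((Corr.tensor K L).ip (Corr.tmul (e i) (e' j)) t) •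
          Corr.tmul (ψ.map (e' j)) (φ.map (e i)) := fun _ _ _ => rfl
  have h1 : ∀ i, ∑ j, R i j (Corr.tmul x y) =
      Corr.tmul (ψ.map y) (φ.map (op (K.ip (e i) x) • e i)) := fun i => by
    rw [φ.map_rsmul, Corr.tmul_lsmul, ← ψ.map_lsmul]
    conv_rhs => rw [← he' (K.ip (e i) x • y), map_sum, Corr.sum_tmul]
    refine Finset.sum_congr rfl fun j _ => ?_
    rw [hR, Corr.ip_tmul, ψ.map_rsmul, Corr.lsmul_tmul]
  simp only [_root_.sum_apply, h1]
  rw [← Corr.tmul_sum, ← map_sum, he]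

/-- Frames on all four modules make both the flip and the flip built from the inverses bounded. They
are mutually inverse, and compatible with the actions, because this holds on elementary tensors. -/
lemma exists_tensor (φ : AntiIso K K') (ψ : AntiIso L L') {m n m' n' : ℕ} {e : Fin m → K}
    (he : K.IsFrame e) {e' : Fin n → L} (he' : L.IsFrame e') {v : Fin m' → K'} (hv : K'.IsFrame v)
    {v' : Fin n' → L'} (hv' : L'.IsFrame v') :
    Nonempty (AntiIso (Corr.tensor K L) (Corr.tensor L' K')) := by
  obtain ⟨J, hJ⟩ := exists_tensor_map φ ψ he he'
  obtain ⟨J', hJ'⟩ := exists_tensor_map ψ.symm φ.symm hv' hv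
  have h1 := Corr.clm_ext_of_total (Corr.total_tmul' K L) (f := J'.comp J)
    (f' := ContinuousLinearMap.id ℂ _) fun p => by
      rw [ContinuousLinearMap.comp_apply, hJ, hJ']
      exact congrArg₂ Corr.tmul (φ.inv_map _) (ψ.inv_map _)
  have h2 := Corr.clm_ext_of_total (Corr.total_tmul' L' K') (f := J.comp J')
    (f' := ContinuousLinearMap.id ℂ _) fun p => by
      rw [ContinuousLinearMap.comp_apply, hJ', hJ]
      exact congrArg₂ Corr.tmul (ψ.map_inv _) (φ.map_inv _)
  have h3 : ∀ a : A, J.comp ((Corr.tensor K L).lsmulL a) =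
      ((Corr.tensor L' K').rsmulActL (star a)).comp J := fun a =>
    Corr.antilinear_ext_of_total (Corr.total_tmul' K L) fun p => by
      rw [ContinuousLinearMap.comp_apply, ContinuousLinearMap.comp_apply, Corr.lsmulL_apply,
        Corr.rsmulActL_apply, Corr.lsmul_tmul, hJ, hJ, φ.map_lsmul, Corr.rsmul_tmul]
  have h4 : ∀ a : A, J.comp ((Corr.tensor K L).rsmulActL a) =
      ((Corr.tensor L' K').lsmulL (star a)).comp J := fun a =>
    Corr.antilinear_ext_of_total (Corr.total_tmul' K L) fun p => by
      rw [ContinuousLinearMap.comp_apply, ContinuousLinearMap.comp_apply, Corr.lsmulL_apply,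
        Corr.rsmulActL_apply, Corr.rsmul_tmul, hJ, hJ, ψ.map_rsmul, Corr.lsmul_tmul]
  exact ⟨{ map := J
           inv := J'
           inv_map := fun x => congrArg (fun T => T x) h1
           map_inv := fun x => congrArg (fun T => T x) h2
           map_lsmul := fun a x => congrArg (fun T => T x) (h3 a)
           map_rsmul := fun a x => congrArg (fun T => T x) (h4 a) }⟩

/-- The object of `Bim_fgp(A)` determined by an anti-isomorphism and two frames. -/
def toBimFgp (φ : AntiIso K K') (h : ∃ (n : ℕ) (e : Fin n → K), K.IsFrame e)
    (h' : ∃ (n : ℕ) (e : Fin n → K'), K'.IsFrame e) : BimFgp A where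
  obj := K
  biHilbertian := ⟨φ.leftInner⟩
  finite_right := h.choose_spec.choose_spec.finite_projective.1
  projective_right := h.choose_spec.choose_spec.finite_projective.2
  finite_left := (φ.finite_projective_left h'.choose_spec.choose_spec).1
  projective_left := (φ.finite_projective_left h'.choose_spec.choose_spec).2

end AntiIso

/-! ### The conjugate of a correspondence with a left inner product -/

namespace LeftInner

variable {K : Corr A} (l : LeftInner K)

/-- The underlying space of the conjugate correspondence. -/
def Conj (_ : LeftInner K) : Type u := K.carrier

/-- The canonical map to the conjugate. -/
def bar (x : K) : l.Conj := x

/-- The inverse of the canonical map to the conjugate. -/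
def unbar (x : l.Conj) : K := x

instance : AddCommGroup l.Conj := inferInstanceAs (AddCommGroup K.carrier)
instance : Module ℂ l.Conj := Module.compHom K.carrier (starRingEnd ℂ)
instance : Module A l.Conj :=
  Module.compHom K.carrier (starRingEquiv (R := A)).toRingHom
instance : Module Aᵐᵒᵖ l.Conj :=
  Module.compHom K.carrier ((starRingEquiv (R := A)).symm.toRingHom)

lemma csmul_bar (c : ℂ) (x : K) : c • l.bar x = l.bar (star c • x) := rfl
lemma lsmul_bar (a : A) (x : K) : a • l.bar x = l.bar (op (star a) • x) := rfl
lemma rsmul_bar (a : A) (x : K) : op a • l.bar x = l.bar (star a • x) := rfl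

/-- The right inner product of the conjugate. -/
def conjIp (x y : l.Conj) : A := l.lip x y

lemma lip_add_right (x y z : K) : l.lip x (y + z) = l.lip x y + l.lip x z := by
  rw [← l.star_lip, l.lip_add_left, star_add, l.star_lip, l.star_lip]

lemma lip_smul_right (a : A) (x y : K) : l.lip x (a • y) = l.lip x y * star a := by
  rw [← l.star_lip, l.lip_smul_left, star_mul, l.star_lip]

lemma isSemiInner_conj : IsSemiInner l.conjIp where
  add_right := l.lip_add_right
  smul_right c x y := by
    change l.lip (l.unbar x) (star c • l.unbar y) = c • l.lip (l.unbar x) (l.unbar y)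
    rw [K.csmul_eq_lsmul, lip_smul_right, Algebra.algebraMap_eq_smul_one, star_smul, star_star,
      star_one, mul_smul_comm, mul_one]
  star_eq := l.star_lip
  nonneg := l.lip_nonneg

lemma conjIp_rsmul (a : A) (x y : l.Conj) : l.conjIp x (op a • y) = l.conjIp x y * a := by
  change l.lip (l.unbar x) (star a • l.unbar y) = l.lip (l.unbar x) (l.unbar y) * a
  rw [l.lip_smul_right, star_star]

instance : Norm l.Conj := ⟨l.isSemiInner_conj.sn⟩

lemma conj_norm_sq (x : l.Conj) : ‖x‖ ^ 2 = ‖l.conjIp x x‖ := l.isSemiInner_conj.sn_sq x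

lemma norm_bar_le : ∃ C : ℝ, 0 < C ∧ ∀ x : K, ‖l.bar x‖ ≤ C * ‖x‖ := by
  obtain ⟨c, C, hc, hC, h⟩ := l.norm_equiv
  refine ⟨√C, Real.sqrt_pos.mpr hC, fun x => le_of_sq_le_sq ?_ (by positivity)⟩
  rw [conj_norm_sq, mul_pow, Real.sq_sqrt hC.le]
  exact (h x).2

lemma norm_le_bar : ∃ C : ℝ, 0 < C ∧ ∀ x : K, ‖x‖ ≤ C * ‖l.bar x‖ := by
  obtain ⟨c, C, hc, hC, h⟩ := l.norm_equiv
  refine ⟨√c⁻¹, Real.sqrt_pos.mpr (inv_pos.mpr hc), fun x => le_of_sq_le_sq ?_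
    (mul_nonneg (Real.sqrt_nonneg _) (l.isSemiInner_conj.sn_nonneg _))⟩
  rw [mul_pow, conj_norm_sq, Real.sq_sqrt (inv_nonneg.mpr hc.le)]
  have := (h x).1
  rw [le_inv_mul_iff₀ hc]
  exact this

/-- Definiteness of the left norm comes from its equivalence with the right norm. -/
lemma conj_core : NormedSpace.Core ℂ l.Conj where
  norm_nonneg := l.isSemiInner_conj.sn_nonneg
  norm_smul := l.isSemiInner_conj.sn_smul
  norm_triangle := l.isSemiInner_conj.sn_add_le (fun a x => op a • x) l.conjIp_rsmul
  norm_eq_zero_iff x := by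
    refine ⟨fun h => ?_, fun h => ?_⟩
    · obtain ⟨C, _, hC⟩ := l.norm_le_bar
      have h1 := hC x
      have h2 : ‖l.bar x‖ = 0 := h
      rw [h2, mul_zero] at h1
      exact norm_le_zero_iff.mp h1
    · rw [h]
      change √‖l.conjIp 0 0‖ = 0
      rw [l.isSemiInner_conj.zero_left, norm_zero, Real.sqrt_zero]

instance : NormedAddCommGroup l.Conj := NormedAddCommGroup.ofCore l.conj_core
instance : NormedSpace ℂ l.Conj := ⟨fun c x => (l.conj_core.norm_smul c x).le⟩

/-- The canonical conjugate linear map to the conjugate. -/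
def barL : K →L⋆[ℂ] l.Conj :=
  LinearMap.mkContinuousOfExistsBound
    { toFun := l.bar
      map_add' := fun _ _ => rfl
      map_smul' := fun c x => by
        rw [l.csmul_bar, starRingEnd_apply, star_star] }
    (l.norm_bar_le.imp fun _ h => h.2)

/-- The inverse of the canonical conjugate linear map to the conjugate. -/
def unbarL : l.Conj →L⋆[ℂ] K :=
  LinearMap.mkContinuousOfExistsBound
    { toFun := l.unbar
      map_add' := fun _ _ => rfl
      map_smul' := fun _ _ => rfl }
    (l.norm_le_bar.imp fun _ h => h.2)

instance : CompleteSpace l.Conj := by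
  obtain ⟨C, hC0, hC⟩ := l.norm_bar_le
  have h : AntilipschitzWith ⟨C, hC0.le⟩ l.unbarL :=
    AddMonoidHomClass.antilipschitz_of_bound l.unbarL fun x => hC x
  have hs : Set.range l.unbarL = Set.univ := Set.range_eq_univ.mpr fun x => ⟨l.bar x, rfl⟩
  rw [completeSpace_iff_isComplete_range (h.isUniformInducing l.unbarL.uniformContinuous), hs]
  exact isClosed_univ.isComplete

/-- The conjugate correspondence. -/
def conj : Corr A where
  carrier := l.Conj
  bimodule := ⟨fun a b x => (smul_comm (star b.unop) (op (star a)) (l.unbar x)).symm⟩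
  leftTower := ⟨fun c a x => by
    change op (star (c • a)) • l.unbar x = star c • op (star a) • l.unbar x
    rw [star_smul, op_smul, smul_assoc]⟩
  rightTower := ⟨fun c a x => by
    change star (c • a.unop) • l.unbar x = star c • star a.unop • l.unbar x
    rw [star_smul, smul_assoc]⟩
  ip := l.conjIp
  ip_add_right := l.isSemiInner_conj.add_right
  ip_smul_right := l.conjIp_rsmul
  star_ip := l.star_lip
  ip_nonneg := l.lip_nonneg
  norm_sq := l.conj_norm_sq
  ip_left a x y := by
    change l.lip (op (star a) • l.unbar x) (l.unbar y) =
      l.lip (l.unbar x) (op (star (star a)) • l.unbar y)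
    rw [l.lip_right]

/-- The canonical anti-isomorphism to the conjugate. -/
def antiIso : AntiIso K l.conj where
  map := l.barL
  inv := l.unbarL
  inv_map _ := rfl
  map_inv _ := rfl
  map_lsmul a x := by
    change l.bar (a • x) = op (star a) • l.bar x
    rw [l.rsmul_bar, star_star]
  map_rsmul a x := by
    change l.bar (op a • x) = star a • l.bar x
    rw [l.lsmul_bar, star_star]

end LeftInner

/-! ### Closure of `Bim_fgp(A)` under tensor products, unit and direct summands -/

namespace BimFgp

lemma exists_frame (X : BimFgp A) : ∃ (n : ℕ) (e : Fin n → X.obj), X.obj.IsFrame e :=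
  X.obj.exists_frame_of_finite X.finite_right

/-- Left generators of `X` become right generators of its conjugate, a right Hilbert module for the
left inner product of `X`; hence the conjugate has a finite frame. -/
lemma exists_antiIso (X : BimFgp A) : ∃ (K' : Corr A) (_ : AntiIso X.obj K'),
    ∃ (n : ℕ) (v : Fin n → K'), K'.IsFrame v := by
  obtain ⟨l⟩ := X.biHilbertian
  have := X.finite_left
  obtain ⟨n, g, hg⟩ := Module.Finite.exists_fin (R := A) (M := X.obj)
  refine ⟨l.conj, l.antiIso, n, l.conj.exists_frame (fun i => l.antiIso.map (g i)) fun x => ?_⟩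
  obtain ⟨c, hc⟩ := (Submodule.mem_span_range_iff_exists_fun A).mp
    (hg ▸ Submodule.mem_top : l.antiIso.inv x ∈ Submodule.span A (Set.range g))
  refine ⟨fun i => star (c i), ?_⟩
  conv_rhs => rw [← l.antiIso.map_inv x, ← hc, map_sum]
  exact Finset.sum_congr rfl fun i _ => (l.antiIso.map_lsmul _ _).symm

/-- `Bim_fgp(A)` is closed under tensor products. -/
lemma exists_tensor (X Y : BimFgp A) : ∃ Z : BimFgp A, Z.obj = X.obj ⊗ Y.obj := by
  obtain ⟨m, e, he⟩ := X.exists_frame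
  obtain ⟨n, e', he'⟩ := Y.exists_frame
  obtain ⟨X', φ, m', v, hv⟩ := X.exists_antiIso
  obtain ⟨Y', ψ, n', v', hv'⟩ := Y.exists_antiIso
  obtain ⟨J⟩ := φ.exists_tensor ψ he he' hv hv'
  exact ⟨J.toBimFgp (Corr.exists_frame_tensor he he') (Corr.exists_frame_tensor hv' hv), rfl⟩

/-- The tensor product of `Bim_fgp(A)`. -/
def tensor (X Y : BimFgp A) : BimFgp A :=
  -- The fields are transported so that `obj` is definitionally `X.obj ⊗ Y.obj`; later, morphisms
  -- out of the tensor product of correspondences are used directly as morphisms out of this object.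
  { (exists_tensor X Y).choose with
    obj := X.obj ⊗ Y.obj
    biHilbertian := (exists_tensor X Y).choose_spec ▸ (exists_tensor X Y).choose.biHilbertian
    finite_right := (exists_tensor X Y).choose_spec ▸ (exists_tensor X Y).choose.finite_right
    projective_right :=
      (exists_tensor X Y).choose_spec ▸ (exists_tensor X Y).choose.projective_right
    finite_left := (exists_tensor X Y).choose_spec ▸ (exists_tensor X Y).choose.finite_left
    projective_left :=
      (exists_tensor X Y).choose_spec ▸ (exists_tensor X Y).choose.projective_left }

lemma isFrame_unit : (Corr.unit A).IsFrame (fun _ : Fin 1 => (1 : A)) := fun x => by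
  rw [Finset.univ_unique, Finset.sum_singleton]
  change (1 : A) * (star (1 : A) * (show A from x)) = x
  rw [star_one, one_mul, one_mul]

variable (A) in
/-- The tensor unit of `Bim_fgp(A)`. -/
def unit : BimFgp A :=
  AntiIso.toBimFgp (K := Corr.unit A) (K' := Corr.unit A)
    { map := ((starL ℂ : A ≃L⋆[ℂ] A) : A →L⋆[ℂ] A)
      inv := ((starL ℂ : A ≃L⋆[ℂ] A) : A →L⋆[ℂ] A)
      inv_map := fun x => star_star (show A from x)
      map_inv := fun x => star_star (show A from x)
      map_lsmul := fun a x => star_mul a (show A from x)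
      map_rsmul := fun a x => star_mul (show A from x) a }
    ⟨1, _, isFrame_unit⟩ ⟨1, _, isFrame_unit⟩

/-- A direct summand of an object of `Bim_fgp(A)`. -/
def summand (X : BimFgp A) {K : Corr A} (V : K ⟶ X.obj) (hV : V ≫ Corr.adj V = 𝟙 K) : BimFgp A where
  obj := K
  biHilbertian := by
    obtain ⟨l⟩ := X.biHilbertian
    obtain ⟨c, C, hc, hC, h⟩ := l.norm_equiv
    have hn : ∀ x, ‖V x‖ ^ 2 = ‖x‖ ^ 2 := fun x => by
      rw [X.obj.norm_sq, Corr.ip_map_map, hV, K.norm_sq, Corr.id_apply]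
    exact ⟨{
      lip := fun x y => l.lip (V x) (V y)
      lip_add_left := fun x y z => by rw [map_add, l.lip_add_left]
      lip_smul_left := fun a x y => by rw [Corr.map_lsmul, l.lip_smul_left]
      star_lip := fun x y => l.star_lip _ _
      lip_nonneg := fun x => l.lip_nonneg _
      lip_right := fun a x y => by rw [Corr.map_rsmul, Corr.map_rsmul, l.lip_right]
      norm_equiv := ⟨c, C, hc, hC, fun x => by rw [← hn]; exact h _⟩ }⟩
  finite_right := (X.exists_frame.choose_spec.choose_spec.map hV).finite_projective.1
  projective_right := (X.exists_frame.choose_spec.choose_spec.map hV).finite_projective.2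
  finite_left := by
    have := X.finite_left
    exact Module.Finite.of_surjective
      ({ toFun := Corr.adj V, map_add' := map_add _, map_smul' := Corr.map_lsmul _ } :
        X.obj →ₗ[A] K) fun x => ⟨V x, congrArg (fun f : K ⟶ K => f x) hV⟩
  projective_left := by
    have := X.projective_left
    exact Module.Projective.of_split
      ({ toFun := V, map_add' := map_add _, map_smul' := Corr.map_lsmul _ } : K →ₗ[A] X.obj)
      { toFun := Corr.adj V, map_add' := map_add _, map_smul' := Corr.map_lsmul _ }
      (LinearMap.ext fun x => congrArg (fun f : K ⟶ K => f x) hV)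

end BimFgp

end CStarCorr

/-! ### Scalars and the trivial centre -/

namespace CStarCorr

variable {A : Type u} [CStarAlgebra A] [PartialOrder A] [StarOrderedRing A]

/-- Self-adjointness makes `c` real. A negative `c` would map to an element both `≥ 0` and `≤ 0` in
a nonzero algebra. -/
lemma algebraMap_nonneg_complex [Nontrivial A] {c : ℂ} (h : 0 ≤ algebraMap ℂ A c) :
    ((c.re : ℝ) : ℂ) = c ∧ 0 ≤ c.re := by
  have h1 : algebraMap ℂ A (star c) = algebraMap ℂ A c := by
    rw [algebraMap_star_comm, (IsSelfAdjoint.of_nonneg h).star_eq]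
  have h2 : ((c.re : ℝ) : ℂ) = c := Complex.conj_eq_iff_re.mp ((algebraMap ℂ A).injective h1)
  refine ⟨h2, ?_⟩
  by_contra hc
  have h3 : algebraMap ℂ A c = c.re • (1 : A) := by
    rw [← h2, Algebra.algebraMap_eq_smul_one, Complex.coe_smul, Complex.ofReal_re]
  have h4 : algebraMap ℂ A c = 0 := le_antisymm
    (h3 ▸ smul_nonpos_of_nonpos_of_nonneg (not_le.mp hc).le zero_le_one) h
  rw [map_eq_zero] at h4
  rw [h4] at hc
  exact hc le_rfl

/-- The center of `A` consists of scalars. -/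
def TrivialCenter (A : Type u) [CStarAlgebra A] : Prop :=
  ∀ z : A, (∀ a, a * z = z * a) → ∃ c : ℂ, algebraMap ℂ A c = z

lemma trivialCenter_of_center_eq_bot (h : Subalgebra.center ℂ A = ⊥) : TrivialCenter A :=
  fun z hz => by
    have : z ∈ Subalgebra.center ℂ A := Subalgebra.mem_center_iff.mpr hz
    rwa [h, Algebra.mem_bot] at this

/-! ### The trace form on endomorphisms and finite-dimensionality -/

section TraceForm

/-- A frame for a left inner product. -/
def LeftInner.IsFrame {X : Corr A} (l : LeftInner X) {n : ℕ} (v : Fin n → X) : Prop :=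
  ∀ x, ∑ j, l.lip x (v j) • v j = x

variable {X : Corr A} {n : ℕ}

/-- The form `∑ ⟨S vⱼ, T vⱼ⟩`. -/
def traceForm (v : Fin n → X) (S T : X ⟶ X) : A := ∑ j, X.ip (S (v j)) (T (v j))

lemma isSemiInner_traceForm (v : Fin n → X) : IsSemiInner (traceForm v) where
  add_right S T T' := by
    simp only [traceForm, Corr.add_apply, X.ip_add_right, Finset.sum_add_distrib]
  smul_right c S T := by
    simp only [traceForm, Corr.smul_apply, X.isSemiInner.smul_right, Finset.smul_sum]
  star_eq S T := by simp only [traceForm, star_sum, X.star_ip]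
  nonneg T := Finset.sum_nonneg fun _ _ => X.ip_nonneg _

lemma traceForm_comp (v : Fin n → X) (S T U : X ⟶ X) :
    traceForm v (S ≫ U) T = traceForm v S (T ≫ Corr.adj U) :=
  Finset.sum_congr rfl fun _ _ => Corr.ip_adj U _ _

variable {v : Fin n → X} {l : LeftInner X} (hv : l.IsFrame v)
include hv

/-- Expand `vⱼ a` in the left frame and move the coefficients into the first argument: `∑ⱼ ⟨S vⱼ,
T(vⱼ a)⟩ = ∑ₖ ⟨S(vₖ a*), T vₖ⟩`. Right linearity extracts `a` on the right from one side and on the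
left from the other. This is how the trivial centre makes the form scalar. -/
lemma traceForm_central (S T : X ⟶ X) (a : A) : a * traceForm v S T = traceForm v S T * a := by
  have h1 : ∀ j, X.ip (S (v j)) (T (v j)) * a =
      ∑ k, X.ip (l.lip (op (star a) • v k) (v j) • S (v j)) (T (v k)) := fun j => by
    rw [← X.ip_smul_right, ← Corr.map_rsmul]
    conv_lhs => rw [← hv (op a • v j), map_sum, Corr.ip_sum_right]
    refine Finset.sum_congr rfl fun k _ => ?_
    rw [Corr.map_lsmul, X.ip_left, l.star_lip, l.lip_right]
  rw [traceForm, Finset.sum_mul, Finset.sum_congr rfl fun j _ => h1 j, Finset.sum_comm,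
    Finset.mul_sum]
  refine Finset.sum_congr rfl fun k _ => ?_
  rw [← Corr.ip_sum_left]
  simp only [← Corr.map_lsmul]
  rw [← map_sum, hv, Corr.map_rsmul, Corr.ip_rsmul_left, star_star]

/-- A positive sum that vanishes has vanishing terms, so `T` kills the `vⱼ`, which generate `X` as a
left module. -/
lemma eq_zero_of_traceForm {T : X ⟶ X} (h : traceForm v T T = 0) : T = 0 := by
  have h1 : ∀ j, T (v j) = 0 := fun j => by
    rw [traceForm, Finset.sum_eq_zero_iff_of_nonneg fun _ _ => X.ip_nonneg _] at h
    rw [← norm_eq_zero, ← sq_eq_zero_iff, X.norm_sq, h j (Finset.mem_univ j), norm_zero]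
  refine Corr.hom_ext fun x => ?_
  rw [← hv x, map_sum]
  exact Finset.sum_eq_zero fun j _ => by rw [Corr.map_lsmul, h1, smul_zero]

variable (hA : TrivialCenter A)

/-- The scalar value of the trace form. -/
def traceInner (S T : X ⟶ X) : ℂ := (hA _ (traceForm_central hv S T)).choose

lemma traceInner_spec (S T : X ⟶ X) :
    algebraMap ℂ A (traceInner hv hA S T) = traceForm v S T :=
  (hA _ (traceForm_central hv S T)).choose_spec

variable [Nontrivial A]

/-- The inner product on endomorphisms. -/
abbrev traceCore : InnerProductSpace.Core ℂ (X ⟶ X) where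
  inner := traceInner hv hA
  conj_inner_symm S T := (algebraMap ℂ A).injective <| by
    change algebraMap ℂ A (star _) = _
    rw [algebraMap_star_comm, traceInner_spec, traceInner_spec, (isSemiInner_traceForm v).star_eq]
  re_inner_nonneg T := by
    refine (algebraMap_nonneg_complex (A := A) ?_).2
    rw [traceInner_spec]
    exact (isSemiInner_traceForm v).nonneg T
  add_left S S' T := (algebraMap ℂ A).injective <| by
    rw [map_add, traceInner_spec, traceInner_spec, traceInner_spec,
      (isSemiInner_traceForm v).add_left]
  smul_left S T c := (algebraMap ℂ A).injective <| by
    rw [map_mul, traceInner_spec, traceInner_spec, (isSemiInner_traceForm v).smul_left,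
      Algebra.smul_def]
    rfl
  definite T h := by
    refine eq_zero_of_traceForm hv ?_
    rw [← traceInner_spec hv hA]
    exact (congrArg _ h).trans (map_zero _)

open scoped ComplexOrder in
/-- If the real part of a positive matrix is the identity then the matrix is at most `2`. -/
lemma gram_le_two {N : ℕ} (T : Fin N → (X ⟶ X))
    (hT : ∀ i j, (traceInner hv hA (T i) (T j)).re = if i = j then 1 else 0) (b : Fin N → A) :
    ∑ i, ∑ j, star (b i) * traceForm v (T i) (T j) * b j ≤ 2 * ∑ i, star (b i) * b i := by
  let core := traceCore hv hA
  let : NormedAddCommGroup (X ⟶ X) := core.toNormedAddCommGroup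
  let : InnerProductSpace ℂ (X ⟶ X) := InnerProductSpace.ofCore core.toCore
  -- The Gram matrix `G` and its transpose are both positive, and `G + Gᵗ = 2 Re G = 2`. Factoring
  -- `Gᵗ` shows that its contribution is positive, and dropping it leaves the bound.
  obtain ⟨m, M, hM⟩ := Matrix.posSemidef_iff_eq_sum_vecMulVec.mp
    (Matrix.posSemidef_gram ℂ T).transpose
  have hG : ∀ i j, traceInner hv hA (T j) (T i) = ∑ z, M z i * star (M z j) := fun i j => by
    have h := congrFun (congrFun hM i) j
    rw [Matrix.transpose_apply, Matrix.gram_apply, Matrix.sum_apply] at h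
    exact h
  have hstar : ∀ i j, star (traceInner hv hA (T i) (T j)) = traceInner hv hA (T j) (T i) :=
    fun i j => core.conj_inner_symm _ _
  have hsum : ∀ i j, traceInner hv hA (T i) (T j) + traceInner hv hA (T j) (T i) =
      if i = j then 2 else 0 := fun i j => by
    rw [← hstar i j, Complex.star_def, Complex.add_conj, hT]
    split_ifs <;> simp
  have hpos : 0 ≤ ∑ i, ∑ j, star (b i) * traceForm v (T j) (T i) * b j := by
    have h : ∑ i, ∑ j, star (b i) * traceForm v (T j) (T i) * b j =
        ∑ z, star (∑ i, star (M z i) • b i) * (∑ j, star (M z j) • b j) := by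
      simp only [star_sum, Finset.sum_mul, Finset.mul_sum]
      simp_rw [Finset.sum_comm (s := (Finset.univ : Finset (Fin m)))]
      rw [Finset.sum_comm]
      refine Finset.sum_congr rfl fun i _ => Finset.sum_congr rfl fun j _ => ?_
      rw [← traceInner_spec hv hA, hG, map_sum, Finset.mul_sum, Finset.sum_mul]
      refine Finset.sum_congr rfl fun z _ => ?_
      rw [star_smul, star_star, smul_mul_smul_comm, ← Algebra.commutes, ← Algebra.smul_def,
        smul_mul_assoc]
    rw [h]
    exact Finset.sum_nonneg fun z _ => star_mul_self_nonneg _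
  have htot : ∑ i, ∑ j, star (b i) * traceForm v (T i) (T j) * b j +
      ∑ i, ∑ j, star (b i) * traceForm v (T j) (T i) * b j = 2 * ∑ i, star (b i) * b i := by
    rw [← Finset.sum_add_distrib, Finset.mul_sum]
    refine Finset.sum_congr rfl fun i _ => ?_
    rw [← Finset.sum_add_distrib, Finset.sum_eq_single i]
    · rw [← add_mul, ← mul_add, ← traceInner_spec hv hA, ← map_add, hsum, if_pos rfl, map_ofNat,
        two_mul, mul_assoc, two_mul, mul_add]
    · intro j _ hj
      rw [← add_mul, ← mul_add, ← traceInner_spec hv hA, ← traceInner_spec hv hA, ← map_add, hsum,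
        if_neg (Ne.symm hj), map_zero, mul_zero, zero_mul]
    · exact fun h => absurd (Finset.mem_univ i) h
  rw [← htot]
  exact le_add_of_nonneg_right hpos

/-- Put `bᵢ = ⟨Tᵢ x, y⟩`, `B = ∑ bᵢ* bᵢ` and `zⱼ = ∑ᵢ Tᵢ(vⱼ) bᵢ`. Expanding `x` in the left frame
gives `B = ⟨y, ∑ⱼ ⟨x, vⱼ⟩ zⱼ⟩`, while `gram_le_two` gives `‖zⱼ‖² ≤ 2‖B‖`. So `‖B‖` is at most a
constant times `‖B‖^(1/2)`, and the resulting bound does not depend on `N`. -/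
lemma norm_sum_ip_le {N : ℕ} (T : Fin N → (X ⟶ X))
    (hT : ∀ i j, (traceInner hv hA (T i) (T j)).re = if i = j then 1 else 0) (x y : X) :
    ‖∑ i, star (X.ip (T i x) y) * X.ip (T i x) y‖ ≤
      2 * (∑ j, ‖l.lip x (v j)‖) ^ 2 * ‖y‖ ^ 2 := by
  set b : Fin N → A := fun i => X.ip (T i x) y
  set B := ∑ i, star (b i) * b i with hB
  let z : Fin n → X := fun j => ∑ i, op (b i) • T i (v j)
  have h1 : B = X.ip y (∑ j, l.lip x (v j) • z j) := by
    have h : ∑ j, l.lip x (v j) • z j = ∑ i, op (b i) • T i x := by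
      simp only [z, Finset.smul_sum]
      rw [Finset.sum_comm]
      refine Finset.sum_congr rfl fun i _ => ?_
      conv_rhs => rw [← hv x, map_sum, Finset.smul_sum]
      exact Finset.sum_congr rfl fun j _ => by rw [Corr.map_lsmul, smul_comm]
    rw [h, Corr.ip_sum_right, hB]
    refine Finset.sum_congr rfl fun i _ => ?_
    rw [X.ip_smul_right, X.star_ip]
  have h2 : ∑ j, X.ip (z j) (z j) = ∑ i, ∑ k, star (b i) * traceForm v (T i) (T k) * b k := by
    simp only [z, Corr.ip_sum_left]
    simp only [Corr.ip_sum_right, traceForm, Finset.mul_sum, Finset.sum_mul]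
    rw [Finset.sum_comm]
    refine Finset.sum_congr rfl fun i _ => ?_
    rw [Finset.sum_comm]
    refine Finset.sum_congr rfl fun k _ => Finset.sum_congr rfl fun j _ => ?_
    rw [X.ip_smul_right, X.ip_rsmul_left]
  have h3 : ∀ j, ‖z j‖ ^ 2 ≤ 2 * ‖B‖ := fun j => by
    have h4 : X.ip (z j) (z j) ≤ 2 * B :=
      (Finset.single_le_sum (f := fun j => X.ip (z j) (z j)) (fun j _ => X.ip_nonneg _)
        (Finset.mem_univ j)).trans (h2 ▸ gram_le_two hv hA T hT b)
    rw [X.norm_sq]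
    refine (CStarAlgebra.norm_le_norm_of_nonneg_of_le (X.ip_nonneg _) h4).trans ?_
    rw [two_mul, two_mul]
    exact norm_add_le _ _
  have h5 : ‖B‖ ≤ ‖y‖ * ((∑ j, ‖l.lip x (v j)‖) * √(2 * ‖B‖)) := by
    conv_lhs => rw [h1]
    refine (X.norm_ip_le _ _).trans ?_
    gcongr
    refine (norm_sum_le _ _).trans ?_
    rw [Finset.sum_mul]
    refine Finset.sum_le_sum fun j _ => (X.norm_smul_le' _ _).trans ?_
    gcongr
    exact Real.le_sqrt_of_sq_le (h3 j)
  have h6 : ‖B‖ ^ 2 ≤ ‖y‖ ^ 2 * (∑ j, ‖l.lip x (v j)‖) ^ 2 * (2 * ‖B‖) := by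
    calc ‖B‖ ^ 2 ≤ (‖y‖ * ((∑ j, ‖l.lip x (v j)‖) * √(2 * ‖B‖))) ^ 2 := by gcongr
      _ = _ := by rw [mul_pow, mul_pow, Real.sq_sqrt (by positivity)]; ring
  rcases (norm_nonneg B).eq_or_lt with h0 | h0
  · rw [← h0]; positivity
  · nlinarith

/-- The trace forms of the `Tᵢ` with themselves add up to `N`. Expanding `Tᵢ vₖ` in the right frame,
and moving `Tᵢ` onto `e_r` by self-adjointness, writes the same sum as finitely many terms that
`norm_sum_ip_le` bounds independently of `N`. -/
lemma card_le_of_orthonormal {m : ℕ} {e : Fin m → X} (he : X.IsFrame e) {N : ℕ}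
    (T : Fin N → (X ⟶ X)) (hsa : ∀ i, Corr.adj (T i) = T i)
    (hT : ∀ i j, (traceInner hv hA (T i) (T j)).re = if i = j then 1 else 0) :
    (N : ℝ) ≤ ∑ k, ∑ r, 2 * (∑ j, ‖l.lip (e r) (v j)‖) ^ 2 * ‖v k‖ ^ 2 := by
  have h1 : ∑ i, traceForm v (T i) (T i) =
      ∑ k, ∑ r, ∑ i, star (X.ip (T i (e r)) (v k)) * X.ip (T i (e r)) (v k) := by
    simp only [traceForm]
    rw [Finset.sum_comm]
    refine Finset.sum_congr rfl fun k _ => ?_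
    rw [Finset.sum_comm]
    refine Finset.sum_congr rfl fun i _ => ?_
    conv_lhs => rw [← he (T i (v k)), Corr.ip_sum_right]
    rw [he]
    refine Finset.sum_congr rfl fun r _ => ?_
    rw [X.ip_smul_right]
    have h : X.ip (T i (e r)) (v k) = X.ip (e r) (T i (v k)) := by rw [Corr.ip_adj, hsa]
    rw [h, X.star_ip]
  have h2 : ∀ i, traceInner hv hA (T i) (T i) = 1 := fun i => by
    have h := (algebraMap_nonneg_complex (A := A) (c := traceInner hv hA (T i) (T i)) (by
      rw [traceInner_spec]; exact (isSemiInner_traceForm v).nonneg _)).1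
    rw [← h, hT, if_pos rfl, Complex.ofReal_one]
  have h3 : ∑ i, traceForm v (T i) (T i) = (N : A) := by
    simp [← traceInner_spec hv hA, h2]
  have h4 : ‖(N : A)‖ = N := by
    have : (N : A) = algebraMap ℂ A N := (map_natCast _ _).symm
    rw [this, norm_algebraMap']
    simp
  rw [← h4, ← h3, h1]
  refine (norm_sum_le _ _).trans (Finset.sum_le_sum fun k _ => (norm_sum_le _ _).trans
    (Finset.sum_le_sum fun r _ => norm_sum_ip_le hv hA T hT _ _))

include hA

/-- Endomorphism spaces are finite-dimensional. -/
lemma finiteDimensional_end {m : ℕ} {e : Fin m → X} (he : X.IsFrame e) :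
    FiniteDimensional ℂ (X ⟶ X) := by
  let core := traceCore hv hA
  let : NormedAddCommGroup (X ⟶ X) := core.toNormedAddCommGroup
  let : InnerProductSpace ℂ (X ⟶ X) := InnerProductSpace.ofCore core.toCore
  let : InnerProductSpace ℝ (X ⟶ X) := InnerProductSpace.rclikeToReal ℂ (X ⟶ X)
  -- The count in `card_le_of_orthonormal` concerns self-adjoint endomorphisms, which form only a
  -- real subspace. An orthonormal basis for the real part of the inner product is available in the
  -- span of any finite independent set, so the count bounds the real rank. The decomposition into
  -- self-adjoint parts then returns to `ℂ`.
  let W : Submodule ℝ (X ⟶ X) :=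
    { carrier := {T | Corr.adj T = T}
      add_mem' := fun {S T} hS hT => by
        change Corr.adj (S + T) = S + T
        rw [Corr.adj_add, show Corr.adj S = S from hS, show Corr.adj T = T from hT]
      zero_mem' := Corr.adj_zero X X
      smul_mem' := fun c T hT => by
        change Corr.adj ((c : ℂ) • T) = (c : ℂ) • T
        rw [Corr.adj_smul, Complex.star_def, Complex.conj_ofReal, hT] }
  obtain ⟨B, hB⟩ := exists_nat_ge (∑ k, ∑ r, 2 * (∑ j, ‖l.lip (e r) (v j)‖) ^ 2 * ‖v k‖ ^ 2)
  have hrank : Module.rank ℝ W ≤ B := by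
    refine rank_le fun s hs => ?_
    have hcard := finrank_span_finset_eq_card hs
    let U := Submodule.span ℝ (s : Set W)
    have : FiniteDimensional ℝ U := FiniteDimensional.span_finset ℝ s
    let o := stdOrthonormalBasis ℝ U
    have h := card_le_of_orthonormal hv hA he (fun i => ((o i : W) : X ⟶ X))
      (fun i => (o i : W).2) fun i j => by
        have h := orthonormal_iff_ite.mp o.orthonormal i j
        rw [← h]; rfl
    rw [hcard] at h
    exact_mod_cast h.trans hB
  have hW : Module.Finite ℝ W := Module.finite_of_rank_eq_nat
    (Cardinal.lt_aleph0.mp (hrank.trans_lt (Cardinal.natCast_lt_aleph0))).choose_spec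
  obtain ⟨s, hs⟩ := hW.fg_top
  refine ⟨⟨s.map ⟨Subtype.val, Subtype.val_injective⟩, ?_⟩⟩
  set P : Submodule ℂ (X ⟶ X) :=
    Submodule.span ℂ (s.map ⟨Subtype.val, Subtype.val_injective⟩ : Finset (X ⟶ X)) with hP
  have hWP : ∀ T ∈ W, T ∈ P := by
    intro T hT
    have h1 : (⟨T, hT⟩ : W) ∈ Submodule.span ℝ (s : Set W) := hs ▸ Submodule.mem_top
    have h2 : Submodule.span ℝ (s : Set W) ≤ (P.restrictScalars ℝ).comap W.subtype :=
      Submodule.span_le.mpr fun t ht => Submodule.subset_span (Finset.mem_coe.mpr (Finset.mem_map_of_mem _ ht))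
    exact h2 h1
  refine eq_top_iff.mpr fun T _ => ?_
  have h1 : T + Corr.adj T ∈ P := hWP _ (by
    change Corr.adj _ = _
    rw [Corr.adj_add, Corr.adj_adj, add_comm])
  have h2 : Complex.I • (T - Corr.adj T) ∈ P := hWP _ (by
    change Corr.adj _ = _
    rw [sub_eq_add_neg, ← neg_one_smul ℂ (Corr.adj T), Corr.adj_smul, Corr.adj_add, Corr.adj_smul,
      Corr.adj_adj, Complex.star_def, Complex.conj_I]
    simp only [map_neg, map_one]
    module)
  have h3 : T = (1 / 2 : ℂ) • (T + Corr.adj T) +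
      (-Complex.I / 2) • (Complex.I • (T - Corr.adj T)) := by
    rw [smul_smul, show -Complex.I / 2 * Complex.I = 1 / 2 by
      rw [div_mul_eq_mul_div, neg_mul, Complex.I_mul_I, neg_neg]]
    module
  rw [h3]
  exact P.add_mem (P.smul_mem _ h1) (P.smul_mem _ h2)

/-- A correspondence with nontrivial endomorphisms has a nontrivial projection. -/
lemma exists_projection {m : ℕ} {e : Fin m → X} (he : X.IsFrame e) (h0 : 𝟙 X ≠ 0)
    (hirr : ¬ IsIrreducible X) :
    ∃ p : X ⟶ X, Corr.adj p = p ∧ p ≫ p = p ∧ p ≠ 0 ∧ p ≠ 𝟙 X := by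
  have hfd := finiteDimensional_end hv hA he
  let core := traceCore hv hA
  let : NormedAddCommGroup (X ⟶ X) := core.toNormedAddCommGroup
  let : InnerProductSpace ℂ (X ⟶ X) := InnerProductSpace.ofCore core.toCore
  have : Nontrivial (X ⟶ X) := ⟨⟨_, _, h0⟩⟩
  -- If every self-adjoint endomorphism were scalar, the decomposition into self-adjoint parts would
  -- make every endomorphism scalar.
  obtain ⟨T, hTsa, hT⟩ : ∃ T : X ⟶ X, Corr.adj T = T ∧ ∀ c : ℂ, T ≠ c • 𝟙 X := by
    by_contra! hcon
    refine hirr ⟨h0, fun T => ?_⟩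
    obtain ⟨c, hc⟩ := hcon (T + Corr.adj T) (by rw [Corr.adj_add, Corr.adj_adj, add_comm])
    obtain ⟨d, hd⟩ := hcon (Complex.I • (T + (-1 : ℂ) • Corr.adj T)) (by
      rw [Corr.adj_smul, Corr.adj_add, Corr.adj_smul, Corr.adj_adj, Complex.star_def,
        Complex.conj_I]
      simp only [map_neg, map_one]
      module)
    refine ⟨(1 / 2) * c + (-Complex.I / 2) * d, ?_⟩
    rw [add_smul, mul_smul, mul_smul, ← hc, ← hd, smul_smul,
      show -Complex.I / 2 * Complex.I = 1 / 2 by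
        rw [div_mul_eq_mul_div, neg_mul, Complex.I_mul_I, neg_neg]]
    module
  -- Composition with a self-adjoint `U` is a symmetric operator on the finite-dimensional Hilbert
  -- space `End(X)`. This replaces functional calculus: eigenvalues are real and the range and the
  -- kernel are orthogonal complements.
  have hsymm : ∀ U : X ⟶ X, Corr.adj U = U → LinearMap.IsSymmetric
      (Linear.rightComp ℂ X U : (X ⟶ X) →ₗ[ℂ] (X ⟶ X)) := fun U hU S S' => by
    change traceInner hv hA (S ≫ U) S' = traceInner hv hA S (S' ≫ U)
    refine (algebraMap ℂ A).injective ?_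
    rw [traceInner_spec, traceInner_spec, traceForm_comp, hU]
  obtain ⟨c, hc⟩ := Module.End.exists_eigenvalue
    (Linear.rightComp ℂ X T : (X ⟶ X) →ₗ[ℂ] (X ⟶ X))
  obtain ⟨S, hS, hS0⟩ := hc.exists_hasEigenvector
  have hcr : star c = c := (hsymm T hTsa).conj_eigenvalue_eq_self hc
  have hSc : S ≫ T = c • S := Module.End.mem_eigenspace_iff.mp hS
  set U : X ⟶ X := T + (-c) • 𝟙 X with hU
  have hUsa : Corr.adj U = U := by
    rw [hU, Corr.adj_add, Corr.adj_smul, Corr.adj_id, hTsa, star_neg, hcr]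
  have hU0 : U ≠ 0 := fun h => hT c (by
    rw [hU, neg_smul] at h
    exact add_neg_eq_zero.mp h)
  have hSU : S ≫ U = 0 := by
    rw [hU, Preadditive.comp_add, hSc, Linear.comp_smul, Category.comp_id, neg_smul, add_neg_cancel]
  set L : (X ⟶ X) →ₗ[ℂ] (X ⟶ X) := Linear.rightComp ℂ X U with hL
  -- Split `𝟙 = r + k` with `r = s ≫ U` and `k ≫ U = 0`. Multiplying by `k*` gives `k ≫ k* = k*`, so
  -- `k` is a self-adjoint idempotent, the projection onto the kernel of `U`.
  have hsup : LinearMap.range L ⊔ (LinearMap.range L)ᗮ = ⊤ :=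
    Submodule.sup_orthogonal_of_hasOrthogonalProjection
  rw [(hsymm U hUsa).orthogonal_range] at hsup
  obtain ⟨r, ⟨s, hs⟩, k, hk, hrk⟩ := Submodule.mem_sup.mp
    (hsup ▸ Submodule.mem_top : 𝟙 X ∈ LinearMap.range L ⊔ LinearMap.ker L)
  have hkU : k ≫ U = 0 := hk
  have hsr : s ≫ U = r := hs
  have hUk : U ≫ Corr.adj k = 0 := by
    have h := congrArg Corr.adj hkU
    rwa [Corr.adj_comp, hUsa, Corr.adj_zero] at h
  have h1 : k ≫ Corr.adj k = Corr.adj k := by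
    have h : (r + k) ≫ Corr.adj k = Corr.adj k := by rw [hrk, Category.id_comp]
    rwa [Preadditive.add_comp, ← hsr, Category.assoc, hUk, Limits.comp_zero, zero_add] at h
  have hksa : Corr.adj k = k := by
    have h := congrArg Corr.adj h1
    rw [Corr.adj_comp, Corr.adj_adj, h1] at h
    exact h
  -- If `k = 0`, then `𝟙 = s ≫ U`, which contradicts the eigenvector `S ≠ 0` with `S ≫ U = 0`. If `k
  -- = 𝟙`, then `U = 0` and `T` is scalar.
  refine ⟨k, hksa, by rw [hksa] at h1; exact h1, fun hk0 => hS0 ?_, fun hk1 => hU0 ?_⟩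
  · rw [hk0, add_zero, ← hsr] at hrk
    have hUS : U ≫ Corr.adj S = 0 := by
      have h := congrArg Corr.adj hSU
      rwa [Corr.adj_comp, hUsa, Corr.adj_zero] at h
    refine Corr.eq_zero_of_adj ?_
    rw [← Category.id_comp (Corr.adj S), ← hrk, Category.assoc, hUS, Limits.comp_zero]
  · rw [hk1, Category.id_comp] at hkU
    exact hkU

end TraceForm

end CStarCorr

namespace CStarCorr

variable {A : Type u} [CStarAlgebra A] [PartialOrder A] [StarOrderedRing A]

/-! ### Direct summands and decomposition into irreducibles -/

namespace Corr

/-- The kernel `⟨x, p y⟩` defining the image of the projection `p`. -/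
def projKernel {X : Corr A} (p : X ⟶ X) (hp : adj p = p) (hpp : p ≫ p = p) : Kernel A X where
  κ x y := X.ip x (p y)
  left a x := a • x
  right a x := op a • x
  star_κ x y := by rw [X.star_ip, ip_adj, hp]
  pos v := by
    have hlin : ∀ x, Finsupp.linearCombination ℂ (fun y => X.ip x (p y)) v =
        X.ip x (p (Finsupp.linearCombination ℂ (fun y : X => y) v)) := fun x => by
      simp only [Finsupp.linearCombination_apply, Finsupp.sum, map_sum, ip_sum_right, map_smul,
        X.isSemiInner.smul_right]
    have h : (v.sum fun x c => star c • Finsupp.linearCombination ℂ (fun y => X.ip x (p y)) v) =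
        X.ip (Finsupp.linearCombination ℂ (fun y : X => y) v)
          (p (Finsupp.linearCombination ℂ (fun y : X => y) v)) := by
      simp only [hlin]
      set w := p (Finsupp.linearCombination ℂ (fun y : X => y) v)
      simp only [Finsupp.linearCombination_apply, Finsupp.sum, ip_sum_left,
        X.isSemiInner.smul_left]
    rw [h]
    set w := Finsupp.linearCombination ℂ (fun y : X => y) v
    have hw : p (p w) = p w := congrArg (fun f : X ⟶ X => f w) hpp
    rw [← hw, ← congrArg (fun f : X ⟶ X => f (p w)) hp, ← ip_adj]
    exact X.ip_nonneg _
  κ_left a x y := by rw [X.ip_left, map_lsmul]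
  κ_right a x y := by rw [map_rsmul, X.ip_smul_right]
  left_add a b x y := by rw [add_smul, map_add, X.ip_add_right]
  left_mul a b x y := by rw [mul_smul]
  left_scalar c x y := by rw [algebraMap_smul, map_smul, X.isSemiInner.smul_right]

/-- The image of `p` is realized as the separated completion of `X` for `⟨x, p y⟩`. The inclusion
sends the class of `x` to `p x`, and its adjoint sends `y` to the class of `y`. -/
lemma exists_summand {X : Corr A} (p : X ⟶ X) (hp : adj p = p) (hpp : p ≫ p = p) :
    ∃ (K : Corr A) (V : K ⟶ X), V ≫ adj V = 𝟙 K ∧ adj V ≫ V = p := by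
  set k := projKernel p hp hpp
  have hpp' : ∀ x, p (p x) = p x := fun x => congrArg (fun f : X ⟶ X => f x) hpp
  have hip : ∀ x y, X.ip (p x) y = X.ip x (p y) := fun x y => by rw [ip_adj, hp]
  have hk : ∀ x y, k.toCorr.ip (k.elem x) (k.elem y) = X.ip x (p y) := k.ip_elem
  have htot : Total k.elem := k.denseRange_elem
  -- `genHom` requires a growth bound for the iterates of `t' ∘ t`, here `p`. By idempotence only
  -- `x` and `p x` occur, so rate `1` suffices.
  have hiter : ∀ (n : ℕ) x, (fun x => p x)^[n] x = x ∨ (fun x => p x)^[n] x = p x := by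
    intro n
    induction n with
    | zero => exact fun x => Or.inl rfl
    | succ n ih =>
      intro x
      right
      rw [Function.iterate_succ_apply]
      rcases ih (p x) with h | h
      · exact h
      · rw [h, hpp']
  let V : k.toCorr ⟶ X := genHom (fun x => p x) (fun x => x) htot (total_id X)
    (fun x y => by rw [hk]; exact hip x y)
    ⟨1, one_pos, fun x => ⟨‖k.elem x‖ + ‖k.elem (p x)‖, fun n => by
      rw [one_pow, mul_one]
      change ‖k.elem ((fun x => p x)^[n] x)‖ ≤ _
      rcases hiter n x with h | h
      · rw [h]; exact le_add_of_nonneg_right (norm_nonneg _)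
      · rw [h]; exact le_add_of_nonneg_left (norm_nonneg _)⟩⟩
    (fun a x => ⟨a • x, k.lsmul_elem a x, (map_lsmul p a x).symm⟩)
  have hV : ∀ x, V (k.elem x) = p x := fun x =>
    genHom_apply (fun x => p x) (fun x => x) htot (total_id X) _ _ _ x
  have hV' : ∀ y, adj V y = k.elem y := fun y => ip_ext_of_total htot fun x => by
    rw [adj_ip, hV, hk]
  refine ⟨k.toCorr, V, hom_ext_of_total htot fun x => ?_, hom_ext fun x => ?_⟩
  · rw [comp_apply, hV, hV', id_apply]
    exact ip_ext_of_total htot fun z => by rw [hk, hk, hip, hpp']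
  · rw [comp_apply, hV', hV]

end Corr

namespace BimFgp

lemma exists_leftFrame (X : BimFgp A) :
    ∃ (l : LeftInner X.obj) (n : ℕ) (v : Fin n → X.obj), l.IsFrame v := by
  obtain ⟨K', φ, n, v, hv⟩ := X.exists_antiIso
  refine ⟨φ.leftInner, n, fun i => φ.inv (v i), fun x => ?_⟩
  conv_rhs => rw [← φ.left_frame hv x]
  refine Finset.sum_congr rfl fun i _ => ?_
  congr 1
  change K'.ip (φ.map x) (φ.map (φ.inv (v i))) = _
  rw [φ.map_inv]

end BimFgp

/-- A decomposition of the identity of `X` through finitely many irreducible objects. -/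
structure Decomp (S : IrrSystem A) (X : Corr A) where
  ν : Type
  [fintype : Fintype ν]
  idx : ν → S.ι
  f : ∀ a, (S.obj (idx a)).obj ⟶ X
  sum_eq : ∑ a, Corr.adj (f a) ≫ f a = 𝟙 X

attribute [instance] Decomp.fintype

namespace Decomp

variable {S : IrrSystem A}

lemma sum_apply {X : Corr A} (D : Decomp S X) (x : X) :
    ∑ a, D.f a (Corr.adj (D.f a) x) = x := by
  have h := congrArg (fun g : X ⟶ X => g x) D.sum_eq
  rw [Corr.sum_apply, Corr.id_apply] at h
  exact h

/-- The decomposition of a sum of two direct summands. -/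
def ofSummands {X K L : Corr A} (D : Decomp S K) (E : Decomp S L) (V : K ⟶ X) (W : L ⟶ X)
    (h : Corr.adj V ≫ V + Corr.adj W ≫ W = 𝟙 X) : Decomp S X where
  ν := D.ν ⊕ E.ν
  idx := Sum.elim D.idx E.idx
  f a := match a with
    | Sum.inl a => D.f a ≫ V
    | Sum.inr a => E.f a ≫ W
  sum_eq := by
    have h1 : ∀ {K : Corr A} (D : Decomp S K) (V : K ⟶ X),
        ∑ a, Corr.adj (D.f a ≫ V) ≫ D.f a ≫ V = Corr.adj V ≫ V := fun D V =>
      Corr.hom_ext fun x => by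
        rw [Corr.sum_apply]
        simp only [Corr.adj_comp, Corr.comp_apply]
        rw [← map_sum, D.sum_apply]
    rw [Fintype.sum_sum_type]
    exact (congrArg₂ (· + ·) (h1 D V) (h1 E W)).trans h

end Decomp

/-- Conjugation by the isometry `V` embeds `End(K)` into `End(X)`. The identity is not in the range,
since it would be absorbed by the projection onto the image of `V`, forcing that projection to be
the identity. -/
lemma finrank_end_lt {X K : Corr A} [FiniteDimensional ℂ (X ⟶ X)] {V : K ⟶ X}
    (hV : V ≫ Corr.adj V = 𝟙 K) (hp : Corr.adj V ≫ V ≠ 𝟙 X) :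
    Module.finrank ℂ (K ⟶ K) < Module.finrank ℂ (X ⟶ X) := by
  let L : (K ⟶ K) →ₗ[ℂ] (X ⟶ X) :=
    (Linear.leftComp ℂ X (Corr.adj V)) ∘ₗ (Linear.rightComp ℂ K V)
  have hL : ∀ T, L T = Corr.adj V ≫ T ≫ V := fun T => rfl
  have hinj : Function.Injective L := fun T T' h => by
    rw [hL, hL] at h
    have h1 := congrArg (fun U => V ≫ U ≫ Corr.adj V) h
    simpa only [Category.assoc, hV, Category.comp_id, reassoc_of% hV] using h1
  rw [← LinearMap.finrank_range_of_inj hinj]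
  refine Submodule.finrank_lt fun htop => hp ?_
  obtain ⟨T, hT⟩ := LinearMap.range_eq_top.mp htop (𝟙 X)
  rw [hL] at hT
  rw [← Category.comp_id (Corr.adj V ≫ V), ← hT, Category.assoc, reassoc_of% hV]

/-- Every object of `Bim_fgp(A)` is a finite direct sum of irreducible objects. -/
lemma nonempty_decomp [Nontrivial A] (hA : TrivialCenter A) (S : IrrSystem A) (X : BimFgp A) :
    Nonempty (Decomp S X.obj) := by
  suffices h : ∀ (n : ℕ) (X : BimFgp A), Module.finrank ℂ (X.obj ⟶ X.obj) = n →
      Nonempty (Decomp S X.obj) from h _ X rfl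
  intro n
  induction n using Nat.strong_induction_on with
  | _ n ih =>
  intro X hn
  by_cases h0 : 𝟙 X.obj = 0
  · exact ⟨{ ν := Empty, idx := Empty.elim, f := fun a => a.elim,
             sum_eq := by rw [h0]; rfl }⟩
  by_cases hirr : IsIrreducible X.obj
  · obtain ⟨i, ⟨u⟩⟩ := S.complete X hirr
    have hu : u.inv ≠ 0 := fun h => h0 (by rw [← u.hom_inv_id, h, Limits.comp_zero])
    obtain ⟨c, _, hc⟩ := Corr.exists_unitary_of_irreducible (S.irreducible i) hirr hu
    exact ⟨{ ν := Unit, idx := fun _ => i, f := fun _ => c • u.inv,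
             sum_eq := by rw [Fintype.sum_unique]; exact hc.2 }⟩
  obtain ⟨l, m, v, hv⟩ := X.exists_leftFrame
  obtain ⟨r, e, he⟩ := X.exists_frame
  have := finiteDimensional_end hv hA he
  -- Neither `p` nor `𝟙 - p` is the identity, so both images have endomorphism algebras of strictly
  -- smaller dimension and the induction hypothesis applies to them.
  obtain ⟨p, hp, hpp, hp0, hp1⟩ := exists_projection hv hA he h0 hirr
  have hneg : (𝟙 X.obj - p) = 𝟙 X.obj + (-1 : ℂ) • p := by module
  obtain ⟨K, V, hV, hVp⟩ := Corr.exists_summand p hp hpp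
  obtain ⟨L, W, hW, hWp⟩ := Corr.exists_summand (𝟙 X.obj - p)
    (by rw [hneg, Corr.adj_add, Corr.adj_smul, Corr.adj_id, hp, star_neg, star_one])
    (by rw [Preadditive.comp_sub, Preadditive.sub_comp, Preadditive.sub_comp, hpp,
      Category.id_comp, Category.id_comp, Category.comp_id, sub_self, sub_zero])
  have hK := finrank_end_lt hV (hVp ▸ hp1)
  have hL := finrank_end_lt hW (by
    rw [hWp]
    exact fun h => hp0 (sub_eq_self.mp h))
  have hsum : Corr.adj V ≫ V + Corr.adj W ≫ W = 𝟙 X.obj := by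
    rw [hVp, hWp]
    exact add_sub_cancel _ _
  obtain ⟨D⟩ : Nonempty (Decomp S K) := ih _ (hn ▸ hK) (X.summand V hV) rfl
  obtain ⟨E⟩ : Nonempty (Decomp S L) := ih _ (hn ▸ hL) (X.summand W hW) rfl
  exact ⟨D.ofSummands E V W hsum⟩

/-! ### Existence of representatives of the irreducible objects -/

/-- Codes of correspondences with a finite frame. -/
def Code (A : Type u) : Type u := Σ n : ℕ, (Fin n → Fin n → A) × (A → Fin n → Fin n → A)

/-- The code consists of the matrices of the inner product and of the left action in a frame. -/
def HasCode (K : Corr A) (c : Code A) : Prop :=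
  ∃ e : Fin c.1 → K, K.IsFrame e ∧ (∀ i j, K.ip (e i) (e j) = c.2.1 i j) ∧
    ∀ a i j, K.ip (e i) (a • e j) = c.2.2 a i j

lemma exists_hasCode (X : BimFgp A) : ∃ c, HasCode X.obj c := by
  obtain ⟨n, e, he⟩ := X.exists_frame
  exact ⟨⟨n, fun i j => X.obj.ip (e i) (e j), fun a i j => X.obj.ip (e i) (a • e j)⟩, e, he,
    fun _ _ => rfl, fun _ _ _ => rfl⟩

/-- A frame generates the module, and both the inner product of combinations `∑ eᵢ bᵢ` and the left
action on them are computed from the matrices in the code. Equal codes therefore match two total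
families compatibly. -/
lemma HasCode.nonempty_iso {K L : Corr A} {c : Code A} (hK : HasCode K c) (hL : HasCode L c) :
    Nonempty (K ≅ L) := by
  have htot : ∀ {K : Corr A} {e : Fin c.1 → K}, K.IsFrame e →
      Corr.Total (fun b : Fin c.1 → A => ∑ i, op (b i) • e i) := fun {K e} he x =>
    subset_closure ⟨Finsupp.single (fun i => K.ip (e i) x) 1, by
      rw [Finsupp.linearCombination_single, one_smul, he]⟩
  have hip : ∀ {K : Corr A} {e : Fin c.1 → K}, (∀ i j, K.ip (e i) (e j) = c.2.1 i j) →
      ∀ b d : Fin c.1 → A, K.ip (∑ i, op (b i) • e i) (∑ i, op (d i) • e i) =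
        ∑ i, ∑ j, star (b i) * c.2.1 i j * d j := fun {K e} h b d => by
    rw [Corr.ip_sum_left]
    refine Finset.sum_congr rfl fun i _ => ?_
    rw [Corr.ip_sum_right]
    exact Finset.sum_congr rfl fun j _ => by rw [K.ip_smul_right, Corr.ip_rsmul_left, h]
  have hleft : ∀ {K : Corr A} {e : Fin c.1 → K}, K.IsFrame e →
      (∀ a i j, K.ip (e i) (a • e j) = c.2.2 a i j) → ∀ (a : A) (b : Fin c.1 → A),
      a • ∑ j, op (b j) • e j = ∑ i, op (∑ j, c.2.2 a i j * b j) • e i := fun {K e} he h a b => by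
    rw [← he (a • ∑ j, op (b j) • e j)]
    refine Finset.sum_congr rfl fun i _ => ?_
    rw [Finset.smul_sum, Corr.ip_sum_right]
    congr 2
    exact Finset.sum_congr rfl fun j _ => by rw [smul_comm, K.ip_smul_right, h]
  obtain ⟨e, he, he1, he2⟩ := hK
  obtain ⟨e', he', he1', he2'⟩ := hL
  exact ⟨Corr.genIso (htot he) (htot he') (fun b d => by rw [hip he1, hip he1'])
    fun a b => ⟨_, hleft he he2 a b, hleft he' he2' a b⟩⟩

/-- Representatives of the isomorphism classes of irreducible objects exist. -/
lemma nonempty_irrSystem : Nonempty (IrrSystem A) := by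
  -- `BimFgp A` lives one universe above `A` and `Code A` does not. The index set consists of codes
  -- of irreducible objects, identified when their chosen representatives are isomorphic.
  let s : Set (Code A) := {c | ∃ X : BimFgp A, IsIrreducible X.obj ∧ HasCode X.obj c}
  have : Nonempty (BimFgp A) := ⟨BimFgp.unit A⟩
  choose! rep hrep using fun (c : Code A) (hc : c ∈ s) => hc
  let r : Setoid s :=
    { r := fun c d => Nonempty ((rep c).obj ≅ (rep d).obj)
      iseqv := ⟨fun _ => ⟨Iso.refl _⟩, fun ⟨f⟩ => ⟨f.symm⟩, fun ⟨f⟩ ⟨g⟩ => ⟨f ≪≫ g⟩⟩ }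
  refine ⟨{ ι := Quotient r, obj := fun i => rep i.out, irreducible := fun i => ?_,
            disjoint := fun i j hij f => ?_, complete := fun X hX => ?_ }⟩
  · exact (hrep _ i.out.2).1
  · by_contra hf
    obtain ⟨c, _, hc⟩ := Corr.exists_unitary_of_irreducible (hrep _ i.out.2).1
      (hrep _ j.out.2).1 hf
    exact hij (Quotient.out_equiv_out.mp ⟨hc.iso⟩)
  · obtain ⟨c, hc⟩ := exists_hasCode X
    have hcs : c ∈ s := ⟨X, hX, hc⟩
    obtain ⟨f⟩ := hc.nonempty_iso (hrep c hcs).2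
    obtain ⟨g⟩ := Quotient.mk_out (s := r) ⟨c, hcs⟩
    exact ⟨Quotient.mk r ⟨c, hcs⟩, ⟨f ≪≫ g.symm⟩⟩

end CStarCorr

namespace CStarCorr

variable {A : Type u} [CStarAlgebra A] [PartialOrder A] [StarOrderedRing A]

/-! ### Solutions of the conjugate equations and the intrinsic dimension -/

namespace Corr

/-- The morphism `a ↦ ζ a = a ζ` defined by a central vector `ζ`. -/
def centralHom (E : Corr A) (ζ : E) (hζ : ∀ a : A, a • ζ = op a • ζ) : 𝟙_ (Corr A) ⟶ E :=
  mkHom (K := unit A) (E.rsmulL ζ) (E.ipL ζ) (fun a y => E.ip_rsmul_left a ζ y) fun a b => by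
    change op (a * (show A from b)) • ζ = a • op (show A from b) • ζ
    rw [← hζ, mul_smul, hζ]

lemma centralHom_one (E : Corr A) (ζ : E) (hζ : ∀ a : A, a • ζ = op a • ζ) :
    centralHom E ζ hζ (toUnit 1) = ζ := one_smul Aᵐᵒᵖ ζ

lemma adj_centralHom (E : Corr A) (ζ : E) (hζ : ∀ a : A, a • ζ = op a • ζ) (y : E) :
    adj (centralHom E ζ hζ) y = toUnit (E.ip ζ y) := by
  have h : adj (centralHom E ζ hζ) = mkHom (L := unit A) (E.ipL ζ) (E.rsmulL ζ)
      (fun y a => by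
        change star (E.ip ζ y) * (show A from a) = E.ip y (op (show A from a) • ζ)
        rw [E.star_ip, E.ip_smul_right]) (fun a y => by
        change E.ip ζ (a • y) = a * E.ip ζ y
        rw [← star_star a, ← E.ip_left, hζ, E.ip_rsmul_left]) :=
    adj_eq fun a y => E.ip_rsmul_left a ζ y
  rw [h]
  rfl

lemma norm_centralHom_le (E : Corr A) (ζ : E) (hζ : ∀ a : A, a • ζ = op a • ζ) :
    ‖op' (centralHom E ζ hζ)‖ ≤ ‖ζ‖ :=
  ContinuousLinearMap.opNorm_le_bound _ (norm_nonneg _) fun a => E.norm_rsmul_le a ζ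

lemma adj_whiskerRight {K K' : Corr A} (f : K ⟶ K') (L : Corr A) :
    adj (f ▷ L) = adj f ▷ L := by
  refine (adj_tensorHom f (𝟙 L)).trans ?_
  rw [adj_id]
  rfl

lemma leftUnitor_isUnitary (K : Corr A) : IsUnitary (λ_ K).hom := genIso_isUnitary _ _ _ _
lemma associator_isUnitary (K L M : Corr A) : IsUnitary (α_ K L M).hom := genIso_isUnitary _ _ _ _

lemma IsUnitary.norm {K L : Corr A} {f : K ⟶ L} (hf : IsUnitary f) (x : K) : ‖f x‖ = ‖x‖ := by
  refine (sq_eq_sq₀ (norm_nonneg _) (norm_nonneg _)).mp ?_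
  rw [L.norm_sq, hf.ip, K.norm_sq]

lemma leftUnitor_one_tmul (K : Corr A) (x : K) : (λ_ K).hom (tmul (toUnit 1) x) = x := by
  rw [leftUnitor_tmul, one_smul]

lemma norm_toUnit_one [Nontrivial A] : ‖(toUnit 1 : 𝟙_ (Corr A))‖ = 1 :=
  CStarRing.norm_one (E := A)

end Corr

/-- The conjugate equation for the morphisms defined by two central vectors. -/
lemma conjugate_equation {X D : Corr A} {ι : Type*} [Fintype ι] (d : ι → D) (y : ι → X)
    {r : (D ⊗ X : Corr A)} (hr : r = ∑ j, Corr.tmul (d j) (y j))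
    (hrc : ∀ a : A, a • r = op a • r) (r' : (X ⊗ D : Corr A)) (hrc' : ∀ a : A, a • r' = op a • r')
    (h : ∀ x : X, ∑ j, (X ⊗ D : Corr A).ip r' (Corr.tmul x (d j)) • y j = x) :
    (ρ_ X).inv ≫ X ◁ (Corr.centralHom _ r hrc) ≫ (α_ X D X).inv ≫
      Corr.adj (Corr.centralHom _ r' hrc') ▷ X ≫ (λ_ X).hom = 𝟙 X := by
  refine Corr.hom_ext fun x => ?_
  simp only [Corr.comp_apply, Corr.id_apply]
  rw [Corr.rightUnitor_inv_apply, Corr.whiskerLeft_tmul, Corr.centralHom_one, hr]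
  have e : Corr.tmul x (∑ j, Corr.tmul (d j) (y j)) =
      ∑ j, Corr.tmul x (Corr.tmul (d j) (y j)) := Corr.tmul_sum _ _ _
  refine (congrArg (fun z => (λ_ X).hom ((Corr.adj (Corr.centralHom _ r' hrc') ▷ X)
    ((α_ X D X).inv z))) e).trans ?_
  rw [map_sum, map_sum, map_sum]
  conv_rhs => rw [← h x]
  refine Finset.sum_congr rfl fun j _ => ?_
  rw [Corr.associator_inv_tmul, Corr.whiskerRight_tmul, Corr.adj_centralHom,
    Corr.leftUnitor_tmul]

namespace AntiIso

variable {K K' : Corr A} (φ : AntiIso K K') {n : ℕ} {e : Fin n → K} (he : K.IsFrame e)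
include he

/-- The vector `∑ eₗ ⊗ J eₗ` represents the functional `x ⊗ d ↦ ⟨J x, d⟩`, which does not involve
the frame. Its centrality and the conjugate equations are read off from this pairing. -/
lemma ip_sum_tmul (x : K) (d : K') :
    (K ⊗ K' : Corr A).ip (∑ l, Corr.tmul (e l) (φ.map (e l))) (Corr.tmul x d) =
      K'.ip (φ.map x) d := by
  refine (Corr.ip_sum_left _ _ _ _).trans ?_
  conv_rhs => rw [← he x, map_sum, K'.ip_sum_left]
  refine Finset.sum_congr rfl fun l _ => ?_
  rw [φ.map_rsmul, K'.ip_left, star_star]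
  exact Corr.ip_tmul _ _ _ _

lemma sum_tmul_central (a : A) :
    a • (∑ l, Corr.tmul (e l) (φ.map (e l)) : (K ⊗ K' : Corr A)) =
      op a • (∑ l, Corr.tmul (e l) (φ.map (e l)) : (K ⊗ K' : Corr A)) :=
  Corr.ip_ext_of_total (Corr.total_tmul' K K') fun p => by
    refine ((K ⊗ K' : Corr A).ip_left _ _ _).trans ?_
    refine Eq.trans ?_ ((K ⊗ K' : Corr A).ip_rsmul_left _ _ _).symm
    rw [Corr.lsmul_tmul]
    refine (φ.ip_sum_tmul he _ _).trans ?_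
    refine Eq.trans ?_ (congrArg (star a * ·) (φ.ip_sum_tmul he _ _).symm)
    rw [φ.map_lsmul, K'.ip_rsmul_left, star_star]

end AntiIso

/-- Take the conjugate as dual, with `R̄` built from a frame of `X` and `R` from a frame of the
conjugate; the conjugate equations are then left frame expansions. Existence matters for `dim`,
since a real infimum over an empty family would be `0`. -/
lemma nonempty_conjugateSolution (X : BimFgp A) : Nonempty (ConjugateSolution X) := by
  obtain ⟨n, e, he⟩ := X.exists_frame
  obtain ⟨K', φ, m, v, hv⟩ := X.exists_antiIso
  exact ⟨{
    dual := φ.symm.toBimFgp ⟨m, v, hv⟩ ⟨n, e, he⟩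
    R := Corr.centralHom _ _ (φ.symm.sum_tmul_central hv)
    Rbar := Corr.centralHom _ _ (φ.sum_tmul_central he)
    conj_obj := conjugate_equation _ _ rfl _ _ _ fun x =>
      (Finset.sum_congr rfl fun j _ => congrArg (· • φ.inv (v j)) (φ.ip_sum_tmul he x _)).trans
        (φ.left_frame hv x)
    conj_dual := conjugate_equation (X := K') _ _ rfl _ _ _ fun x =>
      (Finset.sum_congr rfl fun j _ =>
        congrArg (· • φ.map (e j)) (φ.symm.ip_sum_tmul hv x _)).trans
          (φ.symm.left_frame he x) }⟩

/-- By the first conjugate equation `⟨x, x⟩` is, up to reassociation, the inner product of `R̄(1) ⊗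
x` with `x ⊗ R(1)`. Cauchy-Schwarz yields `‖x‖² ≤ ‖R̄(1)‖ ‖R(1)‖ ‖x‖²`. -/
lemma one_le_of_conjugateSolution [Nontrivial A] {X : BimFgp A} {x : X.obj} (hx : x ≠ 0)
    (s : ConjugateSolution X) : 1 ≤ ‖Corr.op' s.R‖ * ‖Corr.op' s.Rbar‖ := by
  have h1 : ∀ {E : Corr A} (f : 𝟙_ (Corr A) ⟶ E), ‖f (Corr.toUnit 1)‖ ≤ ‖Corr.op' f‖ := fun f => by
    have := Corr.norm_apply_le f (Corr.toUnit 1)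
    rwa [Corr.norm_toUnit_one, mul_one] at this
  set t : (X.obj ⊗ s.dual.obj ⊗ X.obj : Corr A) := Corr.tmul x (s.R (Corr.toUnit 1)) with ht
  have htn : ‖t‖ ≤ ‖x‖ * ‖s.R (Corr.toUnit 1)‖ := Corr.norm_tmul_le _ _
  set z := (α_ X.obj s.dual.obj X.obj).inv t with hzt
  have hz : ‖z‖ = ‖t‖ := by
    rw [← (Corr.associator_isUnitary _ _ _).norm, hzt, ← Corr.comp_apply, Iso.inv_hom_id,
      Corr.id_apply]
  have h2 := congrArg (fun f : X.obj ⟶ X.obj => f x) s.conj_obj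
  simp only [Corr.comp_apply, Corr.id_apply] at h2
  rw [Corr.rightUnitor_inv_apply, Corr.whiskerLeft_tmul, ← ht, ← hzt] at h2
  have h3 : X.obj.ip x x =
      ((X.obj ⊗ s.dual.obj) ⊗ X.obj : Corr A).ip (Corr.tmul (s.Rbar (Corr.toUnit 1)) x) z := by
    nth_rewrite 2 [← h2]
    nth_rewrite 1 [← Corr.leftUnitor_one_tmul X.obj x]
    rw [(Corr.leftUnitor_isUnitary _).ip, ← Corr.adj_whiskerRight, ← Corr.ip_adj,
      Corr.whiskerRight_tmul]
  have h4 : ‖x‖ ^ 2 ≤ ‖s.Rbar (Corr.toUnit 1)‖ * ‖x‖ * (‖x‖ * ‖s.R (Corr.toUnit 1)‖) := by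
    rw [X.obj.norm_sq, h3]
    refine (Corr.norm_ip_le _ _ _).trans ?_
    rw [hz]
    exact mul_le_mul (Corr.norm_tmul_le _ _) htn (norm_nonneg _) (by positivity)
  have hx2 : 0 < ‖x‖ ^ 2 := by positivity
  have h5 : ‖x‖ ^ 2 * 1 ≤ ‖x‖ ^ 2 * (‖s.R (Corr.toUnit 1)‖ * ‖s.Rbar (Corr.toUnit 1)‖) := by
    rw [mul_one]
    exact h4.trans_eq (by ring)
  exact (le_of_mul_le_mul_left h5 hx2).trans
    (mul_le_mul (h1 _) (h1 _) (norm_nonneg _) (norm_nonneg _))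

lemma bddBelow_conjugateSolution (X : BimFgp A) :
    BddBelow (Set.range fun s : ConjugateSolution X => ‖Corr.op' s.R‖ * ‖Corr.op' s.Rbar‖) :=
  ⟨0, by rintro _ ⟨s, rfl⟩; positivity⟩

lemma one_le_dim [Nontrivial A] {X : BimFgp A} (hX : IsIrreducible X.obj) : 1 ≤ dim X := by
  obtain ⟨x, hx⟩ := Corr.exists_ne_zero_of_irreducible hX
  have := nonempty_conjugateSolution X
  exact le_ciInf (one_le_of_conjugateSolution hx)

/-- A bimodule endomorphism of `A` is determined by its value at `1`, which is central and hence
scalar. -/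
lemma irreducible_unit [Nontrivial A] (hA : TrivialCenter A) : IsIrreducible (𝟙_ (Corr A)) := by
  refine ⟨fun h => ?_, fun f => ?_⟩
  · have := congrArg (fun f : 𝟙_ (Corr A) ⟶ 𝟙_ (Corr A) => f (Corr.toUnit 1)) h
    exact one_ne_zero (α := A) this
  · obtain ⟨c, hc⟩ := hA (show A from f (Corr.toUnit 1)) fun a => by
      have h1 : f (Corr.toUnit a) = a • f (Corr.toUnit 1) := by
        rw [← Corr.map_lsmul, ← Corr.toUnit_eq]
      have h2 : f (Corr.toUnit a) = op a • f (Corr.toUnit 1) := by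
        rw [← Corr.map_rsmul]
        congr 1
        exact (one_mul a).symm
      exact h1.symm.trans h2
    refine ⟨c, Corr.unit_hom_ext ?_⟩
    refine hc.symm.trans ?_
    rw [Algebra.algebraMap_eq_smul_one]
    rfl

/-- An irreducible object isomorphic to the unit has dimension one. -/
lemma dim_eq_one [Nontrivial A] (hA : TrivialCenter A) {X : BimFgp A} (hX : IsIrreducible X.obj)
    {f : X.obj ⟶ 𝟙_ (Corr A)} (hf : f ≠ 0) : dim X = 1 := by
  obtain ⟨c, _, hu⟩ := Corr.exists_unitary_of_irreducible hX (irreducible_unit hA) hf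
  set u := c • f
  set w := Corr.adj u (Corr.toUnit 1) with hw
  have huw : u w = Corr.toUnit 1 := congrArg (fun g => Corr.op' g (Corr.toUnit 1)) hu.2
  have hwu : ∀ x, Corr.adj u (u x) = x := fun x => congrArg (fun g => Corr.op' g x) hu.1
  have hip : ∀ x, X.obj.ip w x = (show A from u x) := fun x => by
    rw [hw, Corr.adj_ip]
    change star (1 : A) * (show A from u x) = _
    rw [star_one, one_mul]
  have hwc : ∀ a : A, a • w = op a • w := fun a => by
    rw [hw, ← Corr.map_lsmul, ← Corr.map_rsmul, ← Corr.toUnit_eq]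
    congr 1
    exact (one_mul a).symm
  have hnw : ‖w‖ = 1 := by
    rw [← hu.norm, huw, Corr.norm_toUnit_one]
  have hux : ∀ x, (show A from u x) • w = x := fun x => by
    rw [hw, ← Corr.map_lsmul, ← Corr.toUnit_eq]
    exact hwu x
  have h1 : ∀ a : A, a • (Corr.tmul (Corr.toUnit 1) w : (𝟙_ (Corr A) ⊗ X.obj : Corr A)) =
      op a • (Corr.tmul (Corr.toUnit 1) w : (𝟙_ (Corr A) ⊗ X.obj : Corr A)) := fun a => by
    refine (Corr.lsmul_tmul _ _ _).trans ((Corr.rsmul_tmul _ _ _).trans ?_).symm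
    rw [← hwc, Corr.tmul_lsmul]
    congr 1
    exact (one_mul a).trans (mul_one a).symm
  have h2 : ∀ a : A, a • (Corr.tmul w (Corr.toUnit 1) : (X.obj ⊗ 𝟙_ (Corr A) : Corr A)) =
      op a • (Corr.tmul w (Corr.toUnit 1) : (X.obj ⊗ 𝟙_ (Corr A) : Corr A)) := fun a => by
    refine (Corr.lsmul_tmul _ _ _).trans ((Corr.rsmul_tmul _ _ _).trans ?_).symm
    rw [hwc, ← Corr.tmul_lsmul]
    congr 1
    exact (one_mul a).trans (mul_one a).symm
  -- The vector `w = u*(1)` is central, has norm one and generates `X`. With `A` as dual, `1 ⊗ w`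
  -- and `w ⊗ 1` solve the conjugate equations with operators of norm at most `1`.
  let s : ConjugateSolution X :=
    { dual := BimFgp.unit A
      R := Corr.centralHom (𝟙_ (Corr A) ⊗ X.obj) (Corr.tmul (Corr.toUnit 1) w) h1
      Rbar := Corr.centralHom (X.obj ⊗ 𝟙_ (Corr A)) (Corr.tmul w (Corr.toUnit 1)) h2
      conj_obj := conjugate_equation (fun _ : Unit => Corr.toUnit 1) (fun _ => w)
        (Fintype.sum_unique _).symm _ _ _ fun x => by
          rw [Fintype.sum_unique]
          conv_rhs => rw [← hux x]
          congr 1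
          refine (Corr.ip_tmul _ _ _ _).trans ?_
          rw [hip]
          change star (1 : A) * ((show A from u x) * (1 : A)) = _
          rw [star_one, one_mul, mul_one]
      conj_dual := conjugate_equation (X := 𝟙_ (Corr A)) (fun _ : Unit => w)
        (fun _ => Corr.toUnit 1) (Fintype.sum_unique _).symm _ _ _ fun d => by
          rw [Fintype.sum_unique]
          refine Eq.trans ?_ (Corr.toUnit_eq (show A from d)).symm
          congr 1
          refine (Corr.ip_tmul _ _ _ _).trans ?_
          rw [hip, Corr.map_lsmul, huw]
          change ((star (1 : A) * (show A from d)) * (1 : A)) = _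
          rw [star_one, one_mul, mul_one] }
  refine le_antisymm ((ciInf_le (bddBelow_conjugateSolution X) s).trans ?_) (one_le_dim hX)
  exact mul_le_one₀
    ((Corr.norm_centralHom_le _ _ h1).trans
      ((Corr.norm_tmul_le _ _).trans (by rw [hnw, Corr.norm_toUnit_one, one_mul])))
    (norm_nonneg _)
    ((Corr.norm_centralHom_le _ _ h2).trans
      ((Corr.norm_tmul_le _ _).trans (by rw [hnw, Corr.norm_toUnit_one, one_mul])))

end CStarCorr

namespace CStarCorr

variable {A : Type u} [CStarAlgebra A] [PartialOrder A] [StarOrderedRing A]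

/-! ### The categorical trace -/

namespace IrrSystem

variable (S : IrrSystem A)

/-- The scalar of an endomorphism of an irreducible object. -/
def scal (i : S.ι) (f : (S.obj i).obj ⟶ (S.obj i).obj) : ℂ := ((S.irreducible i).2 f).choose

variable {S} {i j : S.ι}

lemma scal_spec (f : (S.obj i).obj ⟶ (S.obj i).obj) : f = S.scal i f • 𝟙 _ :=
  ((S.irreducible i).2 f).choose_spec

lemma scal_eq {f : (S.obj i).obj ⟶ (S.obj i).obj} {c : ℂ} (h : f = c • 𝟙 _) : S.scal i f = c :=
  smul_left_injective ℂ (S.irreducible i).1 ((scal_spec f).symm.trans h)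

lemma scal_zero : S.scal i 0 = 0 := scal_eq (zero_smul ℂ _).symm

lemma scal_smul_id (c : ℂ) : S.scal i (c • 𝟙 _) = c := scal_eq rfl

lemma scal_add (f g : (S.obj i).obj ⟶ (S.obj i).obj) :
    S.scal i (f + g) = S.scal i f + S.scal i g :=
  scal_eq (by rw [add_smul, ← scal_spec, ← scal_spec])

lemma scal_smul (c : ℂ) (f : (S.obj i).obj ⟶ (S.obj i).obj) :
    S.scal i (c • f) = c * S.scal i f := scal_eq (by rw [mul_smul, ← scal_spec])

lemma scal_sum {α : Type*} (s : Finset α) (f : α → ((S.obj i).obj ⟶ (S.obj i).obj)) :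
    S.scal i (∑ a ∈ s, f a) = ∑ a ∈ s, S.scal i (f a) :=
  scal_eq (by rw [Finset.sum_smul]; exact Finset.sum_congr rfl fun a _ => scal_spec (f a))

lemma scal_adj (f : (S.obj i).obj ⟶ (S.obj i).obj) :
    S.scal i (Corr.adj f) = star (S.scal i f) :=
  scal_eq (by
    conv_lhs => rw [scal_spec f]
    rw [Corr.adj_smul, Corr.adj_id])

/-- For distinct indices both composites vanish by disjointness, and for equal indices the morphisms
are scalars. This is the source of all cyclicity of the trace; any weight depending only on the
index would serve. -/
lemma scal_comp_comm (f : (S.obj i).obj ⟶ (S.obj j).obj) (g : (S.obj j).obj ⟶ (S.obj i).obj) :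
    (dim (S.obj i) : ℂ) * S.scal i (f ≫ g) = dim (S.obj j) * S.scal j (g ≫ f) := by
  by_cases h : i = j
  · subst h
    rw [scal_spec f, Linear.smul_comp, Linear.comp_smul, Category.id_comp, Category.comp_id]
  · rw [S.disjoint i j h f, Limits.zero_comp, Limits.comp_zero, scal_zero, scal_zero, mul_zero,
      mul_zero]

/-- The squared norm of a multiple of an isometry. -/
def sqn {E : Corr A} (f : (S.obj i).obj ⟶ E) : ℝ := (S.scal i (f ≫ Corr.adj f)).re

lemma scal_comp_adj {E : Corr A} (f : (S.obj i).obj ⟶ E) :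
    S.scal i (f ≫ Corr.adj f) = sqn f := by
  refine (Complex.conj_eq_iff_re.mp ?_).symm
  rw [starRingEnd_apply, ← scal_adj, Corr.adj_comp, Corr.adj_adj]

/-- A morphism out of an irreducible object is a multiple of an isometry, so its size is visible on
any single nonzero vector. -/
lemma norm_apply_sq {E : Corr A} (f : (S.obj i).obj ⟶ E) (x : (S.obj i).obj) :
    ‖f x‖ ^ 2 = sqn f * ‖x‖ ^ 2 := by
  by_cases hf : f = 0
  · rw [hf, sqn, Limits.zero_comp, scal_zero, Corr.zero_apply, norm_zero]; simp
  obtain ⟨r, hr, h⟩ := Corr.exists_pos_of_irreducible (S.irreducible i) hf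
  have h' : sqn f = r := by rw [sqn, scal_eq h, Complex.ofReal_re]
  rw [h', E.norm_sq, Corr.ip_map_map, h, Corr.smul_apply, Corr.id_apply,
    (S.obj i).obj.isSemiInner.smul_right, norm_smul, ← (S.obj i).obj.norm_sq, Complex.norm_real,
    Real.norm_of_nonneg hr.le]

lemma exists_norm_pos (i : S.ι) : ∃ x : (S.obj i).obj, 0 < ‖x‖ ^ 2 := by
  obtain ⟨x, hx⟩ := Corr.exists_ne_zero_of_irreducible (S.irreducible i)
  exact ⟨x, by positivity⟩

lemma sqn_nonneg {E : Corr A} (f : (S.obj i).obj ⟶ E) : 0 ≤ sqn f := by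
  obtain ⟨x, hx⟩ := exists_norm_pos i
  exact nonneg_of_mul_nonneg_left (norm_apply_sq f x ▸ sq_nonneg _) hx

lemma eq_zero_of_sqn {E : Corr A} {f : (S.obj i).obj ⟶ E} (h : sqn f = 0) : f = 0 :=
  Corr.hom_ext fun x => by
    have := norm_apply_sq f x
    rw [h, zero_mul, sq_eq_zero_iff, norm_eq_zero] at this
    exact this

lemma sqn_comp_le {E F : Corr A} (f : (S.obj i).obj ⟶ E) (T : E ⟶ F) :
    sqn (f ≫ T) ≤ ‖Corr.op' T‖ ^ 2 * sqn f := by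
  obtain ⟨x, hx⟩ := exists_norm_pos i
  refine le_of_mul_le_mul_right ?_ hx
  rw [mul_assoc, ← norm_apply_sq, ← norm_apply_sq, ← mul_pow]
  exact pow_le_pow_left₀ (norm_nonneg _) (Corr.norm_apply_le T (f x)) 2

end IrrSystem

open IrrSystem

namespace Decomp

variable {S : IrrSystem A}

/-- The decomposition of an irreducible object. -/
def single (S : IrrSystem A) (i : S.ι) : Decomp S (S.obj i).obj where
  ν := Unit
  idx _ := i
  f _ := 𝟙 _
  sum_eq := by rw [Fintype.sum_unique, Corr.adj_id, Category.id_comp]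

lemma sum_comp {X E : Corr A} (D : Decomp S X) (g : X ⟶ E) :
    ∑ a, Corr.adj (D.f a) ≫ D.f a ≫ g = g := by
  conv_rhs => rw [← Category.id_comp g, ← D.sum_eq, Preadditive.sum_comp]
  exact Finset.sum_congr rfl fun a _ => (Category.assoc _ _ _).symm

lemma hom_ext {X E : Corr A} (D : Decomp S X) {g g' : X ⟶ E}
    (h : ∀ a, D.f a ≫ g = D.f a ≫ g') : g = g' := by
  rw [← D.sum_comp g, ← D.sum_comp g']
  exact Finset.sum_congr rfl fun a _ => by rw [h]

/-- The categorical trace. -/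
def trace {X : Corr A} (D : Decomp S X) (T : X ⟶ X) : ℂ :=
  ∑ a, (dim (S.obj (D.idx a)) : ℂ) * S.scal _ (D.f a ≫ T ≫ Corr.adj (D.f a))

/-- Inserting the decomposition of the middle object turns both traces into double sums over matrix
entries between irreducibles, where `scal_comp_comm` applies termwise. -/
lemma trace_comm {X Y : Corr A} (D : Decomp S X) (E : Decomp S Y) (u : X ⟶ Y) (v : Y ⟶ X) :
    D.trace (u ≫ v) = E.trace (v ≫ u) := by
  have key : ∀ {X Y : Corr A} (D : Decomp S X) (E : Decomp S Y) (u : X ⟶ Y) (v : Y ⟶ X),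
      D.trace (u ≫ v) = ∑ a, ∑ b, (dim (S.obj (D.idx a)) : ℂ) *
        S.scal _ ((D.f a ≫ u ≫ Corr.adj (E.f b)) ≫ (E.f b ≫ v ≫ Corr.adj (D.f a))) :=
    fun D E u v => Finset.sum_congr rfl fun a _ => by
      rw [← Finset.mul_sum, ← scal_sum]
      congr 2
      conv_lhs => rw [Category.assoc, ← E.sum_comp (v ≫ Corr.adj (D.f a))]
      rw [Preadditive.comp_sum, Preadditive.comp_sum]
      exact Finset.sum_congr rfl fun b _ => by simp only [Category.assoc]
  rw [key D E, key E D, Finset.sum_comm]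
  exact Finset.sum_congr rfl fun b _ => Finset.sum_congr rfl fun a _ => scal_comp_comm _ _

/-- Cyclicity with one factor the identity, read with a different decomposition on each side: the
trace does not depend on the decomposition. -/
lemma trace_eq {X : Corr A} (D E : Decomp S X) (T : X ⟶ X) : D.trace T = E.trace T := by
  have := trace_comm D E T (𝟙 X)
  rwa [Category.comp_id, Category.id_comp] at this

lemma trace_single (i : S.ι) (T : (S.obj i).obj ⟶ (S.obj i).obj) :
    (single S i).trace T = dim (S.obj i) * S.scal i T := by
  refine (Fintype.sum_unique (ι := Unit) fun _ =>
    (dim (S.obj i) : ℂ) * S.scal i (𝟙 _ ≫ T ≫ Corr.adj (𝟙 _))).trans ?_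
  rw [Corr.adj_id, Category.comp_id, Category.id_comp]

lemma trace_add {X : Corr A} (D : Decomp S X) (T U : X ⟶ X) :
    D.trace (T + U) = D.trace T + D.trace U := by
  simp only [trace, Preadditive.add_comp, Preadditive.comp_add, scal_add, mul_add,
    Finset.sum_add_distrib]

lemma trace_smul {X : Corr A} (D : Decomp S X) (c : ℂ) (T : X ⟶ X) :
    D.trace (c • T) = c * D.trace T := by
  simp only [trace, Linear.smul_comp, Linear.comp_smul, scal_smul, Finset.mul_sum]
  exact Finset.sum_congr rfl fun a _ => by ring

lemma trace_adj {X : Corr A} (D : Decomp S X) (T : X ⟶ X) :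
    D.trace (Corr.adj T) = star (D.trace T) := by
  rw [trace, trace, star_sum]
  refine Finset.sum_congr rfl fun a _ => ?_
  rw [star_mul', Complex.star_def, Complex.conj_ofReal, ← Complex.star_def, ← scal_adj]
  simp only [Corr.adj_comp, Corr.adj_adj, Category.assoc]

/-- The squared Hilbert-Schmidt norm. -/
def hs {X E : Corr A} (D : Decomp S X) (f : X ⟶ E) : ℝ :=
  ∑ a, dim (S.obj (D.idx a)) * sqn (D.f a ≫ f)

lemma trace_comp_adj {X E : Corr A} (D : Decomp S X) (f : X ⟶ E) :
    D.trace (f ≫ Corr.adj f) = D.hs f := by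
  rw [hs, Complex.ofReal_sum]
  refine Finset.sum_congr rfl fun a _ => ?_
  rw [Complex.ofReal_mul, ← scal_comp_adj, Corr.adj_comp]
  simp only [Category.assoc]

variable [Nontrivial A]

lemma _root_.CStarCorr.IrrSystem.dim_pos (S : IrrSystem A) (i : S.ι) : 0 < dim (S.obj i) :=
  one_pos.trans_le (one_le_dim (S.irreducible i))

lemma hs_term_nonneg {X E : Corr A} (D : Decomp S X) (f : X ⟶ E) (a : D.ν) :
    0 ≤ dim (S.obj (D.idx a)) * sqn (D.f a ≫ f) :=
  mul_nonneg (S.dim_pos _).le (sqn_nonneg _)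

lemma hs_nonneg {X E : Corr A} (D : Decomp S X) (f : X ⟶ E) : 0 ≤ D.hs f :=
  Finset.sum_nonneg fun a _ => D.hs_term_nonneg f a

lemma eq_zero_of_hs {X E : Corr A} (D : Decomp S X) {f : X ⟶ E} (h : D.hs f = 0) : f = 0 :=
  D.hom_ext fun a => by
    have := (Finset.sum_eq_zero_iff_of_nonneg fun a _ => D.hs_term_nonneg f a).mp h a
      (Finset.mem_univ a)
    rw [eq_zero_of_sqn ((mul_eq_zero.mp this).resolve_left (S.dim_pos _).ne'), Limits.comp_zero]

lemma hs_comp_le {X E F : Corr A} (D : Decomp S X) (f : X ⟶ E) (T : E ⟶ F) :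
    D.hs (f ≫ T) ≤ ‖Corr.op' T‖ ^ 2 * D.hs f := by
  rw [hs, hs, Finset.mul_sum]
  refine Finset.sum_le_sum fun a _ => ?_
  rw [← Category.assoc, mul_left_comm]
  exact mul_le_mul_of_nonneg_left (sqn_comp_le _ _) (S.dim_pos _).le

/-- Together with `exists_norm_le_hs` this makes the Hilbert-Schmidt and operator norms on `Hom(X,
E)` equivalent, with constants depending only on the decomposition of `X`. -/
lemma exists_hs_le {X : Corr A} (D : Decomp S X) : ∃ C : ℝ, 0 ≤ C ∧ ∀ {E : Corr A} (f : X ⟶ E),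
    D.hs f ≤ C * ‖Corr.op' f‖ ^ 2 := by
  refine ⟨D.hs (𝟙 X), D.hs_nonneg _, fun f => ?_⟩
  have := D.hs_comp_le (𝟙 X) f
  rwa [Category.id_comp, mul_comm] at this

lemma exists_norm_le_hs {X : Corr A} (D : Decomp S X) : ∃ C : ℝ, 0 ≤ C ∧
    ∀ {E : Corr A} (f : X ⟶ E), ‖Corr.op' f‖ ≤ C * √(D.hs f) := by
  have hC : 0 ≤ ∑ a, √(dim (S.obj (D.idx a)))⁻¹ * ‖Corr.op' (Corr.adj (D.f a))‖ := by positivity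
  refine ⟨_, hC, fun f => ContinuousLinearMap.opNorm_le_bound _ (by positivity) fun x => ?_⟩
  conv_lhs => rw [← D.sum_apply x, map_sum]
  rw [Finset.sum_mul, Finset.sum_mul]
  refine (norm_sum_le _ _).trans (Finset.sum_le_sum fun a _ => ?_)
  have h1 : ‖(D.f a ≫ f) (Corr.adj (D.f a) x)‖ =
      √(sqn (D.f a ≫ f)) * ‖Corr.adj (D.f a) x‖ := by
    rw [← Real.sqrt_sq (norm_nonneg ((D.f a ≫ f) _)), norm_apply_sq,
      Real.sqrt_mul (sqn_nonneg _), Real.sqrt_sq (norm_nonneg _)]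
  have h2 : √(sqn (D.f a ≫ f)) ≤ √(dim (S.obj (D.idx a)))⁻¹ * √(D.hs f) := by
    rw [← Real.sqrt_mul (inv_nonneg.mpr (S.dim_pos _).le)]
    refine Real.sqrt_le_sqrt ?_
    rw [le_inv_mul_iff₀ (S.dim_pos _)]
    exact Finset.single_le_sum (fun a _ => D.hs_term_nonneg f a) (Finset.mem_univ a)
  refine h1.le.trans ((mul_le_mul h2 (Corr.norm_apply_le _ x) (norm_nonneg _)
    (by positivity)).trans_eq (by ring))

end Decomp

end CStarCorr

namespace CStarCorr

variable {A : Type u} [CStarAlgebra A] [PartialOrder A] [StarOrderedRing A]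
  [Nontrivial A] [Fact (TrivialCenter A)]

open IrrSystem

/-! ### The Hilbert space object represented by a correspondence -/

/-- A decomposition of an object of `Bim_fgp(A)`. -/
def IrrSystem.dec (S : IrrSystem A) (X : BimFgp A) : Decomp S X.obj :=
  (nonempty_decomp Fact.out S X).some

/-- The space of morphisms `X ⟶ E`, with the trace inner product. -/
def GammaObj (_ : IrrSystem A) (E : Corr A) (X : BimFgp A) : Type u := X.obj ⟶ E

namespace GammaObj

variable {S : IrrSystem A} {E : Corr A} {X : BimFgp A}

instance : AddCommGroup (GammaObj S E X) := inferInstanceAs (AddCommGroup (X.obj ⟶ E))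
instance : Module ℂ (GammaObj S E X) := inferInstanceAs (Module ℂ (X.obj ⟶ E))

/-- The morphism underlying an element. -/
def hom (f : GammaObj S E X) : X.obj ⟶ E := f

variable (S) in
/-- The element defined by a morphism. -/
def of (f : X.obj ⟶ E) : GammaObj S E X := f

abbrev core : InnerProductSpace.Core ℂ (GammaObj S E X) where
  inner f g := (S.dec X).trace (g.hom ≫ Corr.adj f.hom)
  conj_inner_symm f g := by
    rw [starRingEnd_apply, ← Decomp.trace_adj, Corr.adj_comp, Corr.adj_adj]
  re_inner_nonneg f := by
    rw [Decomp.trace_comp_adj]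
    exact (S.dec X).hs_nonneg _
  add_left f g h := by
    rw [← Decomp.trace_add, ← Preadditive.comp_add, ← Corr.adj_add]
    rfl
  smul_left f g c := by
    rw [starRingEnd_apply, ← Decomp.trace_smul, ← Linear.comp_smul, ← Corr.adj_smul]
    rfl
  definite f h := by
    rw [Decomp.trace_comp_adj] at h
    exact (S.dec X).eq_zero_of_hs (by exact_mod_cast h)

instance : NormedAddCommGroup (GammaObj S E X) :=
  core.toNormedAddCommGroup
instance : InnerProductSpace ℂ (GammaObj S E X) :=
  InnerProductSpace.ofCore core.toCore

lemma inner_def (f g : GammaObj S E X) :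
    ⟪f, g⟫_ℂ = (S.dec X).trace (g.hom ≫ Corr.adj f.hom) := rfl

lemma norm_eq (f : GammaObj S E X) : ‖f‖ = √((S.dec X).hs f.hom) := by
  rw [norm_eq_sqrt_re_inner (𝕜 := ℂ), inner_def, Decomp.trace_comp_adj]
  rfl

variable (S E X) in
lemma exists_norm_le_op : ∃ C : ℝ, 0 ≤ C ∧ ∀ f : GammaObj S E X, ‖f‖ ≤ C * ‖Corr.op' f.hom‖ := by
  obtain ⟨C, hC, h⟩ := (S.dec X).exists_hs_le
  refine ⟨√C, Real.sqrt_nonneg _, fun f => ?_⟩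
  rw [norm_eq, ← Real.sqrt_sq (norm_nonneg (Corr.op' f.hom)), ← Real.sqrt_mul hC]
  exact Real.sqrt_le_sqrt (h _)

variable (S E X) in
lemma exists_op_le_norm : ∃ C : ℝ, 0 ≤ C ∧ ∀ f : GammaObj S E X, ‖Corr.op' f.hom‖ ≤ C * ‖f‖ := by
  obtain ⟨C, hC, h⟩ := (S.dec X).exists_norm_le_hs
  exact ⟨C, hC, fun f => (h _).trans_eq (by rw [norm_eq])⟩

variable (S E X) in
/-- The underlying operator as a continuous linear function. -/
def opL : GammaObj S E X →L[ℂ] X.obj →L[ℂ] E :=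
  LinearMap.mkContinuousOfExistsBound
    { toFun := fun f => Corr.op' f.hom
      map_add' := fun _ _ => rfl
      map_smul' := fun _ _ => rfl } ((exists_op_le_norm S E X).imp fun _ h => h.2)

/-- By equivalence of norms, a Cauchy sequence converges in operator norm to a bounded bimodule map.
The finite frame of `X` makes this limit adjointable. -/
instance : CompleteSpace (GammaObj S E X) := by
  refine Metric.complete_of_cauchySeq_tendsto fun u hu => ?_
  obtain ⟨T, hT⟩ := cauchySeq_tendsto_of_complete ((opL S E X).uniformContinuous.comp_cauchySeq hu)
  have hTx : ∀ x, Filter.Tendsto (fun n => (u n).hom x) Filter.atTop (nhds (T x)) := fun x =>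
    ((ContinuousLinearMap.apply ℂ E x).continuous.tendsto T).comp hT
  obtain ⟨n, e, he⟩ := X.exists_frame
  let t : X.obj ⟶ E := Corr.homOfFrame he T
    (fun a x => by
      refine tendsto_nhds_unique (hTx (a • x)) ?_
      simp only [Corr.map_lsmul]
      exact ((E.lsmulL a).continuous.tendsto _).comp (hTx x))
    (fun a x => by
      refine tendsto_nhds_unique (hTx (op a • x)) ?_
      simp only [Corr.map_rsmul]
      exact ((E.rsmulActL a).continuous.tendsto _).comp (hTx x))
  refine ⟨of S t, ?_⟩
  obtain ⟨C, hC, h⟩ := exists_norm_le_op S E X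
  rw [tendsto_iff_norm_sub_tendsto_zero] at hT ⊢
  refine squeeze_zero (fun _ => norm_nonneg _) (fun n => h (u n - of S t)) ?_
  rw [← mul_zero C]
  exact hT.const_mul C

end GammaObj

open GammaObj in
/-- The Hilbert space object `X ↦ Hom(X, E)`. -/
def Gamma (S : IrrSystem A) (E : Corr A) : HilbInd A where
  obj X := GammaObj S E X
  map X Y :=
    { toFun := fun f => LinearMap.mkContinuousOfExistsBound
        { toFun := fun g => of S (f ≫ g.hom)
          map_add' := fun _ _ => Preadditive.comp_add _ _ _ _ _ _
          map_smul' := fun _ _ => Linear.comp_smul _ _ _ _ _ _ } (by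
          obtain ⟨C, hC, h⟩ := exists_norm_le_op S E X
          obtain ⟨D, hD, h'⟩ := exists_op_le_norm S E Y
          refine ⟨C * ‖Corr.op' f‖ * D, fun g => ?_⟩
          refine (h _).trans ?_
          rw [mul_assoc, mul_assoc]
          refine mul_le_mul_of_nonneg_left ?_ hC
          refine (ContinuousLinearMap.opNorm_comp_le (Corr.op' g.hom) (Corr.op' f)).trans ?_
          rw [mul_comm]
          exact mul_le_mul_of_nonneg_left (h' g) (norm_nonneg _))
      map_add' := fun f f' => ContinuousLinearMap.ext fun g => Preadditive.add_comp _ _ _ f f' g.hom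
      map_smul' := fun c f => ContinuousLinearMap.ext fun g => Linear.smul_comp _ _ _ c f g.hom }
  map_id X := ContinuousLinearMap.ext fun g => Category.id_comp g.hom
  map_comp X Y Z f f' := ContinuousLinearMap.ext fun g => Category.assoc f f' g.hom
  -- Cyclicity of the trace says that precomposition with `f*` is adjoint to precomposition with
  -- `f`.
  map_adj X Y f := by
    rw [ContinuousLinearMap.eq_adjoint_iff]
    intro g h
    refine (inner_def _ _).trans (Eq.trans ?_ (inner_def _ _).symm)
    change (S.dec Y).trace (h.hom ≫ Corr.adj (Corr.adj f ≫ g.hom)) =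
      (S.dec X).trace ((f ≫ h.hom) ≫ Corr.adj g.hom)
    rw [Corr.adj_comp, Corr.adj_adj, ← Category.assoc, Decomp.trace_comm _ (S.dec X),
      Category.assoc]

namespace Gamma

open GammaObj

variable (S : IrrSystem A) {E F : Corr A}

lemma norm_comp_le {X : BimFgp A} (f : X.obj ⟶ E) (T : E ⟶ F) :
    ‖of S (f ≫ T)‖ ≤ ‖Corr.op' T‖ * ‖of S f‖ := by
  rw [norm_eq, norm_eq, ← Real.sqrt_sq (norm_nonneg (Corr.op' T)),
    ← Real.sqrt_mul (sq_nonneg _)]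
  exact Real.sqrt_le_sqrt (Decomp.hs_comp_le _ _ _)

/-- Postcomposition with a morphism. -/
def mapApp (T : E ⟶ F) (X : BimFgp A) : GammaObj S E X →L[ℂ] GammaObj S F X :=
  LinearMap.mkContinuous
    { toFun := fun g => of S (g.hom ≫ T)
      map_add' := fun _ _ => Preadditive.add_comp _ _ _ _ _ _
      map_smul' := fun _ _ => Linear.smul_comp _ _ _ _ _ _ }
    ‖Corr.op' T‖ (fun g => norm_comp_le S g.hom T)

lemma norm_mapApp_le (T : E ⟶ F) (X : BimFgp A) : ‖mapApp S T X‖ ≤ ‖Corr.op' T‖ :=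
  LinearMap.mkContinuous_norm_le _ (norm_nonneg _) _

/-- The functoriality of `Gamma`. -/
def map (T : E ⟶ F) : Gamma S E ⟶ Gamma S F :=
  ⟨mapApp S T, fun _ _ f => ContinuousLinearMap.ext fun g => Category.assoc f g.hom T,
    ‖Corr.op' T‖, norm_mapApp_le S T⟩

lemma inner_irr (i : S.ι) (f g : (S.obj i).obj ⟶ E) :
    ⟪of S f, of S g⟫_ℂ = dim (S.obj i) * S.scal i (g ≫ Corr.adj f) :=
  (inner_def _ _).trans ((Decomp.trace_eq _ (Decomp.single S i) _).trans
    (Decomp.trace_single i _))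

end Gamma

end CStarCorr

namespace CStarCorr

variable {A : Type u} [CStarAlgebra A] [PartialOrder A] [StarOrderedRing A]

open IrrSystem

/-! ### Morphisms into the realization -/

section Slice

variable (S : IrrSystem A) {H : HilbInd A}

/-- Elementary vectors as a continuous bilinear map. -/
def relemL (H : HilbInd A) (i : S.ι) : (S.obj i).obj →L[ℂ] H.obj (S.obj i) →L[ℂ] realObj S H := by
  have hext : ∀ {x y : realObj S H}, (∀ k h, (realObj S H).ip (relem S i k h) x =
      (realObj S H).ip (relem S i k h) y) → (∀ j ≠ i, ∀ k h, (realObj S H).ip (relem S j k h) x =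
      (realObj S H).ip (relem S j k h) y) → x = y := fun {x y} h1 h2 =>
    Corr.ip_ext_of_total (total_relem S H) fun ⟨j, k, h⟩ => by
      rw [← Corr.star_ip, ← (realObj S H).star_ip _ y]
      congr 1
      by_cases hj : j = i
      · subst hj; exact h1 k h
      · exact h2 j hj k h
  exact LinearMap.mkContinuous₂ (LinearMap.mk₂ ℂ (relem S i)
    (fun k k' h => hext (fun l m => by
        simp only [Corr.ip_add_right, ip_relem, smul_add])
      (fun j hj l m => by
        simp only [Corr.ip_add_right, ip_relem_ne S (Ne.symm hj), add_zero]))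
    (fun c k h => hext (fun l m => by
        simp only [ip_relem, (Corr.isSemiInner _).smul_right, smul_comm c])
      (fun j hj l m => by
        simp only [(Corr.isSemiInner _).smul_right, ip_relem_ne S (Ne.symm hj), smul_zero]))
    (fun k h h' => hext (fun l m => by
        simp only [Corr.ip_add_right, ip_relem, inner_add_right, add_smul])
      (fun j hj l m => by
        simp only [Corr.ip_add_right, ip_relem_ne S (Ne.symm hj), add_zero]))
    (fun c k h => hext (fun l m => by
        simp only [ip_relem, (Corr.isSemiInner _).smul_right, inner_smul_right, mul_smul])
      (fun j hj l m => by
        simp only [(Corr.isSemiInner _).smul_right, ip_relem_ne S (Ne.symm hj), smul_zero])))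
    1 (fun k h => by rw [one_mul]; exact (norm_relem S i k h).le)

lemma relemL_apply (i : S.ι) (k : (S.obj i).obj) (h : H.obj (S.obj i)) :
    relemL S H i k h = relem S i k h := rfl

/-- The morphism `k ↦ d ^ (-1/2) k ⊗ h`. -/
def slice (i : S.ι) (h : H.obj (S.obj i)) : (S.obj i).obj ⟶ realObj S H :=
  -- The identity of `K` has squared norm `d_K` for the trace inner product, so the factor
  -- `d_K^(-1/2)` makes `h ↦ slice S i h` isometric.
  ((√(dim (S.obj i)) : ℂ)⁻¹) • Corr.homOfFrame (S.obj i).exists_frame.choose_spec.choose_spec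
    ((relemL S H i).flip h)
    (fun a k => ((realKernel S H).lsmul_elem a ⟨i, k, h⟩).symm)
    (fun a k => ((realKernel S H).rsmul_elem a ⟨i, k, h⟩).symm)

lemma slice_apply (i : S.ι) (h : H.obj (S.obj i)) (k : (S.obj i).obj) :
    slice S i h k = ((√(dim (S.obj i)) : ℂ)⁻¹) • relem S i k h := rfl

variable {S}

lemma slice_add (i : S.ι) (h h' : H.obj (S.obj i)) :
    slice S i (h + h') = slice S i h + slice S i h' := Corr.hom_ext fun k => by
  rw [Corr.add_apply, slice_apply, slice_apply, slice_apply, ← smul_add, ← relemL_apply, map_add]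
  rfl

lemma slice_smul (i : S.ι) (c : ℂ) (h : H.obj (S.obj i)) :
    slice S i (c • h) = c • slice S i h := Corr.hom_ext fun k => by
  rw [Corr.smul_apply, slice_apply, slice_apply, smul_comm c, ← relemL_apply, map_smul]
  rfl

lemma slice_zero (i : S.ι) : slice S i (0 : H.obj (S.obj i)) = 0 := by
  have := slice_smul (S := S) i 0 (0 : H.obj (S.obj i))
  rwa [zero_smul, zero_smul] at this

lemma slice_sum (i : S.ι) {α : Type*} (s : Finset α) (h : α → H.obj (S.obj i)) :
    slice S i (∑ a ∈ s, h a) = ∑ a ∈ s, slice S i (h a) := by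
  induction s using Finset.cons_induction with
  | empty => rw [Finset.sum_empty, Finset.sum_empty, slice_zero]
  | cons a s ha ih => rw [Finset.sum_cons, Finset.sum_cons, slice_add, ih]

/-- Slices are natural in the irreducible object. -/
lemma comp_slice {i j : S.ι} (v : (S.obj i).obj ⟶ (S.obj j).obj) (h : H.obj (S.obj j)) :
    v ≫ slice S j h = slice S i (H.map _ _ v h) := by
  by_cases hij : i = j
  · subst hij
    rw [scal_spec v, Linear.smul_comp, Category.id_comp, map_smul, H.map_id,
      _root_.smul_apply, slice_smul]
    rfl
  · rw [S.disjoint i j hij v, map_zero, Limits.zero_comp, _root_.zero_apply,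
      slice_zero]

lemma slice_realMap {G : HilbInd A} (η : H ⟶ G) (i : S.ι) (h : H.obj (S.obj i)) :
    slice S i h ≫ realMap S η = slice S i (HilbInd.app η _ h) := Corr.hom_ext fun k => by
  rw [Corr.comp_apply, slice_apply, slice_apply, map_smul, realMap_relem]

variable [Nontrivial A]

lemma sqrt_dim_ne_zero (i : S.ι) : (√(dim (S.obj i)) : ℂ) ≠ 0 := by
  exact_mod_cast (Real.sqrt_pos.mpr (S.dim_pos i)).ne'

lemma relem_eq (i : S.ι) (h : H.obj (S.obj i)) (k : (S.obj i).obj) :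
    relem S i k h = (√(dim (S.obj i)) : ℂ) • slice S i h k := by
  rw [slice_apply, smul_smul, mul_inv_cancel₀ (sqrt_dim_ne_zero i), one_smul]

lemma dim_mul_inv_sqrt (i : S.ι) :
    (dim (S.obj i) : ℂ) * (star (√(dim (S.obj i)) : ℂ)⁻¹ * (√(dim (S.obj i)) : ℂ)⁻¹) = 1 := by
  rw [← Complex.ofReal_inv, Complex.star_def, Complex.conj_ofReal, ← Complex.ofReal_mul,
    ← Complex.ofReal_mul, ← mul_inv, Real.mul_self_sqrt (S.dim_pos i).le,
    mul_inv_cancel₀ (S.dim_pos i).ne', Complex.ofReal_one]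

lemma slice_comp_adj (i : S.ι) (h h' : H.obj (S.obj i)) :
    (dim (S.obj i) : ℂ) • (slice S i h' ≫ Corr.adj (slice S i h)) = ⟪h, h'⟫_ℂ • 𝟙 _ :=
  Corr.hom_ext fun k => (S.obj i).obj.ip_ext fun l => by
    rw [Corr.smul_apply, (Corr.isSemiInner _).smul_right, ← Corr.ip_map_map, slice_apply,
      slice_apply, (Corr.isSemiInner _).smul_right, (Corr.isSemiInner _).smul_left, ip_relem,
      smul_smul, smul_smul, mul_assoc, mul_comm (_)⁻¹ (star _), dim_mul_inv_sqrt, one_smul, Corr.smul_apply,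
      Corr.id_apply, (Corr.isSemiInner _).smul_right]

lemma scal_slice (i : S.ι) (h h' : H.obj (S.obj i)) :
    (dim (S.obj i) : ℂ) * S.scal i (slice S i h' ≫ Corr.adj (slice S i h)) = ⟪h, h'⟫_ℂ := by
  rw [← scal_smul, slice_comp_adj, scal_smul_id]

/-- Slices detect vectors. -/
lemma total_slice (H : HilbInd A) :
    Corr.Total (fun p : Elem S H => slice S p.1 p.2.2 p.2.1) := by
  intro z
  refine closure_mono ?_ (total_relem S H z)
  rintro _ ⟨v, rfl⟩
  rw [Finsupp.linearCombination_apply]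
  have hmem : (v.sum fun p c => c • relem S p.1 p.2.1 p.2.2) ∈
      LinearMap.range (Finsupp.linearCombination ℂ
        (fun p : Elem S H => slice S p.1 p.2.2 p.2.1)) :=
    Submodule.sum_mem _ fun p _ => Submodule.smul_mem _ _
      ⟨Finsupp.single p (√(dim (S.obj p.1)) : ℂ), by
        rw [Finsupp.linearCombination_single, ← relem_eq]⟩
  exact hmem

lemma real_hom_ext {E : Corr A} {f g : realObj S H ⟶ E}
    (h : ∀ i (x : H.obj (S.obj i)), slice S i x ≫ f = slice S i x ≫ g) : f = g :=
  Corr.hom_ext_of_total (total_slice H) fun p =>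
    congrArg (fun u : (S.obj p.1).obj ⟶ E => u p.2.1) (h p.1 p.2.2)

/-- The adjoint of `g` annihilates every slice: on other irreducibles by disjointness, on the `i`-th
one because the scalar vanishes. Slices are total, so `g* = 0`. -/
lemma eq_zero_of_slice {i : S.ι} {g : (S.obj i).obj ⟶ realObj S H}
    (h : ∀ x : H.obj (S.obj i), S.scal i (g ≫ Corr.adj (slice S i x)) = 0) : g = 0 := by
  refine Corr.eq_zero_of_adj (real_hom_ext fun j x => ?_)
  rw [Limits.comp_zero]
  by_cases hij : j = i
  · subst hij
    rw [← Corr.adj_adj (slice S j x), ← Corr.adj_comp, scal_spec (g ≫ _), h, zero_smul,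
      Corr.adj_zero]
  · exact S.disjoint j i hij _

end Slice

/-! ### Vectors of `H(X)` as morphisms `X ⟶ |H|` -/

section Hat

variable [Nontrivial A] [Fact (TrivialCenter A)] (S : IrrSystem A) {H G : HilbInd A}

/-- The morphism `X ⟶ |H|` corresponding to a vector of `H(X)`. -/
def hat (X : BimFgp A) (x : H.obj X) : X.obj ⟶ realObj S H :=
  ∑ a, Corr.adj ((S.dec X).f a) ≫ slice S _ (H.map (S.obj _) X ((S.dec X).f a) x)

variable {S}

lemma hat_add (X : BimFgp A) (x y : H.obj X) : hat S X (x + y) = hat S X x + hat S X y := by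
  simp only [hat, map_add, slice_add, Preadditive.comp_add, Finset.sum_add_distrib]

lemma hat_smul (X : BimFgp A) (c : ℂ) (x : H.obj X) : hat S X (c • x) = c • hat S X x := by
  simp only [hat, map_smul, slice_smul, Linear.comp_smul, Finset.smul_sum]

lemma sum_map_map {X : BimFgp A} (D : Decomp S X.obj) (x : H.obj X) :
    ∑ a, H.map X (S.obj _) (Corr.adj (D.f a)) (H.map (S.obj _) X (D.f a) x) = x := by
  have h := congrArg (fun T => H.map X X T x) D.sum_eq
  simp only [map_sum, H.map_id, _root_.sum_apply, H.map_comp _ (S.obj _) _,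
    ContinuousLinearMap.comp_apply] at h
  exact h

/-- `hat` is natural in the object of `Bim_fgp(A)`. -/
lemma comp_hat {W X : BimFgp A} (f : W.obj ⟶ X.obj) (x : H.obj X) :
    f ≫ hat S X x = hat S W (H.map W X f x) := by
  rw [← (S.dec W).sum_comp (f ≫ hat S X x)]
  conv_rhs => rw [hat]
  refine Finset.sum_congr rfl fun b _ => ?_
  congr 1
  rw [hat, Preadditive.comp_sum, Preadditive.comp_sum]
  -- Each `f_b ≫ f ≫ f_a*` runs between irreducibles, where `comp_slice` absorbs it into `H`.
  -- Summing over `a` then restores the identity of `X` under `H`.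
  have h : ∀ a, (S.dec W).f b ≫ f ≫ Corr.adj ((S.dec X).f a) ≫
      slice S _ (H.map (S.obj _) X ((S.dec X).f a) x) =
      slice S _ (H.map (S.obj _) W ((S.dec W).f b) (H.map W X f (H.map X (S.obj _)
        (Corr.adj ((S.dec X).f a)) (H.map (S.obj _) X ((S.dec X).f a) x)))) := fun a => by
    rw [← Category.assoc, ← Category.assoc, comp_slice, H.map_comp _ X, H.map_comp _ W]
    rfl
  rw [Finset.sum_congr rfl fun a _ => h a, ← slice_sum, ← map_sum, ← map_sum, sum_map_map]

lemma hat_irr (i : S.ι) (h : H.obj (S.obj i)) : hat S (S.obj i) h = slice S i h := by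
  rw [hat]
  have e : ∀ a, Corr.adj ((S.dec (S.obj i)).f a) ≫
      slice S _ (H.map (S.obj _) (S.obj i) ((S.dec (S.obj i)).f a) h) = _ := fun a =>
    comp_slice _ _
  rw [Finset.sum_congr rfl fun a _ => e a, ← slice_sum, sum_map_map]

/-- `hat` is natural in the Hilbert space object. -/
lemma hat_realMap (η : H ⟶ G) (X : BimFgp A) (x : H.obj X) :
    hat S X x ≫ realMap S η = hat S X (HilbInd.app η X x) := by
  rw [hat, hat, Preadditive.sum_comp]
  refine Finset.sum_congr rfl fun a _ => ?_
  rw [Category.assoc, slice_realMap]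
  congr 2
  exact congrArg (fun T => T x) (η.2.1 (S.obj _) X ((S.dec X).f a))

/-- Along each component `f_a` of `X` the morphism `hat` becomes a slice, whose normalization
cancels the weight in the trace. The terms add up to `⟪x, y⟫` because `H` preserves adjoints and the
decomposition of `𝟙`. -/
lemma trace_hat (X : BimFgp A) (x y : H.obj X) :
    (S.dec X).trace (hat S X y ≫ Corr.adj (hat S X x)) = ⟪x, y⟫_ℂ := by
  conv_rhs => rw [← sum_map_map (S.dec X) y, inner_sum]
  refine Finset.sum_congr rfl fun a _ => ?_
  rw [Category.assoc, ← Corr.adj_comp, ← Category.assoc, comp_hat, comp_hat, hat_irr, hat_irr, scal_slice,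
    H.map_adj, ContinuousLinearMap.adjoint_inner_right]

variable (S) in
/-- `hat` as a linear isometry. -/
def hatL (H : HilbInd A) (X : BimFgp A) : H.obj X →ₗᵢ[ℂ] GammaObj S (realObj S H) X :=
  LinearMap.isometryOfInner
    { toFun := fun x => GammaObj.of S (hat S X x)
      map_add' := hat_add X
      map_smul' := hat_smul X } fun x y => trace_hat X x y

/-- The range is complete, so it suffices that any `g` orthogonal to it vanishes. Testing `g`
against `f_a* ≫ slice x`, which lies in the range, and using cyclicity shows that `f_a ≫ g`
satisfies the hypothesis of `eq_zero_of_slice` for every component `f_a`. -/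
lemma hatL_surjective (H : HilbInd A) (X : BimFgp A) : Function.Surjective (hatL S H X) := by
  let R := (⊤ : Submodule ℂ (H.obj X)).map (hatL S H X).toLinearMap
  have hc : IsComplete (R : Set (GammaObj S (realObj S H) X)) :=
    ((hatL S H X).isComplete_map_iff).mpr (by
      rw [Submodule.top_coe]; exact isComplete_univ)
  have : CompleteSpace R := hc.completeSpace_coe
  have hR : R = ⊤ := R.orthogonal_eq_bot_iff.mp <| (Submodule.eq_bot_iff _).mpr fun g hg => by
    refine (S.dec X).hom_ext (g' := 0) fun a => ?_
    rw [Limits.comp_zero]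
    refine eq_zero_of_slice fun x => ?_
    have h := (Submodule.mem_orthogonal _ _).mp hg _ (Submodule.mem_map_of_mem
      (Submodule.mem_top (x := H.map X (S.obj _) (Corr.adj ((S.dec X).f a)) x)))
    have h1 : (S.dec X).trace (g.hom ≫ Corr.adj (hat S X
      (H.map X (S.obj _) (Corr.adj ((S.dec X).f a)) x))) = 0 := h
    rw [← comp_hat, hat_irr, Corr.adj_comp, Corr.adj_adj, ← Category.assoc,
      Decomp.trace_comm _ (Decomp.single S _), Decomp.trace_single] at h1
    have h2 := (mul_eq_zero.mp h1).resolve_left (by exact_mod_cast (S.dim_pos _).ne')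
    rw [← Category.assoc] at h2
    exact h2
  intro g
  obtain ⟨x, -, hx⟩ := (hR ▸ Submodule.mem_top : g ∈ R)
  exact ⟨x, hx⟩

lemma hat_injective (X : BimFgp A) {x y : H.obj X} (h : hat S X x = hat S X y) : x = y :=
  (hatL S H X).injective h

variable (S) in
/-- Vectors of `H(X)` are morphisms `X ⟶ |H|`. -/
def hatE (H : HilbInd A) (X : BimFgp A) : H.obj X ≃ₗᵢ[ℂ] GammaObj S (realObj S H) X :=
  LinearIsometryEquiv.ofSurjective (hatL S H X) (hatL_surjective H X)

lemma hat_hatE_symm (X : BimFgp A) (g : X.obj ⟶ realObj S H) :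
    hat S X ((hatE S H X).symm (GammaObj.of S g)) = g :=
  (hatE S H X).apply_symm_apply (GammaObj.of S g)

/-! ### The realization is fully faithful -/

variable (S) in
/-- The preimage of a morphism under the realization. -/
def preimage (T : realObj S H ⟶ realObj S G) : H ⟶ G :=
  ⟨fun X => (((hatE S G X).symm : _ →L[ℂ] G.obj X).comp (Gamma.mapApp S T X)).comp
      (hatE S H X : H.obj X →L[ℂ] _), fun X Y f => ContinuousLinearMap.ext fun x => by
    refine hat_injective (S := S) X ?_
    change hat S X ((hatE S G X).symm (GammaObj.of S (hat S X (H.map X Y f x) ≫ T))) =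
      hat S X (G.map X Y f ((hatE S G Y).symm (GammaObj.of S (hat S Y x ≫ T))))
    rw [hat_hatE_symm, ← comp_hat, ← comp_hat, hat_hatE_symm, Category.assoc],
    -- Postcomposition with `T` increases the trace norm by at most the factor `‖T‖`, whatever `X`
    -- is; this is the uniform bound on the natural transformation.
    ‖Corr.op' T‖, fun X => by
      refine ContinuousLinearMap.opNorm_le_bound _ (norm_nonneg _) fun x => ?_
      change ‖(hatE S G X).symm (Gamma.mapApp S T X (hatE S H X x))‖ ≤ _
      rw [LinearIsometryEquiv.norm_map, ← (hatE S H X).norm_map x]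
      exact Gamma.norm_comp_le S (hat S X x) T⟩

lemma hat_preimage (T : realObj S H ⟶ realObj S G) (X : BimFgp A) (x : H.obj X) :
    hat S X (HilbInd.app (preimage S T) X x) = hat S X x ≫ T := hat_hatE_symm _ _

lemma realMap_preimage (T : realObj S H ⟶ realObj S G) : realMap S (preimage S T) = T :=
  real_hom_ext fun i h => by rw [slice_realMap, ← hat_irr, hat_preimage, hat_irr]

lemma realMap_injective {η θ : H ⟶ G} (h : realMap S η = realMap S θ) : η = θ :=
  HilbInd.hom_ext fun X => ContinuousLinearMap.ext fun x =>
    hat_injective (S := S) X (by rw [← hat_realMap, ← hat_realMap, h])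

variable (S)

instance : (realization S).Full := ⟨fun T => ⟨preimage S T, realMap_preimage T⟩⟩

instance : (realization S).Faithful := ⟨fun h => realMap_injective (S := S) h⟩

lemma realMap_add (f g : H ⟶ G) : realMap S (f + g) = realMap S f + realMap S g :=
  real_hom_ext fun i h => by
    rw [Preadditive.comp_add, slice_realMap, slice_realMap, slice_realMap, ← slice_add]
    rfl

lemma realMap_smul (c : ℂ) (f : H ⟶ G) : realMap S (c • f) = c • realMap S f :=
  real_hom_ext fun i h => by
    rw [Linear.comp_smul, slice_realMap, slice_realMap, ← slice_smul]
    rfl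

lemma realMap_adj (f : H ⟶ G) : realMap S (HilbInd.adj f) = Corr.adj (realMap S f) :=
  Corr.hom_ext_of_total (total_relem S G) fun ⟨i, k, h⟩ =>
    Corr.ip_ext_of_total (total_relem S H) fun ⟨j, l, h'⟩ => by
      rw [Corr.adj_ip, realMap_relem, realMap_relem]
      by_cases hij : j = i
      · subst hij
        rw [ip_relem, ip_relem, HilbInd.adj_app, ContinuousLinearMap.adjoint_inner_left]
      · rw [ip_relem_ne S hij, ip_relem_ne S hij]

end Hat

end CStarCorr

namespace CStarCorr

variable {A : Type u} [CStarAlgebra A] [PartialOrder A] [StarOrderedRing A]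
  [Nontrivial A] [Fact (TrivialCenter A)]

open IrrSystem

/-! ### Correspondences generated by irreducible objects -/

namespace Gamma

variable {S : IrrSystem A} {E : Corr A} {X : BimFgp A}

/-- The morphism corresponding to an element of `Gamma S E`. -/
def hom (f : (Gamma S E).obj X) : X.obj ⟶ E := f

variable (S) in
/-- The element of `Gamma S E` corresponding to a morphism. -/
def of (f : X.obj ⟶ E) : (Gamma S E).obj X := f

@[simp] lemma hom_of (f : X.obj ⟶ E) : hom (of S f) = f := rfl
@[simp] lemma of_hom (f : (Gamma S E).obj X) : of S (hom f) = f := rfl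

lemma app_map_of {F : Corr A} (T : E ⟶ F) (g : X.obj ⟶ E) :
    HilbInd.app (map S T) X (of S g) = of S (g ≫ T) := rfl

lemma inner_of (f g : X.obj ⟶ E) : ⟪of S f, of S g⟫_ℂ = (S.dec X).trace (g ≫ Corr.adj f) := rfl

lemma inner_of_irr (i : S.ι) (f g : (S.obj i).obj ⟶ E) :
    ⟪of S f, of S g⟫_ℂ = dim (S.obj i) * S.scal i (g ≫ Corr.adj f) := inner_irr S i f g

/-- The vector `f k`. -/
def eval (p : Elem S (Gamma S E)) : E := hom p.2.2 p.2.1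

lemma eval_mk (i : S.ι) (k : (S.obj i).obj) (f : (Gamma S E).obj (S.obj i)) :
    eval ⟨i, k, f⟩ = hom f k := rfl

end Gamma

/-- The images of the morphisms out of irreducible objects span a dense subspace. -/
def Generated (S : IrrSystem A) (E : Corr A) : Prop :=
  Corr.Total (Gamma.eval (S := S) (E := E))

section Generated

variable {S : IrrSystem A} {E F : Corr A}

/-- Objects of `Bim_fgp(A)` decompose into irreducibles, so a value `f y` with `f` defined on such
an object is a finite sum of values of morphisms out of irreducibles. -/
lemma generated_of_total {X : Type u} {g : X → E} (hg : Corr.Total g)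
    (h : ∀ x, ∃ (Y : BimFgp A) (f : Y.obj ⟶ E) (y : Y.obj), f y = g x) : Generated S E := by
  refine fun z => closure_mono ?_ (hg z)
  rintro _ ⟨v, rfl⟩
  rw [Finsupp.linearCombination_apply]
  have hmem : (v.sum fun x c => c • g x) ∈
      LinearMap.range (Finsupp.linearCombination ℂ (Gamma.eval (S := S) (E := E))) :=
    Submodule.sum_mem _ fun x _ => Submodule.smul_mem _ _ (by
      obtain ⟨Y, f, y, hy⟩ := h x
      rw [← hy, ← (S.dec Y).sum_apply y, map_sum]
      exact Submodule.sum_mem _ fun a _ => ⟨Finsupp.single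
        ⟨_, Corr.adj ((S.dec Y).f a) y, Gamma.of S ((S.dec Y).f a ≫ f)⟩ 1, by
          rw [Finsupp.linearCombination_single, one_smul]; rfl⟩)
  exact hmem

lemma generated_unit : Generated S (𝟙_ (Corr A)) :=
  generated_of_total (Corr.total_id _) fun x => ⟨BimFgp.unit A, 𝟙 _, x, rfl⟩

lemma total_slice_tmul (H G : HilbInd A) : Corr.Total (fun p : Elem S H × Elem S G =>
    (slice S p.1.1 p.1.2.2 ⊗ₘ slice S p.2.1 p.2.2.2 : _ ⟶ realObj S H ⊗ realObj S G)
      (Corr.tmul p.1.2.1 p.2.2.1)) := by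
  have h := Corr.total_tmul (total_slice (S := S) H) (total_slice (S := S) G)
  have e : (fun p : Elem S H × Elem S G =>
      (slice S p.1.1 p.1.2.2 ⊗ₘ slice S p.2.1 p.2.2.2 : _ ⟶ realObj S H ⊗ realObj S G)
        (Corr.tmul p.1.2.1 p.2.2.1)) = fun p => Corr.tmul (slice S p.1.1 p.1.2.2 p.1.2.1)
          (slice S p.2.1 p.2.2.2 p.2.2.1) := funext fun p => Corr.tensorHom_tmul _ _ _ _
  rw [e]
  exact h

/-- Tensor products of slices have their source in `Bim_fgp(A)`, by closure under `⊗_A`, and their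
values are total. -/
lemma generated_tensor (H G : HilbInd A) : Generated S (realObj S H ⊗ realObj S G) :=
  generated_of_total (total_slice_tmul H G) fun p =>
    ⟨(S.obj p.1.1).tensor (S.obj p.2.1), slice S p.1.1 p.1.2.2 ⊗ₘ slice S p.2.1 p.2.2.2,
      Corr.tmul p.1.2.1 p.2.2.1, rfl⟩

lemma real_tensor_hom_ext {H G : HilbInd A} {f g : realObj S H ⊗ realObj S G ⟶ E}
    (h : ∀ i j (x : H.obj (S.obj i)) (y : G.obj (S.obj j)),
      (slice S i x ⊗ₘ slice S j y) ≫ f = (slice S i x ⊗ₘ slice S j y) ≫ g) : f = g :=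
  Corr.hom_ext_of_total (total_slice_tmul H G) fun p =>
    congrArg (fun u : (S.obj p.1.1).obj ⊗ (S.obj p.2.1).obj ⟶ E => u _)
      (h p.1.1 p.2.1 p.1.2.2 p.2.2.2)

lemma dim_ne_zero (i : S.ι) : (dim (S.obj i) : ℂ) ≠ 0 := by exact_mod_cast (S.dim_pos i).ne'

/-- The inner product of `Γ E` at `Kᵢ` contains the weight `d`, which the normalization of slices
removes. Slices of `|Γ E|` therefore have the same products as the morphisms they come from, which
makes `counit` isometric. -/
lemma slice_of_comp_adj (i : S.ι) (f g : (S.obj i).obj ⟶ E) :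
    slice S i (Gamma.of S g) ≫ Corr.adj (slice S i (Gamma.of S f)) = g ≫ Corr.adj f := by
  have h := slice_comp_adj i (Gamma.of S f) (Gamma.of S g)
  rw [Gamma.inner_of_irr, mul_smul, ← scal_spec] at h
  exact smul_right_injective _ (dim_ne_zero i) h

lemma ip_eval (p q : Elem S (Gamma S E)) : E.ip (Gamma.eval p) (Gamma.eval q) =
    (realObj S (Gamma S E)).ip (slice S p.1 p.2.2 p.2.1) (slice S q.1 q.2.2 q.2.1) := by
  obtain ⟨i, k, f⟩ := p
  obtain ⟨j, l, g⟩ := q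
  rw [Gamma.eval_mk, Gamma.eval_mk, Corr.ip_map_map, Corr.ip_map_map]
  by_cases hij : j = i
  · subst hij
    rw [← slice_of_comp_adj]
    rfl
  · rw [S.disjoint j i hij (Gamma.hom g ≫ _), S.disjoint j i hij (slice S _ _ ≫ _)]

lemma smul_eval (a : A) (p : Elem S (Gamma S E)) :
    ∃ q : Elem S (Gamma S E), a • slice S p.1 p.2.2 p.2.1 = slice S q.1 q.2.2 q.2.1 ∧
      a • Gamma.eval p = Gamma.eval q :=
  ⟨⟨p.1, a • p.2.1, p.2.2⟩, (Corr.map_lsmul _ a _).symm, (Corr.map_lsmul _ a _).symm⟩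

/-- The unitary `|Γ E| ≅ E` for generated `E`. -/
def counit (hE : Generated S E) : realObj S (Gamma S E) ≅ E :=
  Corr.genIso (total_slice (Gamma S E)) hE ip_eval smul_eval

lemma slice_counit (hE : Generated S E) (i : S.ι) (f : (Gamma S E).obj (S.obj i)) :
    slice S i f ≫ (counit hE).hom = Gamma.hom f :=
  Corr.hom_ext fun k => Corr.genIso_hom_apply (total_slice (Gamma S E)) hE ip_eval smul_eval
    ⟨i, k, f⟩

lemma hat_counit (hE : Generated S E) (X : BimFgp A) (f : (Gamma S E).obj X) :
    hat S X f ≫ (counit hE).hom = Gamma.hom f :=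
  (S.dec X).hom_ext fun a => by
    rw [← Category.assoc, comp_hat, hat_irr, slice_counit]
    rfl

lemma realMap_gammaMap (hE : Generated S E) (hF : Generated S F) (T : E ⟶ F) :
    realMap S (Gamma.map S T) = (counit hE).hom ≫ T ≫ (counit hF).inv := by
  rw [← Category.assoc, Iso.eq_comp_inv]
  refine real_hom_ext fun i f => ?_
  rw [← Category.assoc, slice_realMap, ← Category.assoc, slice_counit, slice_counit]
  rfl

end Generated

/-! ### The tensor structure transported along the realization -/

section Struct

variable (S : IrrSystem A)

/-- The unitary `|H| ⊗ |G| ≅ |Γ(|H| ⊗ |G|)|`. -/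
def tensorIso (H G : HilbInd A) :
    realObj S H ⊗ realObj S G ≅ realObj S (Gamma S (realObj S H ⊗ realObj S G)) :=
  (counit (generated_tensor H G)).symm

/-- The unitary `A ≅ |Γ(A)|`. -/
def unitIso : 𝟙_ (Corr A) ≅ realObj S (Gamma S (𝟙_ (Corr A))) := (counit generated_unit).symm

/-- The tensor product `Γ(|H| ⊗ |G|)` and the structure morphisms induced by those of `⊗_A`. -/
abbrev tensorStruct : MonoidalCategoryStruct (HilbInd A) where
  tensorObj H G := Gamma S (realObj S H ⊗ realObj S G)
  tensorUnit := Gamma S (𝟙_ (Corr A))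
  whiskerLeft H _ _ θ := Gamma.map S (realObj S H ◁ realMap S θ)
  whiskerRight η G := Gamma.map S (realMap S η ▷ realObj S G)
  tensorHom η θ := Gamma.map S (realMap S η ⊗ₘ realMap S θ)
  associator H G F := (realization S).preimageIso
    (((tensorIso S _ F).symm ≪≫ ((tensorIso S H G).symm ⊗ᵢ .refl _)) ≪≫
      α_ (realObj S H) (realObj S G) (realObj S F) ≪≫
      ((.refl _ ⊗ᵢ tensorIso S G F) ≪≫ tensorIso S H _))
  leftUnitor H := (realization S).preimageIso
    (((tensorIso S _ H).symm ≪≫ ((unitIso S).symm ⊗ᵢ .refl _)) ≪≫ λ_ (realObj S H))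
  rightUnitor H := (realization S).preimageIso
    (((tensorIso S H _).symm ≪≫ (.refl _ ⊗ᵢ (unitIso S).symm)) ≪≫ ρ_ (realObj S H))

/-- The realization preserves the transported structure. -/
abbrev inducingData :
    letI := tensorStruct S
    Monoidal.InducingFunctorData (realization S) :=
  letI := tensorStruct S
  { μIso := tensorIso S
    whiskerLeft_eq := fun _ _ _ _ => realMap_gammaMap (generated_tensor _ _) (generated_tensor _ _) _
    whiskerRight_eq := fun _ _ => realMap_gammaMap (generated_tensor _ _) (generated_tensor _ _) _
    tensorHom_eq := fun _ _ => realMap_gammaMap (generated_tensor _ _) (generated_tensor _ _) _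
    εIso := unitIso S
    associator_eq := fun _ _ _ => (realization S).map_preimage _
    leftUnitor_eq := fun _ => (realization S).map_preimage _
    rightUnitor_eq := fun _ => (realization S).map_preimage _ }

/-- The transported monoidal structure. -/
abbrev tensorMonoidal : MonoidalCategory (HilbInd A) :=
  letI := tensorStruct S
  Monoidal.induced (realization S) (inducingData S)

end Struct

end CStarCorr

namespace CStarCorr

variable {A : Type u} [CStarAlgebra A] [PartialOrder A] [StarOrderedRing A]
  [Nontrivial A] [Fact (TrivialCenter A)]

open IrrSystem

/-- A decomposition of a tensor product. -/
def IrrSystem.decTensor (S : IrrSystem A) (X Y : BimFgp A) : Decomp S (X.obj ⊗ Y.obj) :=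
  S.dec (X.tensor Y)

/-! ### Elementary tensors in the transported structure -/

section Elementary

variable {S : IrrSystem A} {H G F H' G' : HilbInd A}

variable (S) in
/-- The element `f ⊗ h ⊗ g`. -/
def etmul (X Y Z : BimFgp A) (f : X.obj ⟶ Y.obj ⊗ Z.obj) (h : H.obj Y) (g : G.obj Z) :
    (Gamma S (realObj S H ⊗ realObj S G)).obj X :=
  Gamma.of S (f ≫ (hat S Y h ⊗ₘ hat S Z g))

lemma hom_etmul (X Y Z : BimFgp A) (f : X.obj ⟶ Y.obj ⊗ Z.obj) (h : H.obj Y) (g : G.obj Z) :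
    Gamma.hom (etmul S X Y Z f h g) = f ≫ (hat S Y h ⊗ₘ hat S Z g) := rfl

lemma tensorHom_add_left {K K' L L' : Corr A} (f f' : K ⟶ K') (g : L ⟶ L') :
    ((f + f') ⊗ₘ g) = (f ⊗ₘ g) + (f' ⊗ₘ g) := Corr.tensor_hom_ext fun x y => by
  rw [Corr.add_apply, Corr.tensorHom_tmul, Corr.tensorHom_tmul, Corr.tensorHom_tmul,
    Corr.add_apply, Corr.add_tmul]

lemma tensorHom_add_right {K K' L L' : Corr A} (f : K ⟶ K') (g g' : L ⟶ L') :
    (f ⊗ₘ (g + g')) = (f ⊗ₘ g) + (f ⊗ₘ g') := Corr.tensor_hom_ext fun x y => by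
  rw [Corr.add_apply, Corr.tensorHom_tmul, Corr.tensorHom_tmul, Corr.tensorHom_tmul,
    Corr.add_apply, Corr.tmul_add]

lemma tensorHom_smul_left {K K' L L' : Corr A} (c : ℂ) (f : K ⟶ K') (g : L ⟶ L') :
    ((c • f) ⊗ₘ g) = c • (f ⊗ₘ g) := Corr.tensor_hom_ext fun x y => by
  rw [Corr.smul_apply, Corr.tensorHom_tmul, Corr.tensorHom_tmul, Corr.smul_apply, Corr.smul_tmul]

lemma tensorHom_smul_right {K K' L L' : Corr A} (c : ℂ) (f : K ⟶ K') (g : L ⟶ L') :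
    (f ⊗ₘ (c • g)) = c • (f ⊗ₘ g) := Corr.tensor_hom_ext fun x y => by
  rw [Corr.smul_apply, Corr.tensorHom_tmul, Corr.tensorHom_tmul, Corr.smul_apply, Corr.tmul_smul]

lemma tensorHom_zero_left {K K' L L' : Corr A} (g : L ⟶ L') :
    ((0 : K ⟶ K') ⊗ₘ g) = 0 := by
  have h := tensorHom_smul_left 0 (0 : K ⟶ K') g
  rwa [zero_smul, zero_smul] at h

lemma tensorHom_zero_right {K K' L L' : Corr A} (f : K ⟶ K') :
    (f ⊗ₘ (0 : L ⟶ L')) = 0 := by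
  have h := tensorHom_smul_right 0 f (0 : L ⟶ L')
  rwa [zero_smul, zero_smul] at h

lemma slice_tensor_comp_adj (i j i' j' : S.ι) (h : H.obj (S.obj i)) (h' : H.obj (S.obj i'))
    (g : G.obj (S.obj j)) (g' : G.obj (S.obj j')) :
    (slice S i' h' ⊗ₘ slice S j' g') ≫ Corr.adj (slice S i h ⊗ₘ slice S j g) =
      ((slice S i' h' ≫ Corr.adj (slice S i h)) ⊗ₘ (slice S j' g' ≫ Corr.adj (slice S j g))) := by
  rw [Corr.adj_tensorHom, MonoidalCategory.tensorHom_comp_tensorHom]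

lemma slice_comp_adj' (i : S.ι) (h h' : H.obj (S.obj i)) :
    slice S i h' ≫ Corr.adj (slice S i h) = ((dim (S.obj i) : ℂ)⁻¹ * ⟪h, h'⟫_ℂ) • 𝟙 _ := by
  rw [mul_smul, ← slice_comp_adj, smul_smul, inv_mul_cancel₀ (dim_ne_zero i), one_smul]

/-- The normalizations of the two slices contribute `(d_i d_j)⁻¹`, and the trace inner product on
the morphisms out of `K_k` contributes `d_k c`. -/
lemma inner_etmul (k i j : S.ι) (f f' : (S.obj k).obj ⟶ (S.obj i).obj ⊗ (S.obj j).obj) (c : ℂ)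
    (hc : f' ≫ Corr.adj f = c • 𝟙 (S.obj k).obj) (h h' : H.obj (S.obj i))
    (g g' : G.obj (S.obj j)) :
    ⟪etmul S (S.obj k) (S.obj i) (S.obj j) f h g,
      etmul S (S.obj k) (S.obj i) (S.obj j) f' h' g'⟫_ℂ =
      ((dim (S.obj i) * dim (S.obj j))⁻¹ : ℝ) * (dim (S.obj k) * c) * ⟪h, h'⟫_ℂ * ⟪g, g'⟫_ℂ := by
  have e : (f' ≫ (hat S _ h' ⊗ₘ hat S _ g')) ≫ Corr.adj (f ≫ (hat S _ h ⊗ₘ hat S _ g)) =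
      (((dim (S.obj i) : ℂ)⁻¹ * ⟪h, h'⟫_ℂ) * (((dim (S.obj j) : ℂ)⁻¹ * ⟪g, g'⟫_ℂ) * c)) •
        𝟙 (S.obj k).obj := by
    rw [Corr.adj_comp, hat_irr, hat_irr, hat_irr, hat_irr, Category.assoc,
      ← Category.assoc (slice S i h' ⊗ₘ _), slice_tensor_comp_adj, slice_comp_adj',
      slice_comp_adj', tensorHom_smul_left, tensorHom_smul_right, MonoidalCategory.id_tensorHom_id,
      Linear.smul_comp, Linear.smul_comp, Category.id_comp, Linear.comp_smul, Linear.comp_smul,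
      hc, smul_smul, smul_smul, mul_assoc]
  rw [etmul, etmul, Gamma.inner_of_irr, e, scal_smul_id]
  push_cast
  rw [mul_inv]
  ring

lemma inner_etmul_ne (k i j i' j' : S.ι) (hne : (i, j) ≠ (i', j'))
    (f : (S.obj k).obj ⟶ (S.obj i).obj ⊗ (S.obj j).obj)
    (f' : (S.obj k).obj ⟶ (S.obj i').obj ⊗ (S.obj j').obj)
    (h : H.obj (S.obj i)) (h' : H.obj (S.obj i')) (g : G.obj (S.obj j)) (g' : G.obj (S.obj j')) :
    ⟪etmul S (S.obj k) (S.obj i) (S.obj j) f h g,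
      etmul S (S.obj k) (S.obj i') (S.obj j') f' h' g'⟫_ℂ = 0 := by
  have e : (slice S i' h' ⊗ₘ slice S j' g') ≫ Corr.adj (slice S i h ⊗ₘ slice S j g) = 0 := by
    rw [slice_tensor_comp_adj]
    by_cases hi : i' = i
    · have hj : j' ≠ j := fun hj => hne (by rw [hi, hj])
      rw [S.disjoint j' j hj (_ ≫ _), tensorHom_zero_right]
    · rw [S.disjoint i' i hi (slice S i' h' ≫ _), tensorHom_zero_left]
  rw [etmul, etmul, Gamma.inner_of_irr, Corr.adj_comp, hat_irr, hat_irr, hat_irr, hat_irr,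
    Category.assoc, ← Category.assoc (slice S i' h' ⊗ₘ _), e, Limits.zero_comp, Limits.comp_zero,
    scal_zero, mul_zero]

lemma Gamma.of_add {E : Corr A} {X : BimFgp A} (f g : X.obj ⟶ E) :
    Gamma.of S (f + g) = Gamma.of S f + Gamma.of S g := rfl

lemma Gamma.of_smul {E : Corr A} {X : BimFgp A} (c : ℂ) (f : X.obj ⟶ E) :
    Gamma.of S (c • f) = c • Gamma.of S f := rfl

section

variable (X Y Z : BimFgp A) (f f' : X.obj ⟶ Y.obj ⊗ Z.obj) (h h' : H.obj Y) (g g' : G.obj Z) (c : ℂ)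

lemma add_etmul : etmul S X Y Z (f + f') h g = etmul S X Y Z f h g + etmul S X Y Z f' h g := by
  rw [etmul, Preadditive.add_comp, Gamma.of_add, etmul, etmul]

lemma smul_etmul : etmul S X Y Z (c • f) h g = c • etmul S X Y Z f h g := by
  rw [etmul, Linear.smul_comp, Gamma.of_smul, etmul]

lemma etmul_add_left : etmul S X Y Z f (h + h') g = etmul S X Y Z f h g + etmul S X Y Z f h' g := by
  rw [etmul, hat_add, tensorHom_add_left, Preadditive.comp_add, Gamma.of_add, etmul, etmul]

lemma etmul_smul_left : etmul S X Y Z f (c • h) g = c • etmul S X Y Z f h g := by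
  rw [etmul, hat_smul, tensorHom_smul_left, Linear.comp_smul, Gamma.of_smul, etmul]

lemma etmul_add_right :
    etmul S X Y Z f h (g + g') = etmul S X Y Z f h g + etmul S X Y Z f h g' := by
  rw [etmul, hat_add, tensorHom_add_right, Preadditive.comp_add, Gamma.of_add, etmul, etmul]

lemma etmul_smul_right : etmul S X Y Z f h (c • g) = c • etmul S X Y Z f h g := by
  rw [etmul, hat_smul, tensorHom_smul_right, Linear.comp_smul, Gamma.of_smul, etmul]

end

variable (S) in
/-- The element `f ⊗ h ⊗ g` as a trilinear map. -/
def etmulL (X Y Z : BimFgp A) : (X.obj ⟶ Y.obj ⊗ Z.obj) →ₗ[ℂ] H.obj Y →ₗ[ℂ]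
    G.obj Z →ₗ[ℂ] (Gamma S (realObj S H ⊗ realObj S G)).obj X :=
  LinearMap.mk₂ ℂ (fun f h =>
    { toFun := etmul S X Y Z f h
      map_add' := etmul_add_right X Y Z f h
      map_smul' := fun c g => etmul_smul_right X Y Z f h g c })
    (fun f f' h => LinearMap.ext fun g => add_etmul X Y Z f f' h g)
    (fun c f h => LinearMap.ext fun g => smul_etmul X Y Z f h g c)
    (fun f h h' => LinearMap.ext fun g => etmul_add_left X Y Z f h h' g)
    (fun c f h => LinearMap.ext fun g => etmul_smul_left X Y Z f h g c)

lemma etmulL_apply (X Y Z : BimFgp A) (f : X.obj ⟶ Y.obj ⊗ Z.obj) (h : H.obj Y) (g : G.obj Z) :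
    etmulL S X Y Z f h g = etmul S X Y Z f h g := rfl

lemma map_etmul (W X Y Z : BimFgp A) (u : W.obj ⟶ X.obj) (f : X.obj ⟶ Y.obj ⊗ Z.obj) (h : H.obj Y)
    (g : G.obj Z) : (Gamma S (realObj S H ⊗ realObj S G)).map W X u (etmul S X Y Z f h g) =
      etmul S W Y Z (u ≫ f) h g := congrArg (Gamma.of S) (Category.assoc u f _).symm

lemma etmul_map (X Y Z Y' Z' : BimFgp A) (f : X.obj ⟶ Y.obj ⊗ Z.obj) (a : Y.obj ⟶ Y'.obj)
    (b : Z.obj ⟶ Z'.obj) (h : H.obj Y') (g : G.obj Z') :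
    etmul S X Y Z f (H.map Y Y' a h) (G.map Z Z' b g) =
      etmul S X Y' Z' (f ≫ (a ⊗ₘ b)) h g := by
  rw [etmul, etmul, ← comp_hat, ← comp_hat, Category.assoc,
    MonoidalCategory.tensorHom_comp_tensorHom]

lemma gammaMap_etmul (η : H ⟶ H') (θ : G ⟶ G') (X Y Z : BimFgp A) (f : X.obj ⟶ Y.obj ⊗ Z.obj)
    (h : H.obj Y) (g : G.obj Z) :
    HilbInd.app (Gamma.map S (realMap S η ⊗ₘ realMap S θ)) X (etmul S X Y Z f h g) =
      etmul S X Y Z f (HilbInd.app η Y h) (HilbInd.app θ Z g) := by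
  rw [etmul, etmul, Gamma.app_map_of, ← hat_realMap, ← hat_realMap, Category.assoc,
    MonoidalCategory.tensorHom_comp_tensorHom]

variable (S) in
-- Let `u` be orthogonal to the span. Precompose `u*` with tensor products of slices and decompose
-- their source: components along `K_k` vanish by orthogonality, all others by disjointness. Tensor
-- products of slices are total, so `u* = 0`.
lemma dense_etmul (H G : HilbInd A) (k : S.ι) :
    Dense (Submodule.span ℂ {v : (Gamma S (realObj S H ⊗ realObj S G)).obj (S.obj k) |
      ∃ (i j : S.ι) (f : (S.obj k).obj ⟶ (S.obj i).obj ⊗ (S.obj j).obj) (h : H.obj (S.obj i))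
      (g : G.obj (S.obj j)), v = etmulL S (S.obj k) (S.obj i) (S.obj j) f h g} :
      Set ((Gamma S (realObj S H ⊗ realObj S G)).obj (S.obj k))) := by
  rw [Submodule.dense_iff_topologicalClosure_eq_top, Submodule.topologicalClosure_eq_top_iff,
    Submodule.eq_bot_iff]
  intro u hu
  have hu' : ∀ (i j : S.ι) (f : (S.obj k).obj ⟶ (S.obj i).obj ⊗ (S.obj j).obj)
      (h : H.obj (S.obj i)) (g : G.obj (S.obj j)),
      (f ≫ (slice S i h ⊗ₘ slice S j g)) ≫ Corr.adj (Gamma.hom u) = 0 := fun i j f h g => by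
    have h1 := (Submodule.mem_orthogonal' _ _).mp hu _
      (Submodule.subset_span ⟨i, j, f, h, g, rfl⟩)
    rw [etmulL_apply, etmul, ← Gamma.of_hom u, Gamma.inner_of_irr, hat_irr, hat_irr] at h1
    rw [scal_spec ((f ≫ (slice S i h ⊗ₘ slice S j g)) ≫ Corr.adj (Gamma.hom u)),
      (mul_eq_zero.mp h1).resolve_left (dim_ne_zero k), zero_smul]
  have h0 : Corr.adj (Gamma.hom u) = 0 := real_tensor_hom_ext fun i j x y => by
    rw [Limits.comp_zero]
    let D := S.decTensor (S.obj i) (S.obj j)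
    refine D.hom_ext fun a => ?_
    rw [Limits.comp_zero]
    by_cases hk : D.idx a = k
    · have key : ∀ (l : S.ι) (hl : l = k) (f : (S.obj l).obj ⟶ (S.obj i).obj ⊗ (S.obj j).obj),
          f ≫ (slice S i x ⊗ₘ slice S j y) ≫ Corr.adj (Gamma.hom u) = 0 := by
        rintro l rfl f
        rw [← Category.assoc]
        exact hu' i j f x y
      exact key _ hk _
    · exact S.disjoint _ _ hk _
  exact Corr.eq_zero_of_adj h0

/-- By cyclicity this is the trace of the identity of the irreducible representative of `A`, that
is, its dimension, which is one. Hence the inner product on `Hom(X, A)` needs no normalizing factor.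
-/
lemma trace_unit (D : Decomp S (𝟙_ (Corr A))) : D.trace (𝟙 _) = 1 := by
  have hirr : IsIrreducible (𝟙_ (Corr A)) := irreducible_unit Fact.out
  obtain ⟨i, ⟨u⟩⟩ := S.complete (BimFgp.unit A) hirr
  have hu0 : (show (S.obj i).obj ⟶ 𝟙_ (Corr A) from u.inv) ≠ 0 := fun h => hirr.1 <| by
    have := u.hom_inv_id
    rw [show u.inv = 0 from h, Limits.comp_zero] at this
    exact this.symm
  obtain ⟨c, _, hc⟩ := Corr.exists_unitary_of_irreducible (S.irreducible i) hirr hu0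
  set V := c • (show (S.obj i).obj ⟶ 𝟙_ (Corr A) from u.inv)
  have h := Decomp.trace_comm D (Decomp.single S i) (Corr.adj V) V
  rw [hc.1, hc.2, Decomp.trace_single, dim_eq_one Fact.out (S.irreducible i) hu0] at h
  rw [h, scal_eq (one_smul ℂ _).symm, Complex.ofReal_one, mul_one]

lemma inner_of_unit (X : BimFgp A) (f f' : X.obj ⟶ 𝟙_ (Corr A)) (c : ℂ)
    (hc : Corr.adj f ≫ f' = c • 𝟙 (𝟙_ (Corr A))) : ⟪Gamma.of S f, Gamma.of S f'⟫_ℂ = c := by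
  let D : Decomp S (𝟙_ (Corr A)) := S.dec (BimFgp.unit A)
  rw [Gamma.inner_of, Decomp.trace_comm _ D, hc, Decomp.trace_smul, trace_unit, mul_one]

end Elementary

/-! ### Existence of the tensor structure -/

section Exists

variable (S : IrrSystem A)

lemma hat_realization_preimage {H G : HilbInd A}
    (T : (realization S).obj H ⟶ (realization S).obj G)
    (X : BimFgp A) (x : H.obj X) :
    hat S X (HilbInd.app ((realization S).preimage T) X x) = hat S X x ≫ T := by
  have h : realMap S ((realization S).preimage T) = T := (realization S).map_preimage T
  rw [← hat_realMap, h]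
  rfl

/-- After `hat_counit` removes the identifications, this is naturality of the left unitor of `⊗_A`.
-/
lemma etmul_leftUnitor {H : HilbInd A} (X Y Z : BimFgp A) (f : X.obj ⟶ Y.obj ⊗ Z.obj)
    (e : Y.obj ⟶ 𝟙_ (Corr A)) (h : H.obj Z) :
    hat S X (etmul S X Y Z f (Gamma.of S e) h) ≫
      (counit (generated_tensor _ H)).hom ≫ (counit generated_unit).hom ▷ realObj S H ≫
        (λ_ (realObj S H)).hom = hat S X (H.map X Z (f ≫ e ▷ Z.obj ≫ (λ_ Z.obj).hom) h) := by
  rw [← Category.assoc, hat_counit, hom_etmul, ← comp_hat, Category.assoc, Category.assoc,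
    Category.assoc, ← MonoidalCategory.tensorHom_id, MonoidalCategory.tensorHom_comp_tensorHom_assoc,
    hat_counit, Gamma.hom_of, Category.comp_id, MonoidalCategory.tensorHom_def, Category.assoc,
    MonoidalCategory.leftUnitor_naturality]

lemma etmul_rightUnitor {H : HilbInd A} (X Y Z : BimFgp A) (f : X.obj ⟶ Y.obj ⊗ Z.obj)
    (h : H.obj Y) (e : Z.obj ⟶ 𝟙_ (Corr A)) :
    hat S X (etmul S X Y Z f h (Gamma.of S e)) ≫
      (counit (generated_tensor H _)).hom ≫ realObj S H ◁ (counit generated_unit).hom ≫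
        (ρ_ (realObj S H)).hom = hat S X (H.map X Y (f ≫ Y.obj ◁ e ≫ (ρ_ Y.obj).hom) h) := by
  rw [← Category.assoc, hat_counit, hom_etmul, ← comp_hat, Category.assoc, Category.assoc,
    Category.assoc, ← MonoidalCategory.id_tensorHom, MonoidalCategory.tensorHom_comp_tensorHom_assoc,
    hat_counit, Gamma.hom_of, Category.comp_id, MonoidalCategory.tensorHom_def', Category.assoc,
    MonoidalCategory.rightUnitor_naturality]

/-- After `hat_counit` removes the identifications, both sides are composites ending in `hat h ⊗
(hat g ⊗ hat x)`. Naturality of the associator of `⊗_A` moves the discrepancy into the assumed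
relation between `(f, e)` and `(f', e')`. -/
lemma etmul_associator {H G F : HilbInd A} (X Y Z P Q W : BimFgp A)
    (f : X.obj ⟶ Y.obj ⊗ Z.obj) (e : Y.obj ⟶ P.obj ⊗ Q.obj)
    (f' : X.obj ⟶ P.obj ⊗ W.obj) (e' : W.obj ⟶ Q.obj ⊗ Z.obj)
    (he : f ≫ e ▷ Z.obj ≫ (α_ P.obj Q.obj Z.obj).hom = f' ≫ P.obj ◁ e')
    (h : H.obj P) (g : G.obj Q) (x : F.obj Z) :
    hat S X (etmul S X Y Z f (etmul S Y P Q e h g) x) ≫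
      (counit (generated_tensor _ F)).hom ≫ (counit (generated_tensor H G)).hom ▷ realObj S F ≫
        (α_ (realObj S H) (realObj S G) (realObj S F)).hom =
    hat S X (etmul S X P W f' h (etmul S W Q Z e' g x)) ≫
      (counit (generated_tensor H _)).hom ≫ realObj S H ◁ (counit (generated_tensor G F)).hom := by
  rw [← Category.assoc, hat_counit, hom_etmul, ← Category.assoc (hat S X _), hat_counit, hom_etmul,
    ← MonoidalCategory.tensorHom_id, ← MonoidalCategory.id_tensorHom, Category.assoc,
    Category.assoc, MonoidalCategory.tensorHom_comp_tensorHom_assoc,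
    MonoidalCategory.tensorHom_comp_tensorHom, hat_counit, hat_counit, hom_etmul, hom_etmul,
    Category.comp_id, Category.comp_id]
  have h1 : ((e ≫ (hat S P h ⊗ₘ hat S Q g)) ⊗ₘ hat S Z x) =
      e ▷ Z.obj ≫ ((hat S P h ⊗ₘ hat S Q g) ⊗ₘ hat S Z x) := by
    rw [← MonoidalCategory.tensorHom_id, MonoidalCategory.tensorHom_comp_tensorHom,
      Category.id_comp]
  have h2 : (hat S P h ⊗ₘ (e' ≫ (hat S Q g ⊗ₘ hat S Z x))) =
      P.obj ◁ e' ≫ (hat S P h ⊗ₘ (hat S Q g ⊗ₘ hat S Z x)) := by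
    rw [← MonoidalCategory.id_tensorHom, MonoidalCategory.tensorHom_comp_tensorHom,
      Category.id_comp]
  rw [h1, h2, Category.assoc, MonoidalCategory.associator_naturality, ← Category.assoc f',
    ← he, Category.assoc, Category.assoc]

/-- The tensor structure of the unitary ind-completion exists. -/
def indTensor : IndTensor S :=
  letI := tensorMonoidal S
  { tmul := etmulL S
    map_tmul := map_etmul
    tmul_map := etmul_map
    inner_tmul := inner_etmul
    inner_tmul_ne := inner_etmul_ne
    dense_tmul := dense_etmul S
    tensorHom_tmul := gammaMap_etmul
    unit := fun X => LinearEquiv.refl ℂ _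
    map_unit := fun _ _ _ _ => rfl
    inner_unit := inner_of_unit
    leftUnitor_tmul := fun {H} X Y Z f e h => hat_injective (S := S) X <| by
      refine (hat_realization_preimage S _ X _).trans ?_
      change _ ≫ ((counit (generated_tensor _ _)).hom ≫ ((counit generated_unit).hom ⊗ₘ 𝟙 _)) ≫
        (λ_ (realObj S H)).hom = _
      rw [Category.assoc, MonoidalCategory.tensorHom_id]
      exact etmul_leftUnitor S X Y Z f e h
    rightUnitor_tmul := fun {H} X Y Z f h e => hat_injective (S := S) X <| by
      refine (hat_realization_preimage S _ X _).trans ?_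
      change _ ≫ ((counit (generated_tensor _ _)).hom ≫ (𝟙 _ ⊗ₘ (counit generated_unit).hom)) ≫
        (ρ_ (realObj S H)).hom = _
      rw [Category.assoc, MonoidalCategory.id_tensorHom]
      exact etmul_rightUnitor S X Y Z f h e
    associator_tmul := fun {H G F} X Y Z P Q W f e f' e' he h g x => hat_injective (S := S) X <| by
      refine (hat_realization_preimage S _ X _).trans ?_
      change _ ≫ ((counit (generated_tensor _ _)).hom ≫
        ((counit (generated_tensor _ _)).hom ⊗ₘ 𝟙 _)) ≫
        (α_ (realObj S H) (realObj S G) (realObj S F)).hom ≫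
        (𝟙 _ ⊗ₘ (counit (generated_tensor _ _)).inv) ≫ (counit (generated_tensor _ _)).inv = _
      rw [Category.assoc, MonoidalCategory.tensorHom_id, MonoidalCategory.id_tensorHom]
      have key := etmul_associator S X Y Z P Q W f e f' e' he h g x
      have key2 := congrArg (fun u => u ≫ realObj S H ◁ (counit (generated_tensor G F)).inv ≫
        (counit (generated_tensor H _)).inv) key
      simp only [Category.assoc] at key2
      refine Eq.trans ?_ (key2.trans ?_)
      · rfl
      · rw [← MonoidalCategory.whiskerLeft_comp_assoc, Iso.hom_inv_id,
          MonoidalCategory.whiskerLeft_id, Category.id_comp, Iso.hom_inv_id, Category.comp_id]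
        rfl }

end Exists

end CStarCorr

namespace CStarCorr

variable {A : Type u} [CStarAlgebra A] [PartialOrder A] [StarOrderedRing A]
  [Nontrivial A] [Fact (TrivialCenter A)]

open IrrSystem

lemma Decomp.tensor_hom_ext {S : IrrSystem A} {X Y E : Corr A} (D : Decomp S X)
    (D' : Decomp S Y) {u v : X ⊗ Y ⟶ E}
    (h : ∀ a b, (D.f a ⊗ₘ D'.f b) ≫ u = (D.f a ⊗ₘ D'.f b) ≫ v) : u = v :=
  Corr.tensor_hom_ext fun x y => by
    have h' : ∀ a b x y, u (Corr.tmul (D.f a x) (D'.f b y)) =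
        v (Corr.tmul (D.f a x) (D'.f b y)) := fun a b x y => by
      rw [← Corr.tensorHom_tmul]
      exact congrArg (fun w : (S.obj _).obj ⊗ (S.obj _).obj ⟶ E => w (Corr.tmul x y)) (h a b)
    rw [← D.sum_apply x, ← D'.sum_apply y]
    simp only [Corr.sum_tmul, Corr.tmul_sum, map_sum, h']

/-! ### An arbitrary tensor structure and the unitaries `|H| ⊗ |G| ≅ |H ⊠ G|` -/

namespace IndTensor

variable {S : IrrSystem A} (T : IndTensor S) {H G F H' G' : HilbInd A}

/-- The tensor product of two objects. -/
abbrev prod (H G : HilbInd A) : HilbInd A :=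
  letI := T.monoidal
  H ⊗ G

/-- The morphism `Y ⊗ Z ⟶ |H ⊗ G|` determined by `h ∈ H(Y)` and `g ∈ G(Z)`. -/
def pair (Y Z : BimFgp A) (h : H.obj Y) (g : G.obj Z) :
    Y.obj ⊗ Z.obj ⟶ realObj S (T.prod H G) :=
  hat S (Y.tensor Z) (T.tmul (Y.tensor Z) Y Z (𝟙 (Y.obj ⊗ Z.obj)) h g)

/-- Naturality in `X` writes `f ⊗ h ⊗ g` as the pullback along `f` of `𝟙 ⊗ h ⊗ g`, so the morphisms
`pair` encode all elementary tensors of `T`. -/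
lemma comp_pair {X : BimFgp A} (Y Z : BimFgp A) (f : X.obj ⟶ Y.obj ⊗ Z.obj) (h : H.obj Y)
    (g : G.obj Z) : f ≫ T.pair Y Z h g = hat S X (T.tmul X Y Z f h g) := by
  refine (comp_hat (X := Y.tensor Z) f _).trans (congrArg (hat S X) ?_)
  exact (T.map_tmul X (Y.tensor Z) Y Z f _ h g).trans
    (congrArg (fun u => T.tmul X Y Z u h g) (Category.comp_id f))

lemma tensorHom_pair (Y Z Y' Z' : BimFgp A) (a : Y.obj ⟶ Y'.obj) (b : Z.obj ⟶ Z'.obj)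
    (h : H.obj Y') (g : G.obj Z') :
    (a ⊗ₘ b) ≫ T.pair Y' Z' h g = T.pair Y Z (H.map Y Y' a h) (G.map Z Z' b g) := by
  refine (T.comp_pair (X := Y.tensor Z) Y' Z' (a ⊗ₘ b) h g).trans ?_
  refine congrArg (hat S (Y.tensor Z)) (Eq.trans ?_
    (T.tmul_map (Y.tensor Z) Y Z Y' Z' (𝟙 (Y.obj ⊗ Z.obj)) a b h g).symm)
  exact congrArg (fun u => T.tmul (Y.tensor Z) Y' Z' u h g) (Category.id_comp (a ⊗ₘ b)).symm

lemma inner_tmul_eq (k i j i' j' : S.ι) (f : (S.obj k).obj ⟶ (S.obj i).obj ⊗ (S.obj j).obj)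
    (f' : (S.obj k).obj ⟶ (S.obj i').obj ⊗ (S.obj j').obj) (h : H.obj (S.obj i))
    (h' : H.obj (S.obj i')) (g : G.obj (S.obj j)) (g' : G.obj (S.obj j')) :
    ⟪T.tmul (S.obj k) (S.obj i) (S.obj j) f h g, T.tmul (S.obj k) (S.obj i') (S.obj j') f' h' g'⟫_ℂ =
      ⟪etmul S (S.obj k) (S.obj i) (S.obj j) f h g,
        etmul S (S.obj k) (S.obj i') (S.obj j') f' h' g'⟫_ℂ := by
  by_cases hij : (i, j) = (i', j')
  · obtain ⟨rfl, rfl⟩ := Prod.mk.inj hij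
    rw [T.inner_tmul k i j f f' _ (scal_spec _), inner_etmul k i j f f' _ (scal_spec _)]
  · rw [T.inner_tmul_ne k i j i' j' hij, inner_etmul_ne k i j i' j' hij]

/-- Decomposing source and target reduces this to compressions between irreducibles. Off the
diagonal they vanish. On the diagonal they are scalars given by inner products of elementary
tensors, which the axioms force to be the same for `T` as for the transported structure. -/
lemma pair_comp_adj (i j i' j' : S.ι) (h : H.obj (S.obj i)) (h' : H.obj (S.obj i'))
    (g : G.obj (S.obj j)) (g' : G.obj (S.obj j')) :
    T.pair _ _ h' g' ≫ Corr.adj (T.pair _ _ h g) =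
      (slice S i' h' ⊗ₘ slice S j' g') ≫ Corr.adj (slice S i h ⊗ₘ slice S j g) := by
  have key : ∀ (l k : S.ι) (f' : (S.obj l).obj ⟶ (S.obj i').obj ⊗ (S.obj j').obj)
      (f : (S.obj k).obj ⟶ (S.obj i).obj ⊗ (S.obj j).obj),
      f' ≫ (T.pair _ _ h' g' ≫ Corr.adj (T.pair _ _ h g)) ≫ Corr.adj f =
        f' ≫ ((slice S i' h' ⊗ₘ slice S j' g') ≫ Corr.adj (slice S i h ⊗ₘ slice S j g)) ≫
          Corr.adj f := fun l k f' f => by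
    by_cases hlk : l = k
    · subst hlk
      have h1 := T.inner_tmul_eq l i j i' j' f f' h h' g g'
      rw [← scal_slice, ← hat_irr, ← hat_irr, ← comp_pair, ← comp_pair, etmul, etmul,
        Gamma.inner_of_irr, hat_irr, hat_irr, hat_irr, hat_irr, Corr.adj_comp, Corr.adj_comp] at h1
      have h2 := mul_left_cancel₀ (dim_ne_zero l) h1
      simp only [Category.assoc] at h2 ⊢
      rw [scal_spec (f' ≫ T.pair _ _ h' g' ≫ _), h2, ← scal_spec]
    · rw [S.disjoint l k hlk (f' ≫ _), S.disjoint l k hlk (f' ≫ _)]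
  refine (S.decTensor (S.obj i') (S.obj j')).hom_ext fun b => ?_
  rw [← Corr.adj_adj (_ ≫ T.pair _ _ h' g' ≫ _), ← Corr.adj_adj (_ ≫ (_ ⊗ₘ _) ≫ _)]
  congr 1
  refine (S.decTensor (S.obj i) (S.obj j)).hom_ext fun a => ?_
  rw [← Corr.adj_adj ((S.decTensor (S.obj i) (S.obj j)).f a), ← Corr.adj_comp, ← Corr.adj_comp,
    Category.assoc, Category.assoc]
  exact congrArg Corr.adj (key _ _ _ _)

/-- The closed span contains all values of the morphisms `pair`. By `comp_pair` it contains the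
elementary vectors of `|H ⊠ G|` built from elementary tensors of `T`, and the density axiom with
continuity yields all elementary vectors. -/
lemma total_pair (H G : HilbInd A) : Corr.Total (fun p : Elem S H × Elem S G =>
    T.pair (S.obj p.1.1) (S.obj p.2.1) p.1.2.2 p.2.2.2 (Corr.tmul p.1.2.1 p.2.2.1)) := by
  set M := (LinearMap.range (Finsupp.linearCombination ℂ (fun p : Elem S H × Elem S G =>
    T.pair (S.obj p.1.1) (S.obj p.2.1) p.1.2.2 p.2.2.2
      (Corr.tmul p.1.2.1 p.2.2.1)))).topologicalClosure with hM
  have hMc : IsClosed (M : Set (realObj S (T.prod H G))) := Submodule.isClosed_topologicalClosure _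
  have h0 : ∀ (i j : S.ι) (h : H.obj (S.obj i)) (g : G.obj (S.obj j))
      (t : ((S.obj i).obj ⊗ (S.obj j).obj : Corr A)), T.pair _ _ h g t ∈ M := fun i j h g t => by
    refine (Corr.total_tmul' _ _).induction_on
      (p := fun t : ((S.obj i).obj ⊗ (S.obj j).obj : Corr A) => T.pair _ _ h g t ∈ M) t
      (hMc.preimage (Corr.op' (T.pair _ _ h g)).continuous) fun v => ?_
    rw [Finsupp.linearCombination_apply, Finsupp.sum, map_sum]
    refine Submodule.sum_mem _ fun p _ => ?_
    rw [map_smul]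
    refine M.smul_mem _ (Submodule.le_topologicalClosure _ ⟨Finsupp.single
      (⟨i, p.1, h⟩, ⟨j, p.2, g⟩) 1, ?_⟩)
    rw [Finsupp.linearCombination_single, one_smul]
  have h1 : ∀ (k : S.ι) (x : (S.obj k).obj) (v : (T.prod H G).obj (S.obj k)),
      relem S k x v ∈ M := fun k x v => by
    let N : Submodule ℂ ((T.prod H G).obj (S.obj k)) :=
      M.comap (relemL S (T.prod H G) k x).toLinearMap
    have hN : IsClosed (N : Set ((T.prod H G).obj (S.obj k))) :=
      hMc.preimage (relemL S (T.prod H G) k x).continuous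
    have hle : Submodule.span ℂ {v : (T.prod H G).obj (S.obj k) | ∃ (i j : S.ι)
        (f : (S.obj k).obj ⟶ (S.obj i).obj ⊗ (S.obj j).obj) (h : H.obj (S.obj i))
        (g : G.obj (S.obj j)), v = T.tmul (S.obj k) (S.obj i) (S.obj j) f h g} ≤ N := by
      refine Submodule.span_le.mpr ?_
      rintro _ ⟨i, j, f, h, g, rfl⟩
      change relem S k x _ ∈ M
      rw [relem_eq, ← hat_irr, ← comp_pair]
      exact M.smul_mem _ (h0 i j h g (f x))
    exact closure_minimal hle hN (T.dense_tmul H G k v)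
  intro z
  refine (total_relem S (T.prod H G)).induction_on (p := fun z => z ∈ M) z hMc fun v => ?_
  rw [Finsupp.linearCombination_apply, Finsupp.sum]
  exact Submodule.sum_mem _ fun p _ => M.smul_mem _ (h1 _ _ _)

lemma ip_pair (p q : Elem S H × Elem S G) :
    (realObj S (T.prod H G)).ip
        (T.pair (S.obj p.1.1) (S.obj p.2.1) p.1.2.2 p.2.2.2 (Corr.tmul p.1.2.1 p.2.2.1))
        (T.pair (S.obj q.1.1) (S.obj q.2.1) q.1.2.2 q.2.2.2 (Corr.tmul q.1.2.1 q.2.2.1)) =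
      (realObj S H ⊗ realObj S G : Corr A).ip
        ((slice S p.1.1 p.1.2.2 ⊗ₘ slice S p.2.1 p.2.2.2) (Corr.tmul p.1.2.1 p.2.2.1))
        ((slice S q.1.1 q.1.2.2 ⊗ₘ slice S q.2.1 q.2.2.2) (Corr.tmul q.1.2.1 q.2.2.1)) := by
  rw [Corr.ip_map_map, Corr.ip_map_map, pair_comp_adj]

lemma smul_pair (a : A) (p : Elem S H × Elem S G) : ∃ q : Elem S H × Elem S G,
    a • (slice S p.1.1 p.1.2.2 ⊗ₘ slice S p.2.1 p.2.2.2 : _ ⟶ realObj S H ⊗ realObj S G)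
        (Corr.tmul p.1.2.1 p.2.2.1) =
      (slice S q.1.1 q.1.2.2 ⊗ₘ slice S q.2.1 q.2.2.2 : _ ⟶ realObj S H ⊗ realObj S G)
        (Corr.tmul q.1.2.1 q.2.2.1) ∧
    a • T.pair (S.obj p.1.1) (S.obj p.2.1) p.1.2.2 p.2.2.2 (Corr.tmul p.1.2.1 p.2.2.1) =
      T.pair (S.obj q.1.1) (S.obj q.2.1) q.1.2.2 q.2.2.2 (Corr.tmul q.1.2.1 q.2.2.1) :=
  ⟨(⟨p.1.1, a • p.1.2.1, p.1.2.2⟩, p.2), by rw [← Corr.map_lsmul, ← Corr.lsmul_tmul],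
    by rw [← Corr.map_lsmul, ← Corr.lsmul_tmul]⟩

/-- The unitary `|H| ⊗ |G| ≅ |H ⊗ G|`. -/
def tensorator (H G : HilbInd A) : realObj S H ⊗ realObj S G ≅ realObj S (T.prod H G) :=
  Corr.genIso (total_slice_tmul H G) (T.total_pair H G) T.ip_pair T.smul_pair

lemma tensorator_isUnitary (H G : HilbInd A) : Corr.IsUnitary (T.tensorator H G).hom :=
  Corr.genIso_isUnitary (total_slice_tmul H G) (T.total_pair H G) T.ip_pair T.smul_pair

lemma slice_tensorator (i j : S.ι) (h : H.obj (S.obj i)) (g : G.obj (S.obj j)) :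
    (slice S i h ⊗ₘ slice S j g) ≫ (T.tensorator H G).hom = T.pair _ _ h g :=
  Corr.tensor_hom_ext fun x y => Corr.genIso_hom_apply (total_slice_tmul H G) (T.total_pair H G)
    T.ip_pair T.smul_pair (⟨i, x, h⟩, ⟨j, y, g⟩)

/-- Decomposing both factors reduces general objects to irreducible ones, where the formula defines
the tensorator; `tmul_map` makes the two sides compatible with the decomposition. -/
lemma hat_tensorator (Y Z : BimFgp A) (h : H.obj Y) (g : G.obj Z) :
    (hat S Y h ⊗ₘ hat S Z g) ≫ (T.tensorator H G).hom = T.pair Y Z h g :=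
  (S.dec Y).tensor_hom_ext (S.dec Z) fun a b => by
    rw [MonoidalCategory.tensorHom_comp_tensorHom_assoc, comp_hat, comp_hat, hat_irr, hat_irr,
      slice_tensorator, tensorHom_pair]

/-! ### The unit -/

/-- The unit `A ⟶ |1|`. -/
def unitor : 𝟙_ (Corr A) ⟶ realObj S T.monoidal.tensorUnit :=
  hat S (BimFgp.unit A) (T.unit (BimFgp.unit A) (𝟙 (𝟙_ (Corr A))))

lemma comp_unitor (X : BimFgp A) (e : X.obj ⟶ 𝟙_ (Corr A)) :
    e ≫ T.unitor = hat S X (T.unit X e) := by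
  refine (comp_hat (X := BimFgp.unit A) e _).trans (congrArg (hat S X) ?_)
  exact (T.map_unit X (BimFgp.unit A) e _).trans (congrArg (T.unit X) (Category.comp_id e))

/-- The endomorphism is scalar since `A` is irreducible. The axiom on the inner product of the unit
makes its trace `1`, which is also the trace of the identity of `A`. -/
lemma unitor_comp_adj : T.unitor ≫ Corr.adj T.unitor = 𝟙 (𝟙_ (Corr A)) := by
  obtain ⟨c, hc⟩ := (irreducible_unit (A := A) Fact.out).2 (T.unitor ≫ Corr.adj T.unitor)
  have h1 := trace_hat (S := S) (BimFgp.unit A) (T.unit (BimFgp.unit A) (𝟙 (𝟙_ (Corr A))))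
    (T.unit (BimFgp.unit A) (𝟙 (𝟙_ (Corr A))))
  let D : Decomp S (𝟙_ (Corr A)) := S.dec (BimFgp.unit A)
  have h2 : Corr.adj (𝟙 (𝟙_ (Corr A))) ≫ 𝟙 (𝟙_ (Corr A)) = (1 : ℂ) • 𝟙 (𝟙_ (Corr A)) := by
    rw [Corr.adj_id, Category.comp_id, one_smul]
  have h3 : D.trace (T.unitor ≫ Corr.adj T.unitor) = 1 :=
    h1.trans (T.inner_unit (BimFgp.unit A) _ _ 1 h2)
  rw [hc, Decomp.trace_smul, trace_unit, mul_one] at h3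
  rw [hc, h3, one_smul]

/-- Vectors of the unit object at `Kᵢ` are morphisms `e : Kᵢ ⟶ A`, and their slices factor through
the isometry `unitor`. Its image thus contains a total family. -/
lemma unitor_isUnitary : Corr.IsUnitary T.unitor :=
  Corr.isUnitary_of_total (total_slice T.monoidal.tensorUnit)
    (fun x y => by rw [Corr.ip_map_map, unitor_comp_adj, Corr.id_apply]) fun ⟨i, k, x⟩ => by
      obtain ⟨e, rfl⟩ := (T.unit (S.obj i)).surjective x
      refine ⟨e k, ?_⟩
      change _ = slice S i _ k
      rw [← hat_irr, ← comp_unitor, Corr.comp_apply]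

/-! ### Naturality and coherence -/

lemma tensorator_natural (η : H ⟶ H') (θ : G ⟶ G') :
    letI := T.monoidal
    (realMap S η ⊗ₘ realMap S θ) ≫ (T.tensorator H' G').hom =
      (T.tensorator H G).hom ≫ realMap S (η ⊗ₘ θ) := by
  refine real_tensor_hom_ext fun i j x y => ?_
  rw [MonoidalCategory.tensorHom_comp_tensorHom_assoc, slice_realMap, slice_realMap,
    slice_tensorator, ← Category.assoc, slice_tensorator]
  exact (congrArg (hat S _) (T.tensorHom_tmul η θ _ _ _ _ x y).symm).trans (hat_realMap _ _ _).symm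

/-- This is the associativity axiom of `T` for `e` and `e'` identities, `f` the identity of `(P ⊗ Q)
⊗ Z` and `f'` the associator of `⊗_A`. -/
lemma pair_associator (P Q Z : BimFgp A) (h : H.obj P) (g : G.obj Q) (x : F.obj Z) :
    letI := T.monoidal
    (T.pair P Q h g ⊗ₘ hat S Z x) ≫ (T.tensorator (H ⊗ G) F).hom ≫ realMap S (α_ H G F).hom =
      (α_ P.obj Q.obj Z.obj).hom ≫ (hat S P h ⊗ₘ T.pair Q Z g x) ≫
        (T.tensorator H (G ⊗ F)).hom := by
  let _ := T.monoidal
  have h1 := T.hat_tensorator (P.tensor Q) Z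
    (T.tmul (P.tensor Q) P Q (𝟙 (P.obj ⊗ Q.obj)) h g) x
  have h2 := T.hat_tensorator P (Q.tensor Z) h
    (T.tmul (Q.tensor Z) Q Z (𝟙 (Q.obj ⊗ Z.obj)) g x)
  have h3 : 𝟙 ((P.obj ⊗ Q.obj) ⊗ Z.obj) ≫ 𝟙 (P.obj ⊗ Q.obj) ▷ Z.obj ≫
      (α_ P.obj Q.obj Z.obj).hom =
        (α_ P.obj Q.obj Z.obj).hom ≫ P.obj ◁ 𝟙 (Q.obj ⊗ Z.obj) := by
    rw [MonoidalCategory.id_whiskerRight, MonoidalCategory.whiskerLeft_id, Category.id_comp,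
      Category.id_comp, Category.comp_id]
  have h4 := T.associator_tmul ((P.tensor Q).tensor Z) (P.tensor Q) Z P Q (Q.tensor Z) _ _ _ _ h3
    h g x
  have h5 := T.comp_pair (X := (P.tensor Q).tensor Z) P (Q.tensor Z) (α_ P.obj Q.obj Z.obj).hom h
    (T.tmul (Q.tensor Z) Q Z (𝟙 (Q.obj ⊗ Z.obj)) g x)
  refine ((Category.assoc _ _ _).symm.trans
    (congrArg (fun u => u ≫ realMap S (α_ H G F).hom) h1)).trans ?_
  refine ((hat_realMap _ _ _).trans (congrArg (hat S ((P.tensor Q).tensor Z)) h4)).trans ?_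
  exact h5.symm.trans (congrArg (fun u => (α_ P.obj Q.obj Z.obj).hom ≫ u) h2.symm)

lemma tensorator_associativity (H G F : HilbInd A) :
    letI := T.monoidal
    (T.tensorator H G).hom ▷ realObj S F ≫ (T.tensorator (H ⊗ G) F).hom ≫
        realMap S (α_ H G F).hom =
      (α_ (realObj S H) (realObj S G) (realObj S F)).hom ≫
        realObj S H ◁ (T.tensorator G F).hom ≫ (T.tensorator H (G ⊗ F)).hom := by
  let _ := T.monoidal
  have key : ∀ (i j k : S.ι) (h : H.obj (S.obj i)) (g : G.obj (S.obj j)) (x : F.obj (S.obj k)),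
      ((slice S i h ⊗ₘ slice S j g) ⊗ₘ slice S k x) ≫
        (T.tensorator H G).hom ▷ realObj S F ≫ (T.tensorator (H ⊗ G) F).hom ≫
        realMap S (α_ H G F).hom =
      ((slice S i h ⊗ₘ slice S j g) ⊗ₘ slice S k x) ≫
        (α_ (realObj S H) (realObj S G) (realObj S F)).hom ≫
        realObj S H ◁ (T.tensorator G F).hom ≫ (T.tensorator H (G ⊗ F)).hom :=
    fun i j k h g x => by
      rw [← MonoidalCategory.tensorHom_id, ← MonoidalCategory.id_tensorHom,
        MonoidalCategory.tensorHom_comp_tensorHom_assoc, slice_tensorator, Category.comp_id,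
        MonoidalCategory.associator_naturality_assoc,
        MonoidalCategory.tensorHom_comp_tensorHom_assoc, slice_tensorator, Category.comp_id,
        ← hat_irr, ← hat_irr]
      exact T.pair_associator _ _ _ h g x
  refine Corr.hom_ext_of_total (Corr.total_tmul (total_slice_tmul H G) (total_slice F)) fun p => ?_
  rw [← Corr.tensorHom_tmul]
  exact congrArg (fun u : ((S.obj p.1.1.1).obj ⊗ (S.obj p.1.2.1).obj) ⊗ (S.obj p.2.1).obj ⟶ _ =>
    u (Corr.tmul (Corr.tmul p.1.1.2.1 p.1.2.2.1) p.2.2.1))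
    (key p.1.1.1 p.1.2.1 p.2.1 p.1.1.2.2 p.1.2.2.2 p.2.2.2)

lemma tensorator_left_unitality (H : HilbInd A) :
    letI := T.monoidal
    (λ_ (realObj S H)).hom = T.unitor ▷ realObj S H ≫ (T.tensorator (𝟙_ (HilbInd A)) H).hom ≫
      realMap S (λ_ H).hom := by
  let _ := T.monoidal
  have key : ∀ (i : S.ι) (h : H.obj (S.obj i)),
      (𝟙 (𝟙_ (Corr A)) ⊗ₘ slice S i h) ≫ (λ_ (realObj S H)).hom =
        (𝟙 (𝟙_ (Corr A)) ⊗ₘ slice S i h) ≫ T.unitor ▷ realObj S H ≫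
          (T.tensorator (𝟙_ (HilbInd A)) H).hom ≫ realMap S (λ_ H).hom := fun i h => by
    let e := T.unit (BimFgp.unit A) (𝟙 (𝟙_ (Corr A)))
    have h1 := T.hat_tensorator (BimFgp.unit A) (S.obj i) e h
    -- The unit axiom is used with `f` and `e` identities, so that the right-hand side is `H`
    -- applied to the left unitor of `⊗_A`.
    have h2 := T.leftUnitor_tmul ((BimFgp.unit A).tensor (S.obj i)) (BimFgp.unit A) (S.obj i)
      (𝟙 (𝟙_ (Corr A) ⊗ (S.obj i).obj)) (𝟙 (𝟙_ (Corr A))) h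
    have h3 : 𝟙 (𝟙_ (Corr A) ⊗ (S.obj i).obj) ≫ 𝟙 (𝟙_ (Corr A)) ▷ (S.obj i).obj ≫
        (λ_ (S.obj i).obj).hom = (λ_ (S.obj i).obj).hom := by
      rw [MonoidalCategory.id_whiskerRight, Category.id_comp, Category.id_comp]
    rw [MonoidalCategory.id_tensorHom, MonoidalCategory.leftUnitor_naturality,
      ← MonoidalCategory.id_tensorHom, ← MonoidalCategory.tensorHom_id,
      MonoidalCategory.tensorHom_comp_tensorHom_assoc, Category.id_comp, Category.comp_id,
      ← hat_irr]
    refine (((Category.assoc _ _ _).symm.trans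
      (congrArg (fun u => u ≫ realMap S (λ_ H).hom) h1)).trans ?_).symm
    refine ((hat_realMap _ _ _).trans (congrArg (hat S _) h2)).trans ?_
    exact (comp_hat _ h).symm.trans (congrArg (fun u => u ≫ hat S (S.obj i) h) h3)
  refine Corr.hom_ext_of_total (Corr.total_tmul (Corr.total_id _) (total_slice H)) fun p => ?_
  have h4 := Corr.tensorHom_tmul (𝟙 (𝟙_ (Corr A))) (slice S p.2.1 p.2.2.2) p.1 p.2.2.1
  rw [Corr.id_apply] at h4
  rw [← h4]
  exact congrArg (fun u : 𝟙_ (Corr A) ⊗ (S.obj p.2.1).obj ⟶ _ => u (Corr.tmul p.1 p.2.2.1))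
    (key p.2.1 p.2.2.2)

lemma tensorator_right_unitality (H : HilbInd A) :
    letI := T.monoidal
    (ρ_ (realObj S H)).hom = realObj S H ◁ T.unitor ≫ (T.tensorator H (𝟙_ (HilbInd A))).hom ≫
      realMap S (ρ_ H).hom := by
  let _ := T.monoidal
  have key : ∀ (i : S.ι) (h : H.obj (S.obj i)),
      (slice S i h ⊗ₘ 𝟙 (𝟙_ (Corr A))) ≫ (ρ_ (realObj S H)).hom =
        (slice S i h ⊗ₘ 𝟙 (𝟙_ (Corr A))) ≫ realObj S H ◁ T.unitor ≫
          (T.tensorator H (𝟙_ (HilbInd A))).hom ≫ realMap S (ρ_ H).hom := fun i h => by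
    let e := T.unit (BimFgp.unit A) (𝟙 (𝟙_ (Corr A)))
    have h1 := T.hat_tensorator (S.obj i) (BimFgp.unit A) h e
    have h2 := T.rightUnitor_tmul ((S.obj i).tensor (BimFgp.unit A)) (S.obj i) (BimFgp.unit A)
      (𝟙 ((S.obj i).obj ⊗ 𝟙_ (Corr A))) h (𝟙 (𝟙_ (Corr A)))
    have h3 : 𝟙 ((S.obj i).obj ⊗ 𝟙_ (Corr A)) ≫ (S.obj i).obj ◁ 𝟙 (𝟙_ (Corr A)) ≫
        (ρ_ (S.obj i).obj).hom = (ρ_ (S.obj i).obj).hom := by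
      rw [MonoidalCategory.whiskerLeft_id, Category.id_comp, Category.id_comp]
    rw [MonoidalCategory.tensorHom_id, MonoidalCategory.rightUnitor_naturality,
      ← MonoidalCategory.tensorHom_id, ← MonoidalCategory.id_tensorHom,
      MonoidalCategory.tensorHom_comp_tensorHom_assoc, Category.id_comp, Category.comp_id,
      ← hat_irr]
    refine (((Category.assoc _ _ _).symm.trans
      (congrArg (fun u => u ≫ realMap S (ρ_ H).hom) h1)).trans ?_).symm
    refine ((hat_realMap _ _ _).trans (congrArg (hat S _) h2)).trans ?_
    exact (comp_hat _ h).symm.trans (congrArg (fun u => u ≫ hat S (S.obj i) h) h3)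
  refine Corr.hom_ext_of_total (Corr.total_tmul (total_slice H) (Corr.total_id _)) fun p => ?_
  have h4 := Corr.tensorHom_tmul (slice S p.1.1 p.1.2.2) (𝟙 (𝟙_ (Corr A))) p.1.2.1 p.2
  rw [Corr.id_apply] at h4
  rw [← h4]
  exact congrArg (fun u : (S.obj p.1.1).obj ⊗ 𝟙_ (Corr A) ⟶ _ => u (Corr.tmul p.1.2.1 p.2))
    (key p.1.1 p.1.2.2)

/-- The realization is monoidal. -/
abbrev coreMonoidal :
    letI := T.monoidal
    (realization S).CoreMonoidal :=
  letI := T.monoidal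
  { εIso := T.unitor_isUnitary.iso
    μIso := T.tensorator
    μIso_hom_natural_left := fun {X Y} f X' => by
      have h := T.tensorator_natural f (𝟙 X')
      rw [← MonoidalCategory.tensorHom_id, ← MonoidalCategory.tensorHom_id,
        ← (realization S).map_id]
      exact h
    μIso_hom_natural_right := fun {X Y} X' f => by
      have h := T.tensorator_natural (𝟙 X') f
      rw [← MonoidalCategory.id_tensorHom, ← MonoidalCategory.id_tensorHom,
        ← (realization S).map_id]
      exact h
    associativity := T.tensorator_associativity
    left_unitality := T.tensorator_left_unitality
    right_unitality := T.tensorator_right_unitality }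

end IndTensor

end CStarCorr

end

theorem mainTheorem8 {A : Type u} [CStarAlgebra A] [PartialOrder A] [StarOrderedRing A]
    [Nontrivial A] (hA : Subalgebra.center ℂ A = ⊥) :
    Nonempty (CStarCorr.IrrSystem A) ∧
    ∀ S : CStarCorr.IrrSystem A,
      (CStarCorr.realization S).Full ∧ (CStarCorr.realization S).Faithful ∧
      (∀ (H G : CStarCorr.HilbInd A) (f g : H ⟶ G), (CStarCorr.realization S).map (f + g) =
        (CStarCorr.realization S).map f + (CStarCorr.realization S).map g) ∧
      (∀ (H G : CStarCorr.HilbInd A) (c : ℂ) (f : H ⟶ G),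
        (CStarCorr.realization S).map (c • f) = c • (CStarCorr.realization S).map f) ∧
      (∀ (H G : CStarCorr.HilbInd A) (f : H ⟶ G),
        (CStarCorr.realization S).map (CStarCorr.HilbInd.adj f) =
          CStarCorr.Corr.adj ((CStarCorr.realization S).map f)) ∧
      Nonempty (CStarCorr.IndTensor S) ∧
      ∀ T : CStarCorr.IndTensor S,
        letI := T.monoidal
        ∃ _ : (CStarCorr.realization S).Monoidal,
          CStarCorr.Corr.IsUnitary (Functor.LaxMonoidal.ε (CStarCorr.realization S)) ∧
          ∀ H G : CStarCorr.HilbInd A,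
            CStarCorr.Corr.IsUnitary (Functor.LaxMonoidal.μ (CStarCorr.realization S) H G) := by
  have : Fact (CStarCorr.TrivialCenter A) := ⟨CStarCorr.trivialCenter_of_center_eq_bot hA⟩
  refine ⟨CStarCorr.nonempty_irrSystem, fun S => ⟨inferInstance, inferInstance,
    fun H G f g => CStarCorr.realMap_add S f g, fun H G c f => CStarCorr.realMap_smul S c f,
    fun H G f => CStarCorr.realMap_adj S f, ⟨CStarCorr.indTensor S⟩, fun T => ?_⟩⟩
  let _ := T.monoidal
  exact ⟨T.coreMonoidal.toMonoidal, T.unitor_isUnitary, T.tensorator_isUnitary⟩
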